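/- **Setting.** Let $K,n,L,J\ge 1$ be integers, $M=2^J$, $0<p_a<1$. Each of $K$ users is independently active with probability $p_a$; an active user $k$ has a uniform message $W_k\in[M]$, an inactive one has $W_k=0$. Thus $K_a\sim\mathrm{Binom}(K,p_a)$; put $P_{K_a}(k)=\binom Kk p_a^k(1-p_a)^{K-k}$. User $k$ has codewords $\mathbf x_{k,1},\dots,\mathbf x_{k,M}\in\mathbb C^n$ with $\|\mathbf x_{k,m}\|_2^2\le nP$. The receiver, which has $L$ antennas and knows neither the fading nor $K_a$, observes $\mathbf Y=\sum_{k:\,W_k\ne0}\mathbf x_{k,W_k}\mathbf h_k^{T}+\mathbf Z\in\mathbb C^{n\times L}$ with i.i.d. $\mathcal{CN}(0,1)$ entries of $\mathbf h_k\in\mathbb C^L$ and $\mathbf Z$, and outputs $(\hat W_k)_k\in\{0,\dots,M\}^K$. With $\mathcal K_a=\{W_k\neq0\}$ and $\hat{\mathcal K}_a=\{\hat W_k\ne0\}$, $$P_{\rm MD}=\mathbb E\Big[1[K_a>0]\tfrac1{K_a}\sum_{k\in\mathcal K_a}1[W_k\ne\hat W_k]\Big],\qquad P_{\rm FA}=\mathbb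 E\Big[1[|\hat{\mathcal K}_a|>0]\tfrac1{|\hat{\mathcal K}_a|}\sum_{k\in\hat{\mathcal K}_a}1[\hat W_k\ne W_k]\Big].$$ A code consists of codebooks and a decoder, which may both depend on a common random variable known in advance to users and receiver and independent of everything else (randomized coding); $P_{\rm MD}$ and $P_{\rm FA}$ are averaged over it, and the power constraint holds for each of its values. $E^*_b(n,M,\epsilon_{\rm MD},\epsilon_{\rm FA})$ is the infimum of $nP/J$ over all $P>0$ for which there is a code of power $P$ with $P_{\rm MD}\le\epsilon_{\rm MD}$ and $P_{\rm FA}\le\epsilon_{\rm FA}$ (infimum over the empty set $=+\infty$). **Scheme.** Let $0<P'<P$ and let $r'\ge0$ be an integer (decoding radius). Draw codebooks $\mathbf c_{k,m}$ with i.i.d. $\mathcal{CN}(0,P')$ entries, and send $\mathbf x_{k,m}=\mathbf c_{k,m}1[\|\mathbf c_{k,m}\|^2\le nP]$. The receiver computes a minimizer $\mathrm K_a'$ over $\{0,\dots,K\}$ of $\big|\|\mathbf Y\|_F^2-nL(1+\mathrm K P')\big|$ as a function of $\mathrm K$, sets $\mathrm K'_{a,l}=\max\{0,\mathrm K'_a-r'\}$,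 $\mathrm K'_{a,u}=\min\{K,\mathrm K'_a+r'\}$, and outputs a set $\hat{\mathcal K}_a$ with $|\hat{\mathcal K}_a|\in[\mathrm K'_{a,l},\mathrm K'_{a,u}]$ and one message for each of its users, with codewords $\hat{\mathbf c}_{(k)}$, so as to minimize $L\ln|\mathbf G|+\operatorname{tr}(\mathbf G^{-1}\mathbf Y\mathbf Y^H)-\ln\big(P_{K_a}(|\hat{\mathcal K}_a|)M^{-|\hat{\mathcal K}_a|}\big)$, where $\mathbf G=\mathbf I_n+\sum_{k\in\hat{\mathcal K}_a}\hat{\mathbf c}_{(k)}\hat{\mathbf c}_{(k)}^H$; ties are broken in any measurable way. **Bounds.** Write $x^+=\max\{x,0\}$ and $\bar\gamma(s,x)=\gamma(s,x)/\Gamma(s)$ (lower incomplete gamma function), with $\bar\gamma(s,x)=0$ for $x\le 0$ and $\bar\gamma(0,x)=1$ for $x>0$. For $\mathrm K_a,\mathrm K_a',t,t'$ put $a=(\mathrm K_a-\mathrm K'_{a,u})^+$, $c=(\mathrm K'_{a,l}-\mathrm K_a)^+$, $s_1=t+a$, $s_2=t'+c$, $\hat{\mathrm K}_a=\mathrm K_a-s_1+s_2$,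 and $$\mathcal T=[0:\min\{\mathrm K_a,\mathrm K'_{a,u}\}],\qquad \bar{\mathcal T}_t=[(a-(\mathrm K_a-\mathrm K'_{a,l})^++t)^+:(\mathrm K'_{a,u}-\mathrm K_a)^+-c+t],$$ $$\mathcal T_t=[(a-c+\max\{\mathrm K'_{a,l},1\}-\mathrm K_a+t)^+:(\mathrm K'_{a,u}-\mathrm K_a)^+-c+t],$$ $$p_0=p_aK\big(1-\bar\gamma(n,nP/P')\big),$$ $$B_{\rm MD}(P,P')=p_0+\sum_{\mathrm K_a=1}^KP_{K_a}(\mathrm K_a)\sum_{\mathrm K'_a=0}^K\sum_{t\in\mathcal T}\frac{s_1}{\mathrm K_a}\min\Big\{1,\sum_{t'\in\bar{\mathcal T}_t}p_{\mathrm K_a',t,t'},\,p_{\mathrm K_a\to\mathrm K'_a}\Big\},$$ $$B_{\rm FA}(P,P')=p_0+\sum_{\mathrm K_a=0}^KP_{K_a}(\mathrm K_a)\sum_{\mathrm K'_a=0}^K\sum_{t\in\mathcal T}\sum_{t'\in\mathcal T_t}\frac{s_2}{\hat{\mathrm K}_a}\min\{1,p_{\mathrm K_a',t,t'},p_{\mathrm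 K_a\to\mathrm K'_a}\}.$$ Here, all minima over continuous parameters being infima, $$p_{\mathrm K'_a,t,t'}=\inf_{0\le\omega\le1,\,\nu\ge0}\{q_1(\omega,\nu)+1[s_1>0]\,q_2(\omega,\nu)+1[s_1=0]\,q_{2,0}(\omega,\nu)\}.$$ Let $\mathbf A$ ($n\times \mathrm K_a$) and $\mathbf A'$ ($n\times s_2$) be independent with i.i.d. $\mathcal{CN}(0,P')$ entries, let $S_{1,1}\subset S_1\subset[\mathrm K_a]$ and $S_{2,1}\subset[s_2]$ be fixed sets of columns of sizes $a\le s_1$ and $c$, let $\mathbf A_S$ consist of the columns in $S$, and put $\mathbf F=\mathbf I+\mathbf A\mathbf A^H$, $\mathbf F_1=\mathbf I+\mathbf A_{S_1^c}\mathbf A_{S_1^c}^H$, $\mathbf F'=\mathbf F_1+\mathbf A'\mathbf A'^H$, $\mathbf F''=\mathbf I+\mathbf A_{S_{1,1}^c}\mathbf A_{S_{1,1}^c}^H+\mathbf A'_{S_{2,1}}\mathbf A'^H_{S_{2,1}}$, $\mathbf B=(1+r)\mathbf I-u\mathbf F''^{-1}\mathbf F+u\mathbf F'^{-1}\mathbf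 F-r\omega\mathbf F_1^{-1}\mathbf F$. With $\beta(k)=\ln P_{K_a}(k)-k\ln M$ let $b=\beta(\mathrm K_a)$, $b_1=\beta(\mathrm K_a-s_1)$, $b'=\beta(\hat{\mathrm K}_a)$, $b''=\beta(\mathrm K_a-a+c)$. Then $$q_1=\tbinom{\mathrm K_a}{s_1}\tbinom{K-\min\{\mathrm K_a,\mathrm K'_{a,u}\}+t}{s_2}M^{s_2}\;\mathbb E\Big[\inf_{u,r\ge0,\ \lambda_{\min}(\mathbf B)>0}\exp\{Lrn\nu-ub''+rb+ub'-r\omega b_1\}\exp\{L(u\ln|\mathbf F''|-r\ln|\mathbf F|-u\ln|\mathbf F'|+r\omega\ln|\mathbf F_1|-\ln|\mathbf B|)\}\Big],$$ $$q_2=\tbinom{\mathrm K_a}{s_1}\inf_{\delta\ge0}\Big\{1-\bar\gamma(nL,nL(1+\delta))+\mathbb E\Big[\bar\gamma\Big(Lm,\prod_{i=1}^m\lambda_i^{-1/m}\,\tfrac{X_\delta}{\omega}\Big)\Big]\Big\},$$ $$X_\delta=nL(1+\delta)(1-\omega)-\omega(L\ln|\mathbf F_1|-b_1)+L\ln|\mathbf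 F|-b-nL\nu,$$ $$q_{2,0}=\mathbb E\big[1-\bar\gamma\big(nL,\tfrac{nL\nu}{1-\omega}-L\ln|\mathbf F|+b\big)\big],$$ where $m=\min\{n,s_1\}$ and $\lambda_1,\dots,\lambda_m$ are the nonzero eigenvalues of $\mathbf F_1^{-1}\mathbf A_{S_1}\mathbf A_{S_1}^H$; for $\omega=0$ the factor $\bar\gamma(Lm,\cdot)$ in $q_2$ is read as $1[X_\delta>0]$, and for $\omega=1$ one reads $nL\nu/(1-\omega)=+\infty$, i.e. $q_{2,0}=0$. Finally, with $\theta=1+\frac{\mathrm K'_a+\tilde{\mathrm K}_a}2P'$, $m'=\min\{n,\mathrm K_a\}$ and $\lambda'_1\ge\dots\ge\lambda'_{m'}$ the nonzero eigenvalues of $\mathbf A\mathbf A^H$, $$p_{\mathrm K_a\to\mathrm K_a'}=\min_{\tilde{\mathrm K}_a\in[0:K],\,\tilde{\mathrm K}_a\ne\mathrm K'_a}\{1[\mathrm K'_a<\tilde{\mathrm K}_a]\,p_1+1[\mathrm K_a'>\tilde{\mathrm K}_a]\,p_2\},$$ $$p_1=\min\Big\{\inf_{\eta>0}\Big(\mathbb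 E\Big[\bar\gamma\Big(Lm',\prod_{i=1}^{m'}\lambda_i'^{-1/m'}nL(\theta-\eta)\Big)\Big]+\bar\gamma(nL,nL\eta)\Big),\ \mathbb E\Big[\inf_{\rho\ge0}e^{\rho nL\theta-L\ln|\mathbf I+\rho\mathbf F|}\Big]\Big\},$$ $$p_2=\min\Big\{\inf_{\eta>0}\Big(2-\mathbb E\Big[\bar\gamma\Big(Lm',\tfrac{nL}{\lambda_1'}(\theta-\eta)\Big)\Big]-\bar\gamma(nL,nL\eta)\Big),\ \mathbb E\Big[\inf_{0\le\rho<1/(1+\lambda'_1)}e^{-\rho nL\theta-L\ln|\mathbf I-\rho\mathbf F|}\Big]\Big\}.$$ (For $\mathrm K_a=0$ the product over the $\lambda_i'$ is $1$, the factor $1/\lambda'_1$ in the first term of $p_2$ is omitted, and $\lambda'_1=0$ in its second term.) **Theorem.** For every integer $r'\ge0$: (i) for all $0<P'<P$ the scheme exists, satisfies the power constraint, and, for every measurable choice of the minimizers, $P_{\rm MD}\le B_{\rm MD}(P,P')$ and $P_{\rm FA}\le B_{\rm FA}(P,P')$ (averaged over the random codebooks); (ii) for all $\epsilon_{\rm MD},\epsilon_{\rm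 FA}\ge0$, $$E^*_b(n,M,\epsilon_{\rm MD},\epsilon_{\rm FA})\le\inf\frac{nP}J,$$ the infimum being over all $P>0$ for which there is $P'\in(0,P)$ with $B_{\rm MD}(P,P')\le\epsilon_{\rm MD}$ and $B_{\rm FA}(P,P')\le\epsilon_{\rm FA}$. -/

import Mathlib

open MeasureTheory ProbabilityTheory
open scoped ENNReal NNReal Matrix

noncomputable section

namespace MassiveAccess

/-- The numerical parameters of the random access system: `K` potential users, blocklength `n`,
`L` receive antennas, `J` information bits per active user, activity probability `pa`. -/
structure Model where
  K : ℕ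
  n : ℕ
  L : ℕ
  J : ℕ
  pa : ℝ

namespace Model

/-- Codebook size of every user. -/
def M (S : Model) : ℕ := 2 ^ S.J

/-- A vector of length `n` (a codeword). -/
abbrev Word (S : Model) : Type := Fin S.n → ℂ

/-- The codebooks of all users: user, message, channel use. -/
abbrev Codebook (S : Model) : Type := Fin S.K → Fin S.M → Fin S.n → ℂ

/-- The received signal: channel use, antenna. -/
abbrev Signal (S : Model) : Type := Fin S.n → Fin S.L → ℂ

/-- The fading coefficients: user, antenna. -/
abbrev Fading (S : Model) : Type := Fin S.K → Fin S.L → ℂ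

/-- The messages of all users, `none` standing for an inactive (or not detected) user. -/
abbrev Messages (S : Model) : Type := Fin S.K → Option (Fin S.M)

end Model

/-! ### Gaussian laws -/

/-- The circularly symmetric complex Gaussian law `CN(0, v)`. -/
def complexGaussian (v : ℝ) : Measure ℂ :=
  ((gaussianReal 0 (v / 2).toNNReal).prod (gaussianReal 0 (v / 2).toNNReal)).map
    Complex.measurableEquivRealProd.symm

instance (v : ℝ) : IsProbabilityMeasure (complexGaussian v) :=
  Measure.isProbabilityMeasure_map Complex.measurableEquivRealProd.symm.measurable.aemeasurable

/-- The law of an `a × b` array with i.i.d. `CN(0, v)` entries. -/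
def gaussianArray (a b : ℕ) (v : ℝ) : Measure (Fin a → Fin b → ℂ) :=
  Measure.pi fun _ => Measure.pi fun _ => complexGaussian v

instance (a b : ℕ) (v : ℝ) : IsProbabilityMeasure (gaussianArray a b v) := by
  unfold gaussianArray; infer_instance

/-- The law of the Gaussian codebooks without power constraint: i.i.d. `CN(0, P')` entries. -/
def codebookLaw (S : Model) (P' : ℝ) : Measure S.Codebook :=
  Measure.pi fun _ => gaussianArray S.M S.n P'

instance (S : Model) (P' : ℝ) : IsProbabilityMeasure (codebookLaw S P') := by
  unfold codebookLaw; infer_instance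

/-! ### The channel, the error probabilities and codes -/

/-- Prior law of the messages: users are active independently with probability `pa`, and the
message of an active user is uniform on the `M` messages. -/
def prior (S : Model) (W : S.Messages) : ℝ :=
  ∏ k, (W k).elim (1 - S.pa) fun _ => S.pa / S.M

/-- The set of active users. -/
def activeSet {S : Model} (W : S.Messages) : Finset (Fin S.K) :=
  Finset.univ.filter fun k => W k ≠ none

/-- The channel output `Y = ∑ₖ x₍ₖ₎ hₖ + Z` when the messages are `W`; inactive users send `0`. -/
def received {S : Model} (x : S.Codebook) (W : S.Messages) (h : S.Fading) (z : S.Signal) :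
    S.Signal :=
  fun i l => ∑ k, h k l * (W k).elim 0 (fun m => x k m i) + z i l

/-- Fraction of the active users whose message is not correctly decoded (`0` if nobody is
active). -/
def misdetectionFraction {S : Model} (W V : S.Messages) : ℝ :=
  if 0 < (activeSet W).card then
    (((activeSet W).filter fun k => W k ≠ V k).card : ℝ) / (activeSet W).card
  else 0

/-- Fraction of the detected users whose decoded message is not the transmitted one (`0` if nobody
is detected). -/
def falseAlarmFraction {S : Model} (W V : S.Messages) : ℝ :=
  if 0 < (activeSet V).card then
    (((activeSet V).filter fun k => V k ≠ W k).card : ℝ) / (activeSet V).card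
  else 0

/-- Expectation of `f W Ŵ` over activity, messages, fading `CN(0,1)` and noise `CN(0,1)`, for the
codebooks `x` and the decoder `dec`, which sees the received signal only. -/
def expectedError {S : Model} (f : S.Messages → S.Messages → ℝ) (x : S.Codebook)
    (dec : S.Signal → S.Messages) : ℝ≥0∞ :=
  ∑ W : S.Messages, ENNReal.ofReal (prior S W) *
    ∫⁻ hz : S.Fading × S.Signal, ENNReal.ofReal (f W (dec (received x W hz.1 hz.2)))
      ∂((gaussianArray S.K S.L 1).prod (gaussianArray S.n S.L 1))

/-- A random access code: a common random variable with values in `U`, independent of everything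
else and revealed to the transmitters and the receiver beforehand, an encoder (given by its
codebooks), and a decoder.  A deterministic code is the case of a one-point `U`. -/
structure RandomAccessCode (S : Model) (U : Type) [MeasurableSpace U] where
  law : Measure U
  isProb : IsProbabilityMeasure law
  enc : U → S.Codebook
  measurable_enc : Measurable enc
  dec : U → S.Signal → S.Messages
  measurable_dec : ∀ W, MeasurableSet {q : U × S.Signal | dec q.1 q.2 = W}

namespace RandomAccessCode

variable {S : Model} {U : Type} [MeasurableSpace U]

/-- The maximum power constraint `‖x_{k,m}‖² ≤ nP` for all codewords. -/
def PowerConstraint (c : RandomAccessCode S U) (P : ℝ) : Prop :=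
  ∀ u k m, ∑ i, ‖c.enc u k m i‖ ^ 2 ≤ S.n * P

/-- The per-user probability of misdetection. -/
def misdetection (c : RandomAccessCode S U) : ℝ≥0∞ :=
  ∫⁻ u, expectedError misdetectionFraction (c.enc u) (c.dec u) ∂c.law

/-- The per-user probability of false alarm. -/
def falseAlarm (c : RandomAccessCode S U) : ℝ≥0∞ :=
  ∫⁻ u, expectedError falseAlarmFraction (c.enc u) (c.dec u) ∂c.law

end RandomAccessCode

/-- There is a code with power `P` meeting the misdetection and false-alarm requirements. -/
def HasCode (S : Model) (εMD εFA : ℝ≥0) (P : ℝ) : Prop :=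
  ∃ (U : Type) (_ : MeasurableSpace U) (c : RandomAccessCode S U),
    c.PowerConstraint P ∧ c.misdetection ≤ εMD ∧ c.falseAlarm ≤ εFA

/-- The minimum energy-per-bit: the infimum of `nP/J` over all `P > 0` that admit a code
(`∞` if there is none). -/
def minEnergyPerBit (S : Model) (εMD εFA : ℝ≥0) : ℝ≥0∞ :=
  ⨅ (P : ℝ) (_ : 0 < P) (_ : HasCode S εMD εFA P), ENNReal.ofReal (S.n * P / S.J)

/-! ### Matrix and special function notation -/

/-- `A_T A_Tᴴ` for the submatrix `A_T` formed by the columns of `A` with index in `T`. -/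
def gram {n q : ℕ} (A : Fin q → Fin n → ℂ) (T : Finset (Fin q)) : Matrix (Fin n) (Fin n) ℂ :=
  ∑ j ∈ T, Matrix.vecMulVec (A j) (star (A j))

/-- `ln |B|`, for matrices with positive determinant. -/
def logDet {n : ℕ} (B : Matrix (Fin n) (Fin n) ℂ) : ℝ := Real.log B.det.re

/-- The eigenvalues, with multiplicity, of a matrix with real eigenvalues. -/
def eigs {n : ℕ} (B : Matrix (Fin n) (Fin n) ℂ) : Multiset ℝ :=
  B.charpoly.roots.map Complex.re

/-- The product of the nonzero eigenvalues, with multiplicity. -/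
def prodNonzeroEigs {n : ℕ} (B : Matrix (Fin n) (Fin n) ℂ) : ℝ :=
  ((eigs B).filter fun x => x ≠ 0).prod

/-- The largest eigenvalue of a positive semidefinite matrix. -/
def maxEig {n : ℕ} (B : Matrix (Fin n) (Fin n) ℂ) : ℝ := (eigs B).fold max 0

/-- The lower incomplete gamma function `γ(s, x)`, with `γ(s, x) = 0` for `x ≤ 0`. -/
def lowerGamma (s x : ℝ) : ℝ :=
  if x ≤ 0 then 0 else ∫ y in (0 : ℝ)..x, y ^ (s - 1) * Real.exp (-y)

/-- `γ(s, x) / Γ(s)`.  For `s = 0` this is the limit `s → 0⁺`, that is `1` for `x > 0` and `0` for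
`x ≤ 0`. -/
def gammaRatio (s x : ℝ) : ℝ :=
  if s = 0 then (if 0 < x then 1 else 0) else lowerGamma s x / Real.Gamma s

/-- `P_{K_a}(k)`, the probability of exactly `k` active users. -/
def activeProb (S : Model) (k : ℕ) : ℝ :=
  S.K.choose k * S.pa ^ k * (1 - S.pa) ^ (S.K - k)

/-- `ln P_{K_a}(k) - k ln M`. -/
def logWeight (S : Model) (k : ℕ) : ℝ :=
  Real.log (activeProb S k) - k * Real.log S.M

/-! ### The coding scheme -/

/-- The energy-based metric `| ‖Y‖_F² - nL(1 + k P') |`. -/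
def energyMetric (S : Model) (P' : ℝ) (Y : S.Signal) (k : ℕ) : ℝ :=
  |∑ i, ∑ l, ‖Y i l‖ ^ 2 - S.n * S.L * (1 + k * P')|

/-- `I + ∑ₖ ĉ₍ₖ₎ ĉ₍ₖ₎ᴴ`, the sum over the users detected in `V`. -/
def candidateCov {S : Model} (c : S.Codebook) (V : S.Messages) :
    Matrix (Fin S.n) (Fin S.n) ℂ :=
  1 + ∑ k, (V k).elim 0 fun m => Matrix.vecMulVec (c k m) (star (c k m))

/-- The MAP decoding metric of the candidate `V`. -/
def mapMetric {S : Model} (c : S.Codebook) (Y : S.Signal) (V : S.Messages) : ℝ :=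
  S.L * logDet (candidateCov c V)
    + ((candidateCov c V)⁻¹ * (Matrix.of Y * (Matrix.of Y)ᴴ)).trace.re
    - logWeight S (activeSet V).card

/-- `K'_{a,l} = max {0, K'_a - r'}`. -/
def lowK (r' k' : ℕ) : ℕ := k' - r'

/-- `K'_{a,u} = min {K, K'_a + r'}`. -/
def highK (S : Model) (r' k' : ℕ) : ℕ := min S.K (k' + r')

/-- The receiver of the scheme: a minimizer `est` of the energy metric over `{0, …, K}`, followed
by a minimizer `dec` of the MAP metric over all lists of decoded messages whose size lies in
`[K'_{a,l}, K'_{a,u}]`, where `K'_a = est Y`; ties are broken in an arbitrary measurable way. -/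
structure EnergyMAPReceiver (S : Model) (P' : ℝ) (r' : ℕ) where
  est : S.Signal → ℕ
  measurable_est : Measurable est
  est_le : ∀ Y, est Y ≤ S.K
  est_min : ∀ Y, ∀ k ≤ S.K, energyMetric S P' Y (est Y) ≤ energyMetric S P' Y k
  dec : S.Codebook → S.Signal → S.Messages
  measurable_dec : ∀ W, MeasurableSet {q : S.Codebook × S.Signal | dec q.1 q.2 = W}
  dec_size : ∀ c Y, (activeSet (dec c Y)).card ∈
    Finset.Icc (lowK r' (est Y)) (highK S r' (est Y))
  dec_min : ∀ c Y V, (activeSet V).card ∈ Finset.Icc (lowK r' (est Y)) (highK S r' (est Y)) →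
    mapMetric c Y (dec c Y) ≤ mapMetric c Y V

/-- The codewords `c · 1{‖c‖² ≤ nP}`. -/
def truncate (S : Model) (P : ℝ) (c : S.Codebook) : S.Codebook :=
  fun k m i => if ∑ j, ‖c k m j‖ ^ 2 ≤ S.n * P then c k m i else 0

theorem measurable_truncate (S : Model) (P : ℝ) : Measurable (truncate S P) := by
  refine measurable_pi_lambda _ fun k => measurable_pi_lambda _ fun m =>
    measurable_pi_lambda _ fun i => ?_
  refine Measurable.ite (measurableSet_le ?_ measurable_const) ?_ measurable_const
  · fun_prop
  · fun_prop

/-- The random code of the scheme: Gaussian codebooks with i.i.d. `CN(0, P')` entries, truncated so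
as to satisfy the power constraint, and the energy-based and MAP receiver. -/
def EnergyMAPReceiver.code {S : Model} {P' : ℝ} {r' : ℕ} (φ : EnergyMAPReceiver S P' r') (P : ℝ) :
    RandomAccessCode S S.Codebook where
  law := codebookLaw S P'
  isProb := inferInstance
  enc := truncate S P
  measurable_enc := measurable_truncate S P
  dec := φ.dec
  measurable_dec := φ.measurable_dec

/-! ### The bounds

Throughout, `ka`, `k'`, `t`, `t'` stand for `K_a`, `K'_a`, `t`, `t'`; natural-number subtraction
`a - b` is used for `(a - b)⁺`.  All minima are infima with values in `[0, ∞]`. -/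

/-- `p₀`. -/
def p0 (S : Model) (P P' : ℝ) : ℝ≥0∞ :=
  ENNReal.ofReal (S.pa * S.K * (1 - gammaRatio S.n (S.n * P / P')))

/-- `(K_a - K'_{a,u})⁺ = |S_{1,1}|`. -/
def missForced (S : Model) (r' ka k' : ℕ) : ℕ := ka - highK S r' k'

/-- `(K'_{a,l} - K_a)⁺ = |S_{2,1}|`. -/
def falseForced (r' ka k' : ℕ) : ℕ := lowK r' k' - ka

/-- `t + (K_a - K'_{a,u})⁺ = |S_1|`, the number of misdetected codewords. -/
def missCount (S : Model) (r' ka k' t : ℕ) : ℕ := t + missForced S r' ka k'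

/-- `t' + (K'_{a,l} - K_a)⁺ = |S_2|`, the number of false-alarm codewords. -/
def falseCount (r' ka k' t' : ℕ) : ℕ := t' + falseForced r' ka k'

/-- `K̂_a`, the number of detected codewords. -/
def detCount (S : Model) (r' ka k' t t' : ℕ) : ℕ :=
  ka - missCount S r' ka k' t + falseCount r' ka k' t'

/-- The range of `t`. -/
def rangeT (S : Model) (r' ka k' : ℕ) : Finset ℕ :=
  Finset.Icc 0 (min ka (highK S r' k'))

/-- The range of `t'` in the misdetection bound. -/
def rangeTBar (S : Model) (r' ka k' t : ℕ) : Finset ℕ :=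
  Finset.Icc ((ka - highK S r' k') + t - (ka - lowK r' k'))
    ((highK S r' k' - ka) + t - (lowK r' k' - ka))

/-- The range of `t'` in the false-alarm bound. -/
def rangeT' (S : Model) (r' ka k' t : ℕ) : Finset ℕ :=
  Finset.Icc ((ka - highK S r' k') + max (lowK r' k') 1 + t - ((lowK r' k' - ka) + ka))
    ((highK S r' k' - ka) + t - (lowK r' k' - ka))

/-- `F = I + A_{K_a} A_{K_a}ᴴ`, for the matrix `A` of the `ka` transmitted codewords. -/
def matF {n ka : ℕ} (A : Fin ka → Fin n → ℂ) : Matrix (Fin n) (Fin n) ℂ :=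
  1 + gram A Finset.univ

/-- `I + A_{K_a \ T} A_{K_a \ T}ᴴ`, where `T` consists of the first `s` transmitted codewords.  For
`s = |S_1|` this is `F₁`. -/
def matF1 {n ka : ℕ} (A : Fin ka → Fin n → ℂ) (s : ℕ) : Matrix (Fin n) (Fin n) ℂ :=
  1 + gram A (Finset.univ.filter fun j => s ≤ j.val)

/-- `F' = I + A_{K_a \ S_1} A_{K_a \ S_1}ᴴ + A'_{S_2} A'_{S_2}ᴴ`, with `s = |S_1|`. -/
def matF' {n ka q : ℕ} (A : Fin ka → Fin n → ℂ) (A' : Fin q → Fin n → ℂ) (s : ℕ) :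
    Matrix (Fin n) (Fin n) ℂ :=
  matF1 A s + gram A' Finset.univ

/-- `F'' = I + A_{K_a \ S_{1,1}} A_{K_a \ S_{1,1}}ᴴ + A'_{S_{2,1}} A'_{S_{2,1}}ᴴ`, with
`a = |S_{1,1}|` and `c = |S_{2,1}|`. -/
def matF'' {n ka q : ℕ} (A : Fin ka → Fin n → ℂ) (A' : Fin q → Fin n → ℂ) (a c : ℕ) :
    Matrix (Fin n) (Fin n) ℂ :=
  matF1 A a + gram A' (Finset.univ.filter fun j => j.val < c)

/-- `B = (1 + r) I - u F''⁻¹ F + u F'⁻¹ F - r ω F₁⁻¹ F`. -/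
def matB {n : ℕ} (F F1 F' F'' : Matrix (Fin n) (Fin n) ℂ) (ω u r : ℝ) :
    Matrix (Fin n) (Fin n) ℂ :=
  ((1 + r : ℝ) : ℂ) • 1 - (u : ℂ) • (F''⁻¹ * F) + (u : ℂ) • (F'⁻¹ * F)
    - ((r * ω : ℝ) : ℂ) • (F1⁻¹ * F)

/-- `b = ln P_{K_a}(K_a) - K_a ln M`. -/
def bConst (S : Model) (ka : ℕ) : ℝ := logWeight S ka

/-- `b₁`. -/
def b1Const (S : Model) (r' ka k' t : ℕ) : ℝ := logWeight S (ka - missCount S r' ka k' t)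

/-- `b'`. -/
def b'Const (S : Model) (r' ka k' t t' : ℕ) : ℝ := logWeight S (detCount S r' ka k' t t')

/-- `b''`. -/
def b''Const (S : Model) (r' ka k' : ℕ) : ℝ :=
  logWeight S (ka - missForced S r' ka k' + falseForced r' ka k')

/-- `C_{K'_a,t,t'}`. -/
def combCount (S : Model) (r' ka k' t t' : ℕ) : ℕ :=
  ka.choose (missCount S r' ka k' t) *
    (S.K - min ka (highK S r' k') + t).choose (falseCount r' ka k' t') *
    S.M ^ falseCount r' ka k' t'

/-- `q_{1,K'_a,t,t'}(ω, ν)`.  The expectation is over the transmitted codewords `A` and the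
false-alarm codewords `A'`. -/
def q1 (S : Model) (P' : ℝ) (r' ka k' t t' : ℕ) (ω ν : ℝ) : ℝ≥0∞ :=
  (combCount S r' ka k' t t' : ℝ≥0∞) *
    ∫⁻ A : (Fin ka → Fin S.n → ℂ) × (Fin (falseCount r' ka k' t') → Fin S.n → ℂ),
      (let F := matF A.1
       let F1 := matF1 A.1 (missCount S r' ka k' t)
       let F' := matF' A.1 A.2 (missCount S r' ka k' t)
       let F'' := matF'' A.1 A.2 (missForced S r' ka k') (falseForced r' ka k')
       ⨅ (u : ℝ) (r : ℝ) (_ : 0 ≤ u ∧ 0 ≤ r ∧ ∀ x ∈ eigs (matB F F1 F' F'' ω u r), 0 < x),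
        ENNReal.ofReal
          (Real.exp (S.L * r * S.n * ν
              + (-(u * b''Const S r' ka k') + r * bConst S ka + u * b'Const S r' ka k' t t'
                  - r * ω * b1Const S r' ka k' t))
            * Real.exp (S.L * (u * logDet F'' - r * logDet F - u * logDet F'
                + r * ω * logDet F1 - logDet (matB F F1 F' F'' ω u r)))))
      ∂((gaussianArray ka S.n P').prod (gaussianArray (falseCount r' ka k' t') S.n P'))

/-- The numerator `nL(1+δ)(1-ω) - ω(L ln|F₁| - b₁) + L ln|F| - b - nLν`. -/
def q2Numerator (S : Model) (r' ka k' t : ℕ) (A : Fin ka → Fin S.n → ℂ) (ω ν δ : ℝ) : ℝ :=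
  S.n * S.L * (1 + δ) * (1 - ω)
    - ω * (S.L * logDet (matF1 A (missCount S r' ka k' t)) - b1Const S r' ka k' t)
    + S.L * logDet (matF A) - bConst S ka - S.n * S.L * ν

/-- The integrand `γ(Lm, ∏ λᵢ^{-1/m} X/ω) / Γ(Lm)` of the second expectation.  At `ω = 0` the
quotient `X/ω` is `+∞` for `X > 0` (so that the integrand is `1`) and the integrand is `0` for
`X ≤ 0`. -/
def q2Integrand (S : Model) (r' ka k' t : ℕ) (A : Fin ka → Fin S.n → ℂ) (ω ν δ : ℝ) : ℝ :=
  let s := missCount S r' ka k' t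
  let m := min S.n s
  let X := q2Numerator S r' ka k' t A ω ν δ
  let lam := prodNonzeroEigs
    ((matF1 A s)⁻¹ * gram A (Finset.univ.filter fun j => j.val < s))
  if ω = 0 then (if 0 < X then 1 else 0)
  else gammaRatio ((S.L * m : ℕ) : ℝ) (lam ^ (-(1 / (m : ℝ))) * (X / ω))

/-- `q_{2,K'_a,t}(ω, ν)`, used when `|S_1| > 0`. -/
def q2 (S : Model) (P' : ℝ) (r' ka k' t : ℕ) (ω ν : ℝ) : ℝ≥0∞ :=
  (ka.choose (missCount S r' ka k' t) : ℝ≥0∞) *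
    ⨅ (δ : ℝ) (_ : 0 ≤ δ),
      (ENNReal.ofReal
          (1 - gammaRatio ((S.n * S.L : ℕ) : ℝ) (S.n * S.L * (1 + δ)))
        + ∫⁻ A, ENNReal.ofReal (q2Integrand S r' ka k' t A ω ν δ) ∂(gaussianArray ka S.n P'))

/-- `q_{2,K'_a,t,0}(ω, ν)`, used when `S_1` is empty.  At `ω = 1` the quotient `nLν/(1-ω)` is
`+∞`. -/
def q20 (S : Model) (P' : ℝ) (ka : ℕ) (ω ν : ℝ) : ℝ≥0∞ :=
  if ω = 1 then 0
  else ∫⁻ A, ENNReal.ofReal (1 - gammaRatio ((S.n * S.L : ℕ) : ℝ)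
      (S.n * S.L * ν / (1 - ω) - S.L * logDet (matF A) + bConst S ka)) ∂(gaussianArray ka S.n P')

/-- `p_{K'_a,t,t'}`. -/
def pErr (S : Model) (P' : ℝ) (r' ka k' t t' : ℕ) : ℝ≥0∞ :=
  ⨅ (ω : ℝ) (ν : ℝ) (_ : 0 ≤ ω ∧ ω ≤ 1 ∧ 0 ≤ ν),
    (q1 S P' r' ka k' t t' ω ν
      + if 0 < missCount S r' ka k' t then q2 S P' r' ka k' t ω ν else q20 S P' ka ω ν)

/-- `1 + (K'_a + K̃_a)/2 · P'`. -/
def threshold (P' : ℝ) (k' kt : ℕ) : ℝ := 1 + ((k' : ℝ) + kt) / 2 * P'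

/-- `p_{K_a → K'_a, 1}`. -/
def pEst1 (S : Model) (P' : ℝ) (ka k' kt : ℕ) : ℝ≥0∞ :=
  min
    (⨅ (η : ℝ) (_ : 0 < η),
      ((∫⁻ A, ENNReal.ofReal (gammaRatio ((S.L * min S.n ka : ℕ) : ℝ)
          (prodNonzeroEigs (gram A Finset.univ) ^ (-(1 / ((min S.n ka : ℕ) : ℝ)))
            * (S.n * S.L * (threshold P' k' kt - η)))) ∂(gaussianArray ka S.n P'))
        + ENNReal.ofReal (gammaRatio ((S.n * S.L : ℕ) : ℝ) (S.n * S.L * η))))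
    (∫⁻ A, (⨅ (ρ : ℝ) (_ : 0 ≤ ρ),
        ENNReal.ofReal (Real.exp (ρ * S.n * S.L * threshold P' k' kt
          - S.L * logDet (1 + (ρ : ℂ) • matF A)))) ∂(gaussianArray ka S.n P'))

/-- `p_{K_a → K'_a, 2}`; `2 - E[X] - y` is written as `E[1 - X] + (1 - y)`.  For `K_a = 0` there is
no positive eigenvalue, and the factor `1/λ'₁` (irrelevant, since the first argument of the gamma
ratio is then `0`) is omitted. -/
def pEst2 (S : Model) (P' : ℝ) (ka k' kt : ℕ) : ℝ≥0∞ :=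
  min
    (⨅ (η : ℝ) (_ : 0 < η),
      ((∫⁻ A, ENNReal.ofReal (1 - gammaRatio ((S.L * min S.n ka : ℕ) : ℝ)
          (S.n * S.L / (if ka = 0 then 1 else maxEig (gram A Finset.univ))
            * (threshold P' k' kt - η))) ∂(gaussianArray ka S.n P'))
        + ENNReal.ofReal (1 - gammaRatio ((S.n * S.L : ℕ) : ℝ) (S.n * S.L * η))))
    (∫⁻ A, (⨅ (ρ : ℝ) (_ : 0 ≤ ρ ∧ ρ < 1 / (1 + maxEig (gram A Finset.univ))),
        ENNReal.ofReal (Real.exp (-(ρ * S.n * S.L * threshold P' k' kt)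
          - S.L * logDet (1 - (ρ : ℂ) • matF A)))) ∂(gaussianArray ka S.n P'))

/-- `p_{K_a → K'_a}`. -/
def pEst (S : Model) (P' : ℝ) (ka k' : ℕ) : ℝ≥0∞ :=
  ⨅ (kt : ℕ) (_ : kt ≤ S.K ∧ kt ≠ k'),
    if k' < kt then pEst1 S P' ka k' kt else pEst2 S P' ka k' kt

/-- The upper bound on the per-user probability of misdetection, for a given `P'`. -/
def boundMD (S : Model) (r' : ℕ) (P P' : ℝ) : ℝ≥0∞ :=
  p0 S P P' +
    ∑ ka ∈ Finset.Icc 1 S.K, ENNReal.ofReal (activeProb S ka) *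
      ∑ k' ∈ Finset.Icc 0 S.K, ∑ t ∈ rangeT S r' ka k',
        (missCount S r' ka k' t : ℝ≥0∞) / (ka : ℝ≥0∞) *
          min 1 (min (∑ t' ∈ rangeTBar S r' ka k' t, pErr S P' r' ka k' t t') (pEst S P' ka k'))

/-- The upper bound on the per-user probability of false alarm, for a given `P'`. -/
def boundFA (S : Model) (r' : ℕ) (P P' : ℝ) : ℝ≥0∞ :=
  p0 S P P' +
    ∑ ka ∈ Finset.Icc 0 S.K, ENNReal.ofReal (activeProb S ka) *
      ∑ k' ∈ Finset.Icc 0 S.K, ∑ t ∈ rangeT S r' ka k', ∑ t' ∈ rangeT' S r' ka k' t,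
        (falseCount r' ka k' t' : ℝ≥0∞) / (detCount S r' ka k' t t' : ℝ≥0∞) *
          min 1 (min (pErr S P' r' ka k' t t') (pEst S P' ka k'))

end MassiveAccess

end

/-!
The bounds rest on one conditional fact. Given the codewords, fading and noise combine to a signal
`Y` whose columns are independent `CN(0, F)` with `F = I + A Aᴴ` (`isCN_fading_add_noise`), so every
error event becomes an inequality between quadratic forms `tr (Q Y Yᴴ)`. A positive definite `F` and
a Hermitian `Q` are simultaneously diagonalizable, which turns such a form into a weighted sum of
squares of i.i.d. Gaussian variables, the weights being the eigenvalues of `Q F`. Three estimates on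
these sums are used:
* their Laplace transform, hence the Chernoff bound (`IsCN.measure_le_exp`);
* the exact law for equal weights, an incomplete gamma function (`stdGaussian_sq_norm_le`);
* Okamoto's inequality (`stdGaussian_weighted_sq_norm_le`): a small deviation is at most as likely as
  it is with all weights replaced by their geometric mean.

*Estimate of the number of users.* If the energy estimator outputs `k'`, the received energy lies on
the side of `k'` of the midpoint belonging to any competing `kt`. The Chernoff bound gives the
exponential terms. Splitting the energy as `tr (F⁻¹ Y Yᴴ) + tr ((I - F⁻¹) Y Yᴴ)` gives the terms with
incomplete gamma functions (`jointLaw_est_eq_le`).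

*Decoding.* Let `T` be the set of misdetected users of the decoded list `V`. The transmitted list is
compared with itself after removal of `T`; it is good for `T` if its metric exceeds `ω` times the
metric of the shortened list by at most `nLν`. The probability that it is not good is bounded with
Okamoto's inequality and yields `q₂`, or `q₂₀` if `T` is empty (`jointLaw_not_isGood_le`). If it is
good, then `V` has beaten the transmitted list modified by the errors that the range of admissible
list sizes forces; the Chernoff bound with one multiplier for each of these two inequalities, times
the number of possible `V`, is `q₁` (`jointLaw_dec_eq_le`,
`card_filter_card_missSet_card_falseSet_le`). The union bound gives `pErr`
(`jointLaw_card_errors_le`).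

*Averaging.* The error fractions are functions of the estimate and of the numbers of misdetections
and of false alarms, and these three determine `t` and `t'`. Truncating the codewords changes the
received signal only if an active user has a codeword that is too long, which costs `p₀`. The sizes
of the sets of active users are binomial.

The receiver exists because finitely many measurable functions have a measurable minimizer, and the
bound on the energy per bit follows since the scheme is a code.
-/

noncomputable section

namespace MassiveAccess

open scoped ComplexOrder

/-! ### Finite product measures -/

theorem measurePreserving_uncurry {α β X : Type*} [Fintype α] [Fintype β] [MeasurableSpace X]
    (μ : Measure X) [IsProbabilityMeasure μ] :
    MeasurePreserving (fun (f : α → β → X) (p : α × β) => f p.1 p.2)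
      (Measure.pi fun _ => Measure.pi fun _ => μ) (Measure.pi fun _ => μ) := by
  refine ⟨by fun_prop, ?_⟩
  refine (Measure.pi_eq fun s hs => ?_).symm
  rw [Measure.map_apply (by fun_prop) (MeasurableSet.univ_pi hs)]
  have : (fun (f : α → β → X) (p : α × β) => f p.1 p.2) ⁻¹' Set.univ.pi s
      = Set.univ.pi fun a => Set.univ.pi fun b => s (a, b) := by
    ext f
    simp [Set.mem_pi]
  rw [this, Measure.pi_pi]
  simp_rw [Measure.pi_pi]
  rw [← Finset.univ_product_univ, Finset.prod_product]

theorem measurePreserving_comp_injective {ι κ X : Type*} [Fintype ι] [Fintype κ]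
    [MeasurableSpace X] (μ : Measure X) [IsProbabilityMeasure μ] {e : ι → κ}
    (he : Function.Injective e) :
    MeasurePreserving (fun (f : κ → X) (i : ι) => f (e i))
      (Measure.pi fun _ => μ) (Measure.pi fun _ => μ) := by
  refine ⟨by fun_prop, ?_⟩
  refine (Measure.pi_eq fun s hs => ?_).symm
  rw [Measure.map_apply (by fun_prop) (MeasurableSet.univ_pi hs)]
  have : (fun (f : κ → X) (i : ι) => f (e i)) ⁻¹' Set.univ.pi s
      = Set.univ.pi fun k => {x | ∀ i, e i = k → x ∈ s i} := by
    ext f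
    simp only [Set.mem_preimage, Set.mem_pi, Set.mem_univ, true_implies, Set.mem_ofPred_eq]
    exact ⟨fun h k i hi => hi ▸ h i, fun h i => h _ i rfl⟩
  rw [this, Measure.pi_pi]
  refine (Fintype.prod_of_injective e he _ _ (fun k hk => ?_) fun i => ?_).symm
  · have : {x : X | ∀ i, e i = k → x ∈ s i} = Set.univ := by
      ext x
      simp only [Set.mem_ofPred_eq, Set.mem_univ, iff_true]
      exact fun i hi => absurd ⟨i, hi⟩ hk
    rw [this, measure_univ]
  · congr 1
    ext x
    simp only [Set.mem_ofPred_eq]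
    exact ⟨fun h j hj => he hj ▸ h, fun h => h i rfl⟩

/-- Tonelli's theorem for a product of functions of the single coordinates. -/
theorem lintegral_pi_prod {ι X : Type*} [Fintype ι] [MeasurableSpace X]
    (μ : ι → Measure X) [∀ i, SigmaFinite (μ i)] (f : ι → X → ℝ≥0∞) (hf : ∀ i, Measurable (f i)) :
    ∫⁻ x, ∏ i, f i (x i) ∂(Measure.pi μ) = ∏ i, ∫⁻ x, f i x ∂(μ i) := by
  have hfin : ∀ (n : ℕ) (μ : Fin n → Measure X) [∀ i, SigmaFinite (μ i)] (f : Fin n → X → ℝ≥0∞),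
      (∀ i, Measurable (f i)) →
      ∫⁻ x, ∏ i, f i (x i) ∂(Measure.pi μ) = ∏ i, ∫⁻ x, f i x ∂(μ i) := by
    intro n
    induction n with
    | zero => intro μ _ f _; simp
    | succ n ih =>
      intro μ _ f hf
      rw [← ((measurePreserving_piFinSuccAbove μ 0).symm).lintegral_comp_emb
        (MeasurableEquiv.measurableEmbedding _)]
      have : ∀ x : X × (Fin n → X), (∏ i, f i
          (((MeasurableEquiv.piFinSuccAbove (fun _ => X) (0 : Fin (n + 1))).symm x) i))
          = f 0 x.1 * ∏ i : Fin n, f i.succ (x.2 i) := by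
        intro x
        rw [Fin.prod_univ_succ]
        simp [MeasurableEquiv.piFinSuccAbove_symm_apply, Fin.insertNthEquiv]
      simp_rw [this]
      have hg : Measurable fun y : Fin n → X => ∏ i : Fin n, f i.succ (y i) :=
        Finset.measurable_prod _ fun i _ => (hf _).comp (measurable_pi_apply i)
      rw [lintegral_prod_mul (hf 0).aemeasurable hg.aemeasurable,
        Fin.prod_univ_succ, ← ih (fun i => μ i.succ) (fun i => f i.succ) fun i => hf _]
      simp
  -- reindexing reduces the claim to `Fin n`
  let e := (Fintype.equivFin ι).symm
  rw [← (measurePreserving_piCongrLeft μ e).lintegral_comp_emb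
    (MeasurableEquiv.measurableEmbedding _), ← e.prod_comp, ← hfin _ _ _ fun i => hf _]
  refine lintegral_congr fun x => ?_
  rw [← e.prod_comp]
  refine Finset.prod_congr rfl fun i _ => ?_
  congr 1
  exact Equiv.piCongrLeft_apply_apply (fun _ => X) e x i

theorem pi_withDensity {ι X : Type*} [Fintype ι] [MeasurableSpace X]
    (μ : Measure X) [SigmaFinite μ] (f : X → ℝ≥0∞) (hf : Measurable f)
    [SigmaFinite (μ.withDensity f)] :
    (Measure.pi fun _ : ι => μ.withDensity f)
      = (Measure.pi fun _ : ι => μ).withDensity fun x => ∏ i, f (x i) := by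
  refine Measure.pi_eq fun s hs => ?_
  rw [withDensity_apply _ (MeasurableSet.univ_pi hs),
    ← lintegral_indicator (MeasurableSet.univ_pi hs)]
  have : (Set.univ.pi s).indicator (fun x : ι → X => ∏ i, f (x i))
      = fun x => ∏ i, (s i).indicator f (x i) := by
    ext x
    by_cases hx : x ∈ Set.univ.pi s
    · rw [Set.indicator_of_mem hx]
      exact Finset.prod_congr rfl fun i _ => (Set.indicator_of_mem (hx i trivial) _).symm
    · rw [Set.indicator_of_notMem hx]
      simp only [Set.mem_pi, Set.mem_univ, true_implies, not_forall] at hx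
      obtain ⟨i, hi⟩ := hx
      exact (Finset.prod_eq_zero (Finset.mem_univ i) (Set.indicator_of_notMem hi _)).symm
  rw [this, lintegral_pi_prod _ _ fun i => hf.indicator (hs i)]
  refine Finset.prod_congr rfl fun i _ => ?_
  rw [lintegral_indicator (hs i), withDensity_apply _ (hs i)]

/-! ### The complex Gaussian law -/

theorem complexGaussian_one_eq_withDensity :
    complexGaussian 1
      = volume.withDensity fun z => ENNReal.ofReal (Real.pi⁻¹ * Real.exp (-‖z‖ ^ 2)) := by
  have hv : (1 / 2 : ℝ).toNNReal ≠ 0 := by simp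
  rw [complexGaussian, gaussianReal_of_var_ne_zero _ hv,
    prod_withDensity (measurable_gaussianPDF _ _) (measurable_gaussianPDF _ _)]
  ext s hs
  have hm : MeasurableSet (Complex.measurableEquivRealProd.symm ⁻¹' s) :=
    Complex.measurableEquivRealProd.symm.measurable hs
  rw [Measure.map_apply Complex.measurableEquivRealProd.symm.measurable hs,
    withDensity_apply _ hm, withDensity_apply _ hs,
    ← (Complex.volume_preserving_equiv_real_prod.symm).setLIntegral_comp_preimage hs (by fun_prop)]
  refine setLIntegral_congr_fun hm fun z _ => ?_
  rw [gaussianPDF, gaussianPDF, ← ENNReal.ofReal_mul (gaussianPDFReal_nonneg _ _ _)]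
  congr 1
  rw [gaussianPDFReal, gaussianPDFReal, mul_mul_mul_comm, ← Real.exp_add, ← mul_inv,
    Real.mul_self_sqrt (by positivity), Complex.sq_norm, Complex.normSq_apply]
  have h : ((1 / 2 : ℝ).toNNReal : ℝ) = 1 / 2 := Real.coe_toNNReal _ (by norm_num)
  rw [h]
  congr 2
  · ring
  · simp
    ring

theorem complexGaussian_eq_map {v : ℝ} (hv : 0 ≤ v) :
    complexGaussian v = (complexGaussian 1).map fun z => (Real.sqrt v : ℂ) * z := by
  have h1 : gaussianReal 0 (v / 2).toNNReal
      = (gaussianReal 0 (1 / 2 : ℝ).toNNReal).map fun x => Real.sqrt v * x := by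
    rw [gaussianReal_map_const_mul]
    congr 1
    · simp
    · ext
      simp [Real.sq_sqrt hv]
      rw [max_eq_left (by positivity)]; ring
  rw [complexGaussian, complexGaussian, h1, Measure.map_prod_map _ _ (by fun_prop) (by fun_prop),
    Measure.map_map (by fun_prop) (by fun_prop), Measure.map_map (by fun_prop) (by fun_prop)]
  congr 1
  ext ⟨x, y⟩
  apply Complex.ext <;> simp [Complex.measurableEquivRealProd]

theorem charFunDual_complexGaussian_one (L : StrongDual ℝ ℂ) :
    charFunDual (complexGaussian 1) L
      = Complex.exp (-(((L 1) ^ 2 + (L Complex.I) ^ 2) / 4 : ℝ)) := by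
  have hreal : ∀ M : StrongDual ℝ ℝ, charFunDual (gaussianReal 0 (1 / 2 : ℝ).toNNReal) M
      = Complex.exp (-((M 1) ^ 2 / 4 : ℝ)) := by
    intro M
    rw [charFunDual_eq_charFun_map_one, gaussianReal_map_continuousLinearMap, charFun_gaussianReal]
    congr 1
    simp only [map_zero, Complex.ofReal_zero, zero_mul, mul_zero, zero_sub, NNReal.coe_mul,
      Real.coe_toNNReal _ (sq_nonneg (M 1)), Real.coe_toNNReal (1 / 2 : ℝ) (by norm_num)]
    push_cast
    ring
  have hmap : complexGaussian 1 = ((gaussianReal 0 (1 / 2 : ℝ).toNNReal).prod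
      (gaussianReal 0 (1 / 2 : ℝ).toNNReal)).map
        (Complex.equivRealProdCLM.symm : ℝ × ℝ →L[ℝ] ℂ) := rfl
  rw [hmap, charFunDual_map, charFunDual_prod, hreal, hreal, ← Complex.exp_add]
  congr 1
  have e1 : (Complex.equivRealProdCLM.symm : ℝ × ℝ →L[ℝ] ℂ) (1, 0) = 1 := by
    apply Complex.ext <;> simp
  have e2 : (Complex.equivRealProdCLM.symm : ℝ × ℝ →L[ℝ] ℂ) (0, 1) = Complex.I := by
    apply Complex.ext <;> simp
  simp only [ContinuousLinearMap.comp_apply, ContinuousLinearMap.inl_apply,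
    ContinuousLinearMap.inr_apply, e1, e2]
  push_cast
  ring

/-- `E exp(-d |z|²) = 1 / (1 + d)`. -/
theorem lintegral_exp_neg_mul_sq_complexGaussian {d : ℝ} (hd : -1 < d) :
    ∫⁻ z, ENNReal.ofReal (Real.exp (-d * ‖z‖ ^ 2)) ∂(complexGaussian 1)
      = ENNReal.ofReal (1 + d)⁻¹ := by
  have hb : 0 < 1 + d := by linarith
  rw [complexGaussian_one_eq_withDensity,
    lintegral_withDensity_eq_lintegral_mul _ (by fun_prop) (by fun_prop)]
  have h := GaussianFourier.integral_rexp_neg_mul_sq_norm (V := ℂ) hb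
  rw [Complex.finrank_real_complex] at h
  -- the integral is known and nonzero, hence not a junk value
  have hi : Integrable fun z : ℂ => Real.exp (-(1 + d) * ‖z‖ ^ 2) := by
    by_contra hc
    rw [integral_undef hc] at h
    have : 0 < (Real.pi / (1 + d)) ^ ((2 : ℕ) / 2 : ℝ) := by positivity
    linarith
  have h2 : ∀ z : ℂ, ((fun z : ℂ => ENNReal.ofReal (Real.pi⁻¹ * Real.exp (-‖z‖ ^ 2))) *
      fun z : ℂ => ENNReal.ofReal (Real.exp (-d * ‖z‖ ^ 2))) z
      = ENNReal.ofReal (Real.pi⁻¹ * Real.exp (-(1 + d) * ‖z‖ ^ 2)) := by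
    intro z
    rw [Pi.mul_apply, ← ENNReal.ofReal_mul (by positivity), mul_assoc, ← Real.exp_add]
    congr 3
    ring
  simp_rw [h2]
  rw [← ofReal_integral_eq_lintegral_ofReal (hi.const_mul _) (ae_of_all _ fun z => by positivity),
    integral_const_mul, h]
  congr 1
  norm_num
  field_simp

/-! ### Weighted sums of squares of Gaussian variables -/

/-- The standard complex Gaussian law on `ι → ℂ`. -/
abbrev stdGaussian (ι : Type*) [Fintype ι] : Measure (ι → ℂ) :=
  Measure.pi fun _ => complexGaussian 1

theorem stdGaussian_eq_withDensity (ι : Type*) [Fintype ι] :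
    stdGaussian ι = volume.withDensity fun z =>
      ENNReal.ofReal (Real.pi⁻¹ ^ Fintype.card ι * Real.exp (-∑ i, ‖z i‖ ^ 2)) := by
  have h := complexGaussian_one_eq_withDensity
  have : SigmaFinite ((volume : Measure ℂ).withDensity fun z =>
      ENNReal.ofReal (Real.pi⁻¹ * Real.exp (-‖z‖ ^ 2))) := by
    rw [← h]; infer_instance
  simp only [stdGaussian, h]
  rw [pi_withDensity _ _ (by fun_prop)]
  congr 1
  ext z
  rw [← ENNReal.ofReal_prod_of_nonneg fun i _ => by positivity, Finset.prod_mul_distrib,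
    ← Real.exp_sum, Finset.sum_neg_distrib]
  simp

/-- `E exp(-∑ dᵢ |zᵢ|²) = ∏ 1 / (1 + dᵢ)`. -/
theorem lintegral_exp_neg_sum_stdGaussian {ι : Type*} [Fintype ι] (d : ι → ℝ)
    (hd : ∀ i, -1 < d i) :
    ∫⁻ z, ENNReal.ofReal (Real.exp (-∑ i, d i * ‖z i‖ ^ 2)) ∂(stdGaussian ι)
      = ENNReal.ofReal (∏ i, (1 + d i)⁻¹) := by
  have : ∀ z : ι → ℂ, ENNReal.ofReal (Real.exp (-∑ i, d i * ‖z i‖ ^ 2))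
      = ∏ i, ENNReal.ofReal (Real.exp (-d i * ‖z i‖ ^ 2)) := by
    intro z
    rw [← ENNReal.ofReal_prod_of_nonneg fun i _ => by positivity, ← Real.exp_sum,
      ← Finset.sum_neg_distrib]
    simp
  simp_rw [this]
  rw [stdGaussian, lintegral_pi_prod _ (fun i z => ENNReal.ofReal (Real.exp (-d i * ‖z‖ ^ 2)))
    (by fun_prop), ENNReal.ofReal_prod_of_nonneg fun i _ => by
      have := hd i; exact inv_nonneg.2 (by linarith)]
  exact Finset.prod_congr rfl fun i _ => lintegral_exp_neg_mul_sq_complexGaussian (hd i)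

/-- Polar coordinates: the squared norm of a standard complex Gaussian vector of length `N` has a
density proportional to `s ^ (N - 1) * exp (-s)`. -/
theorem exists_integral_sq_norm_stdGaussian (ι : Type*) [Fintype ι] [Nonempty ι] :
    ∃ C : ℝ, ∀ h : ℝ → ℝ, ∫ z, h (∑ i, ‖z i‖ ^ 2) ∂(stdGaussian ι)
      = C * ∫ s in Set.Ioi (0 : ℝ), s ^ ((Fintype.card ι : ℝ) - 1) * Real.exp (-s) * h s := by
  set N := Fintype.card ι with hN
  have hN0 : 0 < N := Fintype.card_pos
  -- integration in polar coordinates needs the Euclidean norm in place of the supremum norm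
  let e := (PiLp.continuousLinearEquiv 2 ℝ (fun _ : ι => ℂ)).symm
  let μ : Measure (EuclideanSpace ℂ ι) := (volume : Measure (ι → ℂ)).map e
  have hfin : Module.finrank ℝ (EuclideanSpace ℂ ι) = 2 * N := by
    rw [← e.toLinearEquiv.finrank_eq, Module.finrank_pi_fintype]
    simp [hN, mul_comm]
  have : Nontrivial (EuclideanSpace ℂ ι) := inferInstance
  refine ⟨(2 * N : ℕ) * μ.real (Metric.ball 0 1) * Real.pi⁻¹ ^ N / 2, fun h => ?_⟩
  have h1 : ∫ z, h (∑ i, ‖z i‖ ^ 2) ∂(stdGaussian ι)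
      = ∫ z : ι → ℂ, (Real.pi⁻¹ ^ N * Real.exp (-∑ i, ‖z i‖ ^ 2)) * h (∑ i, ‖z i‖ ^ 2) := by
    rw [stdGaussian_eq_withDensity, integral_withDensity_eq_integral_toReal_smul
      (by fun_prop) (ae_of_all _ fun z => ENNReal.ofReal_lt_top)]
    refine integral_congr_ae (ae_of_all _ fun z => ?_)
    simp only [smul_eq_mul]
    rw [ENNReal.toReal_ofReal (by positivity)]
  have h2 : ∫ z : ι → ℂ, (Real.pi⁻¹ ^ N * Real.exp (-∑ i, ‖z i‖ ^ 2)) * h (∑ i, ‖z i‖ ^ 2)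
      = ∫ y, (fun r : ℝ => Real.pi⁻¹ ^ N * Real.exp (-r ^ 2) * h (r ^ 2)) ‖y‖ ∂μ := by
    have he : MeasurableEmbedding e := e.toHomeomorph.measurableEmbedding
    rw [he.integral_map]
    refine integral_congr_ae (ae_of_all _ fun z => ?_)
    have : ‖e z‖ ^ 2 = ∑ i, ‖z i‖ ^ 2 := EuclideanSpace.norm_sq_eq _
    simp only [this]
  have h3 := integral_fun_norm_addHaar μ
    (fun r : ℝ => Real.pi⁻¹ ^ N * Real.exp (-r ^ 2) * h (r ^ 2))
  rw [h1, h2, h3, hfin]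
  -- substitution of the squared radius
  have h4 := integral_comp_rpow_Ioi (fun s : ℝ => s ^ ((N : ℝ) - 1) * Real.exp (-s) * h s)
    (two_ne_zero)
  rw [← h4]
  simp only [nsmul_eq_mul, smul_eq_mul]
  have h5 : ∫ y in Set.Ioi (0 : ℝ),
        y ^ (2 * N - 1) * (Real.pi⁻¹ ^ N * Real.exp (-y ^ 2) * h (y ^ 2))
      = Real.pi⁻¹ ^ N / 2 * ∫ x in Set.Ioi (0 : ℝ), (|(2 : ℝ)| * x ^ ((2 : ℝ) - 1)) *
        ((x ^ (2 : ℝ)) ^ ((N : ℝ) - 1) * Real.exp (-x ^ (2 : ℝ)) * h (x ^ (2 : ℝ))) := by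
    rw [← integral_const_mul]
    refine setIntegral_congr_fun measurableSet_Ioi fun y hy => ?_
    have hy : 0 < y := hy
    have e1 : y ^ (2 * N - 1) = y ^ ((2 : ℝ) - 1) * (y ^ (2 : ℝ)) ^ ((N : ℝ) - 1) := by
      rw [← Real.rpow_mul hy.le, ← Real.rpow_add hy, ← Real.rpow_natCast]
      congr 1
      rw [Nat.cast_sub (by omega)]
      push_cast
      ring
    simp only [e1, Real.rpow_two, abs_two]
    ring
  rw [h5]
  ring

/-- The squared norm of a standard complex Gaussian vector of length `N` has the gamma law of shape
`N`. -/
theorem measureReal_sq_norm_stdGaussian {ι : Type*} [Fintype ι] [Nonempty ι] {s : Set ℝ}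
    (hs : MeasurableSet s) :
    (stdGaussian ι).real {z | ∑ i, ‖z i‖ ^ 2 ∈ s}
      = (∫ y in Set.Ioi (0 : ℝ) ∩ s, y ^ ((Fintype.card ι : ℝ) - 1) * Real.exp (-y))
        / Real.Gamma (Fintype.card ι) := by
  obtain ⟨C, hC⟩ := exists_integral_sq_norm_stdGaussian ι
  have hN0 : (0 : ℝ) < Fintype.card ι := by exact_mod_cast Fintype.card_pos
  -- the total mass determines the normalizing constant
  have h1 := hC fun _ => 1
  simp only [mul_one, integral_const, probReal_univ, smul_eq_mul] at h1
  have hG : ∫ s in Set.Ioi (0 : ℝ), s ^ ((Fintype.card ι : ℝ) - 1) * Real.exp (-s)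
      = Real.Gamma (Fintype.card ι) := by
    rw [Real.Gamma_eq_integral hN0]
    simp_rw [mul_comm]
  rw [hG] at h1
  have h2 := hC (s.indicator fun _ => 1)
  have h3 : ∫ z, s.indicator (fun _ => (1 : ℝ)) (∑ i, ‖z i‖ ^ 2) ∂(stdGaussian ι)
      = (stdGaussian ι).real {z | ∑ i, ‖z i‖ ^ 2 ∈ s} := by
    have hm : MeasurableSet {z : ι → ℂ | ∑ i, ‖z i‖ ^ 2 ∈ s} :=
      (show Measurable fun z : ι → ℂ => ∑ i, ‖z i‖ ^ 2 by fun_prop) hs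
    rw [← integral_indicator_one hm]
    rfl
  have h4 : ∫ y in Set.Ioi (0 : ℝ), y ^ ((Fintype.card ι : ℝ) - 1) * Real.exp (-y) *
        s.indicator (fun _ => 1) y
      = ∫ y in Set.Ioi (0 : ℝ) ∩ s, y ^ ((Fintype.card ι : ℝ) - 1) * Real.exp (-y) := by
    rw [← setIntegral_indicator hs]
    refine setIntegral_congr_fun measurableSet_Ioi fun y _ => ?_
    by_cases hy : y ∈ s <;> simp [hy]
  rw [← h3, h2, h4]
  have hΓ := Real.Gamma_pos_of_pos hN0
  have : C = 1 / Real.Gamma (Fintype.card ι) := by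
    field_simp
    linarith
  rw [this]
  ring

theorem gammaRatio_eq_setIntegral {s : ℝ} (hs : s ≠ 0) (x : ℝ) :
    gammaRatio s x
      = (∫ y in Set.Ioi (0 : ℝ) ∩ Set.Iic x, y ^ (s - 1) * Real.exp (-y)) / Real.Gamma s := by
  rw [gammaRatio, if_neg hs, lowerGamma]
  split_ifs with hx
  · have : Set.Ioi (0 : ℝ) ∩ Set.Iic x = ∅ := by
      rw [Set.Ioi_inter_Iic]; exact Set.Ioc_eq_empty (not_lt.2 hx)
    simp [this]
  · rw [Set.Ioi_inter_Iic, intervalIntegral.integral_of_le (not_le.1 hx).le]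

theorem stdGaussian_sq_norm_le {ι : Type*} [Fintype ι] [Nonempty ι] (x : ℝ) :
    stdGaussian ι {z | ∑ i, ‖z i‖ ^ 2 ≤ x} = ENNReal.ofReal (gammaRatio (Fintype.card ι) x) := by
  have hN0 : (Fintype.card ι : ℝ) ≠ 0 := by exact_mod_cast Fintype.card_ne_zero
  rw [gammaRatio_eq_setIntegral hN0, ← measureReal_sq_norm_stdGaussian measurableSet_Iic,
    ofReal_measureReal]
  rfl

theorem stdGaussian_sq_norm_lt {ι : Type*} [Fintype ι] [Nonempty ι] (x : ℝ) :
    stdGaussian ι {z | ∑ i, ‖z i‖ ^ 2 < x} = ENNReal.ofReal (gammaRatio (Fintype.card ι) x) := by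
  have hN0 : (Fintype.card ι : ℝ) ≠ 0 := by exact_mod_cast Fintype.card_ne_zero
  rw [gammaRatio_eq_setIntegral hN0, setIntegral_congr_set
      (t := Set.Ioi (0 : ℝ) ∩ Set.Iio x) ((ae_eq_refl _).inter Iio_ae_eq_Iic.symm),
    ← measureReal_sq_norm_stdGaussian measurableSet_Iio, ofReal_measureReal]
  rfl

theorem gammaRatio_nonneg (N : ℕ) (x : ℝ) : 0 ≤ gammaRatio N x := by
  rcases Nat.eq_zero_or_pos N with rfl | h
  · simp only [gammaRatio, Nat.cast_zero, if_true]; split_ifs <;> norm_num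
  · rw [gammaRatio_eq_setIntegral (by positivity)]
    exact div_nonneg (setIntegral_nonneg (measurableSet_Ioi.inter measurableSet_Iic) fun y hy =>
      mul_nonneg (Real.rpow_nonneg (le_of_lt hy.1) _) (Real.exp_pos _).le)
      (Real.Gamma_pos_of_pos (by positivity)).le

theorem stdGaussian_le_sq_norm {ι : Type*} [Fintype ι] [Nonempty ι] (x : ℝ) :
    stdGaussian ι {z | x ≤ ∑ i, ‖z i‖ ^ 2}
      = ENNReal.ofReal (1 - gammaRatio (Fintype.card ι) x) := by
  have h : {z : ι → ℂ | x ≤ ∑ i, ‖z i‖ ^ 2} = {z | ∑ i, ‖z i‖ ^ 2 < x}ᶜ := by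
    ext z; simp
  rw [h, prob_compl_eq_one_sub (measurableSet_lt (by fun_prop) (by fun_prop)),
    stdGaussian_sq_norm_lt, ENNReal.ofReal_sub _ (gammaRatio_nonneg _ _), ENNReal.ofReal_one]

/-- Among the sets of a given finite volume, a superlevel set of the density has the largest
mass. -/
theorem setLIntegral_le_of_measure_eq {X : Type*} [MeasurableSpace X] (v : Measure X)
    {ρ : X → ℝ≥0∞} {E B : Set X} (hE : MeasurableSet E) (hB : MeasurableSet B)
    (hv : v E = v B) (hfin : v B ≠ ∞) (c : ℝ≥0∞) (h1 : ∀ x ∈ B, c ≤ ρ x) (h2 : ∀ x ∉ B, ρ x ≤ c) :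
    ∫⁻ x in E, ρ x ∂v ≤ ∫⁻ x in B, ρ x ∂v := by
  rw [← lintegral_inter_add_sdiff ρ E hB, ← lintegral_inter_add_sdiff ρ B hE, Set.inter_comm B E]
  gcongr 1
  calc ∫⁻ x in E \ B, ρ x ∂v ≤ ∫⁻ _ in E \ B, c ∂v :=
        setLIntegral_mono' (hE.diff hB) fun x hx => h2 x hx.2
    _ = c * v (E \ B) := setLIntegral_const _ _
    _ = c * v (B \ E) := by
        congr 1
        have hf : v (E ∩ B) ≠ ∞ := ne_top_of_le_ne_top hfin (measure_mono Set.inter_subset_right)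
        have a1 := measure_inter_add_sdiff E hB (μ := v)
        have a2 := measure_inter_add_sdiff B hE (μ := v)
        rw [Set.inter_comm B E, ← hv, ← a1] at a2
        exact ((ENNReal.add_right_inj hf).1 a2).symm
    _ = ∫⁻ _ in B \ E, c ∂v := (setLIntegral_const _ _).symm
    _ ≤ ∫⁻ x in B \ E, ρ x ∂v := setLIntegral_mono' (hB.diff hE) fun x hx => h1 x hx.1

/-- Coordinatewise scaling by positive factors of product one preserves volume. -/
theorem measurePreserving_scale {ι : Type*} [Fintype ι] (a : ι → ℝ) (ha : ∀ i, 0 < a i)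
    (hprod : ∏ i, a i = 1) :
    MeasurePreserving (fun (z : ι → ℂ) i => a i • z i) volume volume := by
  refine ⟨by fun_prop, (Measure.pi_eq fun s hs => ?_).symm⟩
  rw [Measure.map_apply (by fun_prop) (MeasurableSet.univ_pi hs)]
  have : (fun (z : ι → ℂ) i => a i • z i) ⁻¹' Set.univ.pi s
      = Set.univ.pi fun i => (fun z : ℂ => a i • z) ⁻¹' s i := by
    ext z; simp [Set.mem_pi]
  rw [this, volume_pi, Measure.pi_pi]
  simp_rw [Measure.addHaar_preimage_smul volume (ha _).ne', Complex.finrank_real_complex]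
  rw [Finset.prod_mul_distrib, ← ENNReal.ofReal_prod_of_nonneg fun i _ => by positivity]
  have : ∏ i, |(a i ^ 2)⁻¹| = 1 := by
    rw [Finset.prod_congr rfl fun i _ => abs_of_pos (inv_pos.2 (pow_pos (ha i) 2)),
      Finset.prod_inv_distrib, Finset.prod_pow, hprod]
    simp
  rw [this, ENNReal.ofReal_one, one_mul]

/-- Okamoto's inequality: a weighted sum of squares of Gaussian variables is small with at most the
probability that it is small when all weights are replaced by their geometric mean.  Both events
are ellipsoids of the same volume, and the ball catches more of the Gaussian mass. -/
theorem stdGaussian_weighted_sq_norm_le {ι : Type*} [Fintype ι] [Nonempty ι] (w : ι → ℝ)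
    (hw : ∀ i, 0 < w i) (x : ℝ) :
    stdGaussian ι {z | ∑ i, w i * ‖z i‖ ^ 2 ≤ x}
      ≤ ENNReal.ofReal (gammaRatio (Fintype.card ι)
          ((∏ i, w i) ^ (-(1 / (Fintype.card ι : ℝ))) * x)) := by
  have hN0 : (Fintype.card ι : ℝ) ≠ 0 := by exact_mod_cast Fintype.card_ne_zero
  have hp : 0 < ∏ i, w i := Finset.prod_pos fun i _ => hw i
  set g := (∏ i, w i) ^ (-(1 / (Fintype.card ι : ℝ))) with hg
  have hg0 : 0 < g := Real.rpow_pos_of_pos hp _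
  rw [← stdGaussian_sq_norm_le, stdGaussian_eq_withDensity]
  set E := {z : ι → ℂ | ∑ i, w i * ‖z i‖ ^ 2 ≤ x}
  set B := {z : ι → ℂ | ∑ i, ‖z i‖ ^ 2 ≤ g * x}
  have hE : MeasurableSet E := measurableSet_le (by fun_prop) (by fun_prop)
  have hB : MeasurableSet B := measurableSet_le (by fun_prop) (by fun_prop)
  rw [withDensity_apply _ hE, withDensity_apply _ hB]
  have hpg : ∏ i, (w i * g) = 1 := by
    rw [Finset.prod_mul_distrib, Finset.prod_const, Finset.card_univ, hg, ← Real.rpow_natCast,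
      ← Real.rpow_mul hp.le]
    rw [show -(1 / (Fintype.card ι : ℝ)) * (Fintype.card ι : ℝ) = -1 by field_simp,
      Real.rpow_neg_one, mul_inv_cancel₀ hp.ne']
  -- the factors are normalized so that the map to the ball preserves volume
  have hmp := measurePreserving_scale (fun i => Real.sqrt (w i * g))
    (fun i => Real.sqrt_pos.2 (mul_pos (hw i) hg0)) (by
      rw [← Real.sqrt_prod _ fun i _ => (mul_pos (hw i) hg0).le, hpg, Real.sqrt_one])
  have hEB : E = (fun (z : ι → ℂ) i => Real.sqrt (w i * g) • z i) ⁻¹' B := by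
    ext z
    simp only [E, B, Set.mem_preimage, Set.mem_ofPred_eq, norm_smul, mul_pow, Real.norm_eq_abs,
      sq_abs, Real.sq_sqrt (mul_pos (hw _) hg0).le]
    have : ∑ i, w i * g * ‖z i‖ ^ 2 = g * ∑ i, w i * ‖z i‖ ^ 2 := by
      rw [Finset.mul_sum]; exact Finset.sum_congr rfl fun i _ => by ring
    rw [this, mul_le_mul_iff_right₀ hg0]
  refine setLIntegral_le_of_measure_eq _ hE hB ?_ ?_
    (ENNReal.ofReal (Real.pi⁻¹ ^ Fintype.card ι * Real.exp (-(g * x)))) ?_ ?_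
  · rw [hEB, hmp.measure_preimage hB.nullMeasurableSet]
  · refine ne_top_of_le_ne_top (measure_closedBall_lt_top (x := (0 : ι → ℂ))
      (r := Real.sqrt (g * x))).ne (measure_mono fun z hz => ?_)
    rw [mem_closedBall_zero_iff]
    refine (pi_norm_le_iff_of_nonneg (Real.sqrt_nonneg _)).2 fun i => Real.le_sqrt_of_sq_le ?_
    exact (Finset.single_le_sum (f := fun i => ‖z i‖ ^ 2) (fun i _ => by positivity)
      (Finset.mem_univ i)).trans hz
  · intro z hz
    have hz : ∑ i, ‖z i‖ ^ 2 ≤ g * x := hz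
    gcongr
  · intro z hz
    have hz : g * x < ∑ i, ‖z i‖ ^ 2 := not_le.1 hz
    gcongr

/-! ### Linear images of Gaussian arrays -/

/-- The standard complex Gaussian law on `ι × Fin L` arrays. -/
abbrev stdArray (ι : Type*) [Fintype ι] (L : ℕ) : Measure (ι → Fin L → ℂ) :=
  Measure.pi fun _ => Measure.pi fun _ => complexGaussian 1

/-- The matrix product `T Z` for an array `Z`. -/
def leftMul {κ ι : Type*} [Fintype ι] {L : ℕ} (T : Matrix κ ι ℂ) (Z : ι → Fin L → ℂ) :
    κ → Fin L → ℂ :=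
  fun k l => ∑ i, T k i * Z i l

theorem measurable_leftMul {κ ι : Type*} [Fintype ι] {L : ℕ} (T : Matrix κ ι ℂ) :
    Measurable (leftMul (L := L) T) := by
  unfold leftMul
  fun_prop

/-- The characteristic function of `T Z`, which depends on `T` only through `T Tᴴ`. -/
theorem charFunDual_map_leftMul {κ ι : Type*} [Fintype κ] [DecidableEq κ] [Fintype ι] {L : ℕ}
    (T : Matrix κ ι ℂ) (ℓ : StrongDual ℝ (κ → Fin L → ℂ)) :
    charFunDual ((stdArray ι L).map (leftMul T)) ℓ
      = Complex.exp (-(∑ l, ∑ k, ∑ k',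
          ((ℓ (Pi.single k (Pi.single l 1)) : ℂ)
            + ℓ (Pi.single k (Pi.single l Complex.I)) * Complex.I) *
          (starRingEnd ℂ) ((ℓ (Pi.single k' (Pi.single l 1)) : ℂ)
            + ℓ (Pi.single k' (Pi.single l Complex.I)) * Complex.I) * (T * Tᴴ) k' k) / 4) := by
  classical
  -- `ℓ` is the real part of the Hermitian inner product with `w`
  set w : κ → Fin L → ℂ := fun k l => (ℓ (Pi.single k (Pi.single l 1)) : ℂ)
            + ℓ (Pi.single k (Pi.single l Complex.I)) * Complex.I with hw
  let TL : (ι → Fin L → ℂ) →ₗ[ℝ] (κ → Fin L → ℂ) :=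
    { toFun := leftMul T
      map_add' := fun x y => by
        ext k l; simp [leftMul, mul_add, Finset.sum_add_distrib]
      map_smul' := fun c x => by
        ext k l
        simp only [leftMul, Pi.smul_apply, Complex.real_smul, RingHom.id_apply, Finset.mul_sum]
        exact Finset.sum_congr rfl fun i _ => by ring }
  let TC : (ι → Fin L → ℂ) →L[ℝ] (κ → Fin L → ℂ) := LinearMap.toContinuousLinearMap TL
  have hTC : leftMul T = TC := rfl
  have hℓ : ∀ Y : κ → Fin L → ℂ, ℓ Y = ∑ k, ∑ l, ((starRingEnd ℂ) (w k l) * Y k l).re := by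
    intro Y
    have hY : Y = ∑ k, ∑ l, ((Y k l).re • (Pi.single k (Pi.single l 1) : κ → Fin L → ℂ)
        + (Y k l).im • (Pi.single k (Pi.single l Complex.I) : κ → Fin L → ℂ)) := by
      ext k l
      simp only [Finset.sum_apply, Pi.add_apply, Pi.smul_apply]
      rw [Finset.sum_eq_single k, Finset.sum_eq_single l]
      · simp
      · intro l' _ hl; simp [Pi.single_eq_of_ne hl.symm]
      · simp
      · intro k' _ hk; simp [Pi.single_eq_of_ne hk.symm]
      · simp
    conv_lhs => rw [hY]
    simp only [map_sum, map_add, map_smul, smul_eq_mul]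
    refine Finset.sum_congr rfl fun k _ => Finset.sum_congr rfl fun l _ => ?_
    simp [hw]
    ring
  have hM : ∀ (i : ι) (l : Fin L) (c : ℂ),
      (((ℓ.comp TC).comp (.single ℝ (fun _ : ι => Fin L → ℂ) i)).comp
        (.single ℝ (fun _ : Fin L => ℂ) l)) c
        = ((∑ k, (starRingEnd ℂ) (w k l) * T k i) * c).re := by
    intro i l c
    have : TC (Pi.single i (Pi.single l c)) = fun k => Pi.single l (T k i * c) := by
      ext k l'
      change leftMul T _ k l' = _
      rw [leftMul, Finset.sum_eq_single i]
      · by_cases h : l' = l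
        · subst h; simp
        · simp [Pi.single_eq_of_ne h]
      · intro j _ hj; simp [Pi.single_eq_of_ne hj]
      · simp
    simp only [ContinuousLinearMap.comp_apply, ContinuousLinearMap.single_apply, this]
    rw [hℓ, Finset.sum_mul, Complex.re_sum]
    refine Finset.sum_congr rfl fun k _ => ?_
    rw [Finset.sum_eq_single l]
    · simp [mul_assoc]
    · intro l' _ hl; simp [Pi.single_eq_of_ne hl]
    · simp
  rw [hTC, charFunDual_map, charFunDual_pi]
  simp_rw [charFunDual_pi, charFunDual_complexGaussian_one, hM]
  simp_rw [← Complex.exp_sum]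
  congr 1
  have key : ∀ v : ℂ, ((((v * 1).re ^ 2 + (v * Complex.I).re ^ 2) / 4 : ℝ) : ℂ)
      = (starRingEnd ℂ) v * v / 4 := by
    intro v
    rw [← Complex.normSq_eq_conj_mul_self, Complex.normSq_apply]
    simp
    ring
  simp_rw [key]
  rw [Finset.sum_comm, neg_div, Finset.sum_div, ← Finset.sum_neg_distrib]
  refine Finset.sum_congr rfl fun l _ => ?_
  rw [Finset.sum_neg_distrib, ← Finset.sum_div]
  congr 2
  simp only [map_sum, map_mul, Complex.conj_conj, Finset.sum_mul_sum]
  rw [Finset.sum_comm]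
  refine Finset.sum_congr rfl fun k _ => ?_
  rw [Finset.sum_comm]
  refine Finset.sum_congr rfl fun k' _ => ?_
  rw [Matrix.mul_apply, Finset.mul_sum]
  refine Finset.sum_congr rfl fun i _ => ?_
  simp only [Matrix.conjTranspose_apply, RCLike.star_def]
  ring

theorem map_leftMul_eq {κ ι ι' : Type*} [Fintype κ] [Fintype ι] [Fintype ι'] {L : ℕ}
    {T : Matrix κ ι ℂ} {T' : Matrix κ ι' ℂ} (h : T * Tᴴ = T' * T'ᴴ) :
    (stdArray ι L).map (leftMul T) = (stdArray ι' L).map (leftMul T') := by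
  classical
  have := Measure.isProbabilityMeasure_map (μ := stdArray ι L)
    (measurable_leftMul (L := L) T).aemeasurable
  have := Measure.isProbabilityMeasure_map (μ := stdArray ι' L)
    (measurable_leftMul (L := L) T').aemeasurable
  refine Measure.ext_of_charFunDual (funext fun ℓ => ?_)
  rw [charFunDual_map_leftMul, charFunDual_map_leftMul, h]

/-- The law of an `n × L` array with independent `CN(0, F)` columns: it is the law of `T Z` for
every `T` with `T Tᴴ = F`, where `Z` has i.i.d. `CN(0, 1)` entries.  For positive semidefinite `F` such
a `T` exists, so that the law is determined. -/
def IsCN {n L : ℕ} (ν : Measure (Fin n → Fin L → ℂ)) (F : Matrix (Fin n) (Fin n) ℂ) : Prop :=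
  ∀ T : Matrix (Fin n) (Fin n) ℂ, T * Tᴴ = F → ν = (gaussianArray n L 1).map (leftMul T)

/-- Fading and noise combine to a signal with independent Gaussian columns. -/
theorem isCN_fading_add_noise {n L K q : ℕ} (A : Fin q → Fin n → ℂ) {e : Fin q → Fin K}
    (he : Function.Injective e) :
    IsCN (((gaussianArray K L 1).prod (gaussianArray n L 1)).map
      fun hz : (Fin K → Fin L → ℂ) × (Fin n → Fin L → ℂ) =>
        fun i l => ∑ j, hz.1 (e j) l * A j i + hz.2 i l) (matF A) := by
  classical
  intro T hT
  -- the signal is the block matrix `(A, I)` times the stacked fading and noise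
  let T' : Matrix (Fin n) (Fin q ⊕ Fin n) ℂ :=
    Matrix.of fun i => Sum.elim (fun j => A j i) (fun i' => (1 : Matrix (Fin n) (Fin n) ℂ) i i')
  have hT' : T' * T'ᴴ = T * Tᴴ := by
    rw [hT]
    ext i i'
    rw [Matrix.mul_apply, Fintype.sum_sum_type]
    simp only [T', Matrix.of_apply, Sum.elim_inl, Sum.elim_inr, Matrix.conjTranspose_apply, matF,
      gram, Matrix.add_apply, Matrix.sum_apply, Matrix.vecMulVec_apply, Pi.star_apply]
    rw [add_comm]
    congr 1
    have := congrFun (congrFun (Matrix.mul_one (1 : Matrix (Fin n) (Fin n) ℂ)) i) i'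
    rw [Matrix.mul_apply] at this
    rw [← this]
    refine Finset.sum_congr rfl fun x _ => ?_
    congr 1
    rw [Matrix.one_apply, Matrix.one_apply]
    simp only [eq_comm (a := i') (b := x)]
    split_ifs <;> simp
  have h1 : MeasurePreserving (fun hz : (Fin K → Fin L → ℂ) × (Fin n → Fin L → ℂ) =>
      (Sum.elim (fun j => hz.1 (e j)) hz.2 : Fin q ⊕ Fin n → Fin L → ℂ))
      ((gaussianArray K L 1).prod (gaussianArray n L 1)) (stdArray (Fin q ⊕ Fin n) L) := by
    have a1 := (measurePreserving_comp_injective (Measure.pi fun _ : Fin L => complexGaussian 1)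
      he).prod (MeasurePreserving.id (gaussianArray n L 1))
    have a2 := measurePreserving_sumPiEquivProdPi_symm (X := fun _ : Fin q ⊕ Fin n => Fin L → ℂ)
      fun _ : Fin q ⊕ Fin n => Measure.pi fun _ : Fin L => complexGaussian 1
    have a3 := a2.comp a1
    have hfun : (fun hz : (Fin K → Fin L → ℂ) × (Fin n → Fin L → ℂ) =>
        (Sum.elim (fun j => hz.1 (e j)) hz.2 : Fin q ⊕ Fin n → Fin L → ℂ))
        = (MeasurableEquiv.sumPiEquivProdPi fun _ => Fin L → ℂ).symm ∘
          Prod.map (fun (f : Fin K → Fin L → ℂ) i => f (e i)) id := by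
      ext hz x
      cases x <;> rfl
    rw [hfun]
    exact a3
  have h2 : (fun hz : (Fin K → Fin L → ℂ) × (Fin n → Fin L → ℂ) =>
        fun i l => ∑ j, hz.1 (e j) l * A j i + hz.2 i l)
      = leftMul T' ∘ fun hz => Sum.elim (fun j => hz.1 (e j)) hz.2 := by
    ext hz i l
    simp only [leftMul, Function.comp, Fintype.sum_sum_type, T', Matrix.of_apply, Sum.elim_inl,
      Sum.elim_inr, Matrix.one_apply]
    simp [mul_comm]
  rw [h2, ← Measure.map_map (measurable_leftMul T') h1.measurable, h1.map_eq, map_leftMul_eq hT']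
  rfl

/-! ### Simultaneous diagonalization -/

theorem exists_unitary_diagonalization {n : ℕ} {A : Matrix (Fin n) (Fin n) ℂ}
    (hA : A.IsHermitian) :
    ∃ (U : Matrix (Fin n) (Fin n) ℂ) (d : Fin n → ℝ), U * Uᴴ = 1 ∧ Uᴴ * U = 1 ∧
      Uᴴ * A * U = Matrix.diagonal fun i => (d i : ℂ) := by
  refine ⟨hA.eigenvectorUnitary, hA.eigenvalues, ?_, ?_, ?_⟩
  · exact Unitary.coe_mul_star_self _
  · exact Unitary.coe_star_mul_self _
  · have := hA.conjStarAlgAut_star_eigenvectorUnitary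
    rw [Unitary.conjStarAlgAut_star_apply] at this
    exact this

theorem exists_eq_mul_conjTranspose {n : ℕ} {F : Matrix (Fin n) (Fin n) ℂ} (hF : F.PosSemidef) :
    ∃ R : Matrix (Fin n) (Fin n) ℂ, R * Rᴴ = F := by
  obtain ⟨U, d, h1, h2, h3⟩ := exists_unitary_diagonalization hF.isHermitian
  have hd : ∀ i, 0 ≤ d i := by
    have h := hF.conjTranspose_mul_mul_same U
    rw [h3, Matrix.posSemidef_diagonal_iff] at h
    exact fun i => by exact_mod_cast h i
  have hFU : F = U * (Matrix.diagonal fun i => (d i : ℂ)) * Uᴴ := by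
    rw [← h3]
    calc F = (U * Uᴴ) * F * (U * Uᴴ) := by rw [h1]; simp
      _ = _ := by simp only [Matrix.mul_assoc]
  refine ⟨U * Matrix.diagonal fun i => (Real.sqrt (d i) : ℂ), ?_⟩
  rw [Matrix.conjTranspose_mul, Matrix.diagonal_conjTranspose, ← Matrix.mul_assoc,
    Matrix.mul_assoc U, Matrix.diagonal_mul_diagonal, hFU]
  congr 3
  ext i
  simp only [Pi.star_apply, RCLike.star_def, Complex.conj_ofReal]
  rw [← Complex.ofReal_mul, Real.mul_self_sqrt (hd i)]

/-- A positive definite `F` and a Hermitian `Q` are simultaneously brought to diagonal form. -/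
theorem exists_simultaneous_diagonalization {n : ℕ} {F Q : Matrix (Fin n) (Fin n) ℂ}
    (hF : F.PosDef) (hQ : Q.IsHermitian) :
    ∃ (T : Matrix (Fin n) (Fin n) ℂ) (d : Fin n → ℝ), T * Tᴴ = F ∧ Tᴴ * F⁻¹ * T = 1 ∧
      Tᴴ * Q * T = Matrix.diagonal fun i => (d i : ℂ) := by
  obtain ⟨R, hR⟩ := exists_eq_mul_conjTranspose hF.posSemidef
  have hQR : (Rᴴ * Q * R).IsHermitian := by
    rw [Matrix.IsHermitian, Matrix.conjTranspose_mul, Matrix.conjTranspose_mul, hQ.eq,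
      Matrix.conjTranspose_conjTranspose, Matrix.mul_assoc]
  obtain ⟨U, d, h1, h2, h3⟩ := exists_unitary_diagonalization hQR
  have hTT : (R * U) * (R * U)ᴴ = F := by
    rw [Matrix.conjTranspose_mul, Matrix.mul_assoc, ← Matrix.mul_assoc U, h1, Matrix.one_mul, hR]
  refine ⟨R * U, d, hTT, ?_, ?_⟩
  · generalize R * U = T at hTT
    have hdet : IsUnit F.det := (Matrix.isUnit_iff_isUnit_det _).1 hF.isUnit
    have hdT : IsUnit T.det := by
      rw [← hTT, Matrix.det_mul] at hdet
      exact isUnit_of_mul_isUnit_left hdet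
    have hdT' : IsUnit (Tᴴ).det := by
      rw [← hTT, Matrix.det_mul] at hdet
      exact isUnit_of_mul_isUnit_right hdet
    rw [← hTT, Matrix.mul_inv_rev, ← Matrix.mul_assoc, Matrix.mul_nonsing_inv _ hdT',
      Matrix.one_mul,
      Matrix.nonsing_inv_mul _ hdT]
  · rw [← h3, Matrix.conjTranspose_mul]
    simp only [Matrix.mul_assoc]

theorem eigs_diagonal {n : ℕ} (d : Fin n → ℝ) :
    eigs (Matrix.diagonal fun i => (d i : ℂ)) = Finset.univ.val.map d := by
  have h : (∏ i, (Polynomial.X - Polynomial.C (d i : ℂ)))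
      = ((Finset.univ.val.map fun i => (d i : ℂ)).map
          fun a => Polynomial.X - Polynomial.C a).prod := by
    rw [Multiset.map_map]
    rfl
  rw [eigs, Matrix.charpoly_diagonal, h, Polynomial.roots_multiset_prod_X_sub_C, Multiset.map_map]
  exact Multiset.map_congr rfl fun i _ => Complex.ofReal_re _

/-- The weights of the diagonalized form `Q` are the eigenvalues of `Q F`. -/
theorem eigs_mul_of_diagonalization {n : ℕ} {F Q T : Matrix (Fin n) (Fin n) ℂ} {d : Fin n → ℝ}
    (hT : T * Tᴴ = F) (hQ : Tᴴ * Q * T = Matrix.diagonal fun i => (d i : ℂ)) :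
    eigs (Q * F) = Finset.univ.val.map d := by
  rw [← eigs_diagonal, ← hQ, eigs, eigs, ← hT, ← Matrix.mul_assoc, Matrix.charpoly_mul_comm,
    Matrix.mul_assoc]

theorem det_mul_of_diagonalization {n : ℕ} {F Q T : Matrix (Fin n) (Fin n) ℂ} {d : Fin n → ℝ}
    (hT : T * Tᴴ = F) (hQ : Tᴴ * Q * T = Matrix.diagonal fun i => (d i : ℂ)) :
    (Q * F).det = ((∏ i, d i : ℝ) : ℂ) := by
  rw [← hT, ← Matrix.mul_assoc, Matrix.det_mul_comm, ← Matrix.mul_assoc, hQ, Matrix.det_diagonal]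
  push_cast
  rfl

/-- The quadratic form `tr (Q Y Yᴴ)`. -/
def trForm {n L : ℕ} (Q : Matrix (Fin n) (Fin n) ℂ) (Y : Fin n → Fin L → ℂ) : ℝ :=
  (Q * (Matrix.of Y * (Matrix.of Y)ᴴ)).trace.re

theorem trForm_add {n L : ℕ} (Q Q' : Matrix (Fin n) (Fin n) ℂ) (Y : Fin n → Fin L → ℂ) :
    trForm (Q + Q') Y = trForm Q Y + trForm Q' Y := by
  simp [trForm, Matrix.add_mul]

theorem trForm_sub {n L : ℕ} (Q Q' : Matrix (Fin n) (Fin n) ℂ) (Y : Fin n → Fin L → ℂ) :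
    trForm (Q - Q') Y = trForm Q Y - trForm Q' Y := by
  simp [trForm, Matrix.sub_mul]

theorem trForm_smul {n L : ℕ} (a : ℝ) (Q : Matrix (Fin n) (Fin n) ℂ) (Y : Fin n → Fin L → ℂ) :
    trForm ((a : ℂ) • Q) Y = a * trForm Q Y := by
  simp [trForm]

theorem trForm_one {n L : ℕ} (Y : Fin n → Fin L → ℂ) :
    trForm 1 Y = ∑ i, ∑ l, ‖Y i l‖ ^ 2 := by
  rw [trForm, Matrix.one_mul]
  simp only [Matrix.trace, Matrix.diag, Matrix.mul_apply, Complex.re_sum,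
    Matrix.conjTranspose_apply, Matrix.of_apply, RCLike.star_def, Complex.mul_conj]
  refine Finset.sum_congr rfl fun i _ => Finset.sum_congr rfl fun l _ => ?_
  rw [Complex.ofReal_re, Complex.normSq_eq_norm_sq]

theorem continuous_trForm {n L : ℕ} (Q : Matrix (Fin n) (Fin n) ℂ) :
    Continuous (trForm (L := L) Q) := by
  unfold trForm
  simp only [Matrix.trace, Matrix.diag, Matrix.mul_apply, Matrix.conjTranspose_apply,
    Matrix.of_apply]
  fun_prop

theorem trForm_leftMul {n L : ℕ} {Q T : Matrix (Fin n) (Fin n) ℂ} {d : Fin n → ℝ}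
    (hQ : Tᴴ * Q * T = Matrix.diagonal fun i => (d i : ℂ)) (Z : Fin n → Fin L → ℂ) :
    trForm Q (leftMul T Z) = ∑ i, d i * ∑ l, ‖Z i l‖ ^ 2 := by
  have h : Matrix.of (leftMul T Z) = T * Matrix.of Z := by
    ext i l; simp [leftMul, Matrix.mul_apply]
  rw [trForm, h, Matrix.conjTranspose_mul]
  have : Q * (T * Matrix.of Z * ((Matrix.of Z)ᴴ * Tᴴ))
      = (Q * T * (Matrix.of Z * (Matrix.of Z)ᴴ)) * Tᴴ := by simp only [Matrix.mul_assoc]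
  rw [this, Matrix.trace_mul_comm, ← Matrix.mul_assoc, ← Matrix.mul_assoc Tᴴ, hQ]
  simp only [Matrix.trace, Matrix.diag, Complex.re_sum, Matrix.diagonal_mul]
  refine Finset.sum_congr rfl fun i _ => ?_
  rw [Complex.re_ofReal_mul, Matrix.mul_apply, Complex.re_sum]
  congr 1
  refine Finset.sum_congr rfl fun l _ => ?_
  rw [Matrix.conjTranspose_apply, RCLike.star_def, Complex.mul_conj, Complex.ofReal_re,
    Complex.normSq_eq_norm_sq]
  rfl

theorem trForm_inv_leftMul {n L : ℕ} {F T : Matrix (Fin n) (Fin n) ℂ}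
    (hF : Tᴴ * F⁻¹ * T = 1) (Z : Fin n → Fin L → ℂ) :
    trForm F⁻¹ (leftMul T Z) = ∑ i, ∑ l, ‖Z i l‖ ^ 2 := by
  rw [trForm_leftMul (d := fun _ => 1) (by rw [hF]; simp)]
  simp

/-! ### Quadratic forms of Gaussian signals -/

theorem measurePreserving_uncurry_gaussianArray (n L : ℕ) :
    MeasurePreserving (fun (Z : Fin n → Fin L → ℂ) (p : Fin n × Fin L) => Z p.1 p.2)
      (gaussianArray n L 1) (stdGaussian (Fin n × Fin L)) :=
  measurePreserving_uncurry (complexGaussian 1)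

/-- The Laplace transform of a Gaussian quadratic form. -/
theorem IsCN.lintegral_exp_trForm {n L : ℕ} {ν : Measure (Fin n → Fin L → ℂ)}
    {F Q : Matrix (Fin n) (Fin n) ℂ} (hν : IsCN ν F) (hF : F.PosDef) (hQ : Q.IsHermitian)
    (hpos : ∀ x ∈ eigs (Q * F), 0 < x) :
    ∫⁻ Y, ENNReal.ofReal (Real.exp (-(trForm Q Y - trForm F⁻¹ Y))) ∂ν
      = ENNReal.ofReal (Real.exp (-(L * logDet (Q * F)))) := by
  obtain ⟨T, d, hT, hTF, hTQ⟩ := exists_simultaneous_diagonalization hF hQ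
  have hd : ∀ i, 0 < d i := fun i => by
    refine hpos _ ?_
    rw [eigs_mul_of_diagonalization hT hTQ]
    exact Multiset.mem_map_of_mem d (Finset.mem_univ i)
  have hc := continuous_trForm (L := L) Q
  have hc' := continuous_trForm (L := L) F⁻¹
  rw [hν T hT, lintegral_map (by fun_prop) (measurable_leftMul T)]
  have h1 : ∀ Z : Fin n → Fin L → ℂ,
      trForm Q (leftMul T Z) - trForm F⁻¹ (leftMul T Z)
        = ∑ p : Fin n × Fin L, (d p.1 - 1) * ‖Z p.1 p.2‖ ^ 2 := by
    intro Z
    rw [trForm_leftMul hTQ, trForm_inv_leftMul hTF, ← Finset.sum_sub_distrib,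
      Fintype.sum_prod_type]
    refine Finset.sum_congr rfl fun i _ => ?_
    simp only [← Finset.mul_sum]
    ring
  simp_rw [h1]
  have h2 := (measurePreserving_uncurry_gaussianArray n L).lintegral_comp
    (f := fun z => ENNReal.ofReal (Real.exp (-∑ p : Fin n × Fin L, (d p.1 - 1) * ‖z p‖ ^ 2)))
    (by fun_prop)
  rw [h2, lintegral_exp_neg_sum_stdGaussian _ fun p => by linarith [hd p.1]]
  congr 1
  rw [logDet, det_mul_of_diagonalization hT hTQ, Complex.ofReal_re, Fintype.prod_prod_type]
  simp only [add_sub_cancel, Finset.prod_const, Finset.card_univ, Fintype.card_fin]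
  rw [Finset.prod_pow, Finset.prod_inv_distrib, ← mul_neg, Real.exp_nat_mul, Real.exp_neg,
    Real.exp_log (Finset.prod_pos fun i _ => hd i)]

theorem IsCN.measure_le_trForm_inv {n L : ℕ} (hn : 1 ≤ n) (hL : 1 ≤ L)
    {ν : Measure (Fin n → Fin L → ℂ)} {F : Matrix (Fin n) (Fin n) ℂ} (hν : IsCN ν F)
    (hF : F.PosDef) (y : ℝ) :
    ν {Y | y ≤ trForm F⁻¹ Y} = ENNReal.ofReal (1 - gammaRatio ((n * L : ℕ) : ℝ) y) := by
  obtain ⟨T, d, hT, hTF, -⟩ := exists_simultaneous_diagonalization hF Matrix.isHermitian_one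
  have : Nonempty (Fin n × Fin L) := ⟨⟨0, hn⟩, ⟨0, hL⟩⟩
  have h := stdGaussian_le_sq_norm (ι := Fin n × Fin L) y
  rw [Fintype.card_prod, Fintype.card_fin, Fintype.card_fin] at h
  rw [hν T hT, Measure.map_apply (measurable_leftMul T)
    (measurableSet_le measurable_const (continuous_trForm _).measurable), ← h,
    ← (measurePreserving_uncurry_gaussianArray n L).measure_preimage
      (measurableSet_le (by fun_prop) (by fun_prop)).nullMeasurableSet]
  congr 1
  ext Z
  simp only [Set.mem_preimage, Set.mem_ofPred_eq, trForm_inv_leftMul hTF, Fintype.sum_prod_type]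

theorem IsCN.measure_trForm_inv_le {n L : ℕ} (hn : 1 ≤ n) (hL : 1 ≤ L)
    {ν : Measure (Fin n → Fin L → ℂ)} {F : Matrix (Fin n) (Fin n) ℂ} (hν : IsCN ν F)
    (hF : F.PosDef) (y : ℝ) :
    ν {Y | trForm F⁻¹ Y ≤ y} = ENNReal.ofReal (gammaRatio ((n * L : ℕ) : ℝ) y) := by
  obtain ⟨T, d, hT, hTF, -⟩ := exists_simultaneous_diagonalization hF Matrix.isHermitian_one
  have : Nonempty (Fin n × Fin L) := ⟨⟨0, hn⟩, ⟨0, hL⟩⟩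
  have h := stdGaussian_sq_norm_le (ι := Fin n × Fin L) y
  rw [Fintype.card_prod, Fintype.card_fin, Fintype.card_fin] at h
  rw [hν T hT, Measure.map_apply (measurable_leftMul T)
    (measurableSet_le (continuous_trForm _).measurable measurable_const), ← h,
    ← (measurePreserving_uncurry_gaussianArray n L).measure_preimage
      (measurableSet_le (by fun_prop) (by fun_prop)).nullMeasurableSet]
  congr 1
  ext Z
  simp only [Set.mem_preimage, Set.mem_ofPred_eq, trForm_inv_leftMul hTF, Fintype.sum_prod_type]

/-- With `F = F₁ + G`, the form `F₁⁻¹ - F⁻¹` is diagonalized together with `F`, its eigenvalues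
relative to `F` being those of `F₁⁻¹ G`. -/
theorem exists_diagonalization_inv_sub_inv {n : ℕ} {F F1 G : Matrix (Fin n) (Fin n) ℂ}
    (hF1 : F1.PosDef) (hG : G.PosSemidef) (hF : F = F1 + G) :
    ∃ (T : Matrix (Fin n) (Fin n) ℂ) (d : Fin n → ℝ), T * Tᴴ = F ∧ Tᴴ * F⁻¹ * T = 1 ∧
      Tᴴ * (F1⁻¹ - F⁻¹) * T = (Matrix.diagonal fun i => (d i : ℂ)) ∧ (∀ i, 0 ≤ d i) ∧
      eigs (F1⁻¹ * G) = Finset.univ.val.map d ∧ Fintype.card {i // d i ≠ 0} = G.rank := by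
  have hFp : F.PosDef := hF ▸ hF1.add_posSemidef hG
  have hdF : IsUnit F.det := (Matrix.isUnit_iff_isUnit_det _).1 hFp.isUnit
  have hdF1 : IsUnit F1.det := (Matrix.isUnit_iff_isUnit_det _).1 hF1.isUnit
  have hQ : (F1⁻¹ - F⁻¹).IsHermitian := hF1.inv.isHermitian.sub hFp.inv.isHermitian
  obtain ⟨T, d, hT, hTF, hTQ⟩ := exists_simultaneous_diagonalization hFp hQ
  have hQF : (F1⁻¹ - F⁻¹) * F = F1⁻¹ * G := by
    rw [Matrix.sub_mul, Matrix.nonsing_inv_mul _ hdF, hF, Matrix.mul_add,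
      Matrix.nonsing_inv_mul _ hdF1, add_sub_cancel_left]
  have hQG : F1⁻¹ - F⁻¹ = F1⁻¹ * G * F⁻¹ := by
    rw [← hQF, Matrix.mul_assoc, Matrix.mul_nonsing_inv _ hdF, Matrix.mul_one]
  have hFQF : F * (F1⁻¹ - F⁻¹) * F = G + Gᴴ * F1⁻¹ * G := by
    rw [Matrix.mul_assoc, hQF, hF, Matrix.add_mul, ← Matrix.mul_assoc,
      Matrix.mul_nonsing_inv _ hdF1, Matrix.one_mul, hG.isHermitian.eq, ← Matrix.mul_assoc]
  have hQpos : (F1⁻¹ - F⁻¹).PosSemidef := by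
    have h := (hG.add (hF1.inv.posSemidef.conjTranspose_mul_mul_same G)).conjTranspose_mul_mul_same
      F⁻¹
    rw [← hFQF, hFp.inv.isHermitian.eq] at h
    have e : F⁻¹ * (F * (F1⁻¹ - F⁻¹) * F) * F⁻¹ = F1⁻¹ - F⁻¹ := by
      rw [Matrix.mul_assoc F, ← Matrix.mul_assoc F⁻¹, Matrix.nonsing_inv_mul _ hdF, Matrix.one_mul,
        Matrix.mul_assoc, Matrix.mul_nonsing_inv _ hdF, Matrix.mul_one]
    rwa [e] at h
  have hdT : IsUnit T.det := by
    rw [← hT, Matrix.det_mul] at hdF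
    exact isUnit_of_mul_isUnit_left hdF
  have hdT' : IsUnit (Tᴴ).det := by
    rw [← hT, Matrix.det_mul] at hdF
    exact isUnit_of_mul_isUnit_right hdF
  refine ⟨T, d, hT, hTF, hTQ, ?_, ?_, ?_⟩
  · have h := hQpos.conjTranspose_mul_mul_same T
    rw [hTQ, Matrix.posSemidef_diagonal_iff] at h
    exact fun i => by exact_mod_cast h i
  · rw [← hQF, eigs_mul_of_diagonalization hT hTQ]
  · have h1 : (Matrix.diagonal fun i => (d i : ℂ)).rank = G.rank := by
      have hdFi : IsUnit (F⁻¹).det := Matrix.isUnit_nonsing_inv_det _ hdF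
      have hdF1i : IsUnit (F1⁻¹).det := Matrix.isUnit_nonsing_inv_det _ hdF1
      rw [← hTQ, Matrix.rank_mul_eq_left_of_isUnit_det _ _ hdT,
        Matrix.rank_mul_eq_right_of_isUnit_det _ _ hdT', hQG,
        Matrix.rank_mul_eq_left_of_isUnit_det _ _ hdFi,
        Matrix.rank_mul_eq_right_of_isUnit_det _ _ hdF1i]
    rw [← h1, Matrix.rank_diagonal]
    simp

theorem prodNonzeroEigs_of_eigs {n : ℕ} {B : Matrix (Fin n) (Fin n) ℂ} {d : Fin n → ℝ}
    (h : eigs B = Finset.univ.val.map d) :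
    prodNonzeroEigs B = ∏ i : {i // d i ≠ 0}, d i := by
  rw [prodNonzeroEigs, h, Multiset.filter_map]
  have : (Multiset.filter ((fun x => x ≠ 0) ∘ d) Finset.univ.val)
      = (Finset.univ.filter fun i => d i ≠ 0).val := rfl
  rw [this, ← Finset.prod_eq_multiset_prod]
  exact (Finset.prod_subtype _ (by simp) d)

theorem le_maxEig_of_eigs {n : ℕ} {B : Matrix (Fin n) (Fin n) ℂ} {d : Fin n → ℝ}
    (h : eigs B = Finset.univ.val.map d) (i : Fin n) : d i ≤ maxEig B := by
  rw [maxEig, h]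
  have : ∀ s : Multiset ℝ, ∀ x ∈ s, x ≤ s.fold max 0 := by
    intro s
    induction s using Multiset.induction with
    | empty => simp
    | cons a s ih =>
      intro x hx
      rw [Multiset.fold_cons_left]
      rcases Multiset.mem_cons.1 hx with rfl | hx
      · exact le_max_left _ _
      · exact (ih x hx).trans (le_max_right _ _)
  exact this _ _ (Multiset.mem_map_of_mem d (Finset.mem_univ i))

theorem maxEig_nonneg {n : ℕ} (B : Matrix (Fin n) (Fin n) ℂ) : 0 ≤ maxEig B := by
  rw [maxEig]
  have : ∀ s : Multiset ℝ, 0 ≤ s.fold max 0 := by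
    intro s
    induction s using Multiset.induction with
    | empty => simp
    | cons a s ih => rw [Multiset.fold_cons_left]; exact ih.trans (le_max_right _ _)
  exact this _

/-- Small deviations of the part of the quadratic form that comes from `G`: Okamoto's inequality,
with each nonzero eigenvalue of `F₁⁻¹ G` occurring once for every antenna. -/
theorem IsCN.measure_trForm_inv_sub_inv_le {n L : ℕ} (hL : 1 ≤ L)
    {ν : Measure (Fin n → Fin L → ℂ)} {F F1 G : Matrix (Fin n) (Fin n) ℂ} (hν : IsCN ν F)
    (hF1 : F1.PosDef) (hG : G.PosSemidef) (hF : F = F1 + G) {m : ℕ} (hm : 1 ≤ m)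
    (hrank : G.rank = m) (x : ℝ) :
    ν {Y | trForm F1⁻¹ Y - trForm F⁻¹ Y ≤ x}
      ≤ ENNReal.ofReal (gammaRatio ((L * m : ℕ) : ℝ)
          (prodNonzeroEigs (F1⁻¹ * G) ^ (-(1 / (m : ℝ))) * x)) := by
  obtain ⟨T, d, hT, hTF, hTQ, hd, heigs, hcard⟩ := exists_diagonalization_inv_sub_inv hF1 hG hF
  rw [hrank] at hcard
  have : Nonempty ({i // d i ≠ 0} × Fin L) := by
    have h1 : Nonempty {i // d i ≠ 0} := Fintype.card_pos_iff.1 (by omega)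
    have h2 : Nonempty (Fin L) := ⟨⟨0, hL⟩⟩
    infer_instance
  have hpos : ∀ i : {i // d i ≠ 0}, 0 < d i := fun i => lt_of_le_of_ne (hd i) (Ne.symm i.2)
  have h := stdGaussian_weighted_sq_norm_le (ι := {i // d i ≠ 0} × Fin L) (fun p => d p.1)
    (fun p => hpos p.1) x
  have hprod : (∏ p : {i // d i ≠ 0} × Fin L, d p.1)
      ^ (-(1 / (Fintype.card ({i // d i ≠ 0} × Fin L) : ℝ)))
      = prodNonzeroEigs (F1⁻¹ * G) ^ (-(1 / (m : ℝ))) := by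
    have hp0 : 0 ≤ ∏ i : {i // d i ≠ 0}, d i := Finset.prod_nonneg fun i _ => hd i
    rw [prodNonzeroEigs_of_eigs heigs, Fintype.prod_prod_type]
    simp only [Finset.prod_const, Finset.card_univ, Fintype.card_fin, Fintype.card_prod, hcard]
    rw [Finset.prod_pow, ← Real.rpow_natCast, ← Real.rpow_mul hp0]
    congr 1
    have : (L : ℝ) ≠ 0 := by positivity
    push_cast
    field_simp
  rw [hprod, Fintype.card_prod, hcard, Fintype.card_fin, mul_comm m L] at h
  refine le_trans (le_of_eq ?_) h
  have hinj : Function.Injective fun p : {i // d i ≠ 0} × Fin L => ((p.1 : Fin n), p.2) := by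
    rintro ⟨a, b⟩ ⟨a', b'⟩ hab
    simp only [Prod.mk.injEq] at hab
    exact Prod.ext (Subtype.ext hab.1) hab.2
  have hmp := (measurePreserving_comp_injective (complexGaussian 1) hinj).comp
    (measurePreserving_uncurry_gaussianArray n L)
  have hm1 := (continuous_trForm (L := L) F1⁻¹).measurable
  have hm2 := (continuous_trForm (L := L) F⁻¹).measurable
  rw [hν T hT, Measure.map_apply (measurable_leftMul T)
    (measurableSet_le (f := fun Y => trForm F1⁻¹ Y - trForm F⁻¹ Y) (hm1.sub hm2)
      measurable_const), ← hmp.measure_preimage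
      (measurableSet_le (by fun_prop) (by fun_prop)).nullMeasurableSet]
  congr 1
  ext Z
  simp only [Set.mem_preimage, Set.mem_ofPred_eq, Function.comp, ← trForm_sub,
    trForm_leftMul hTQ, Fintype.sum_prod_type]
  simp_rw [← Finset.mul_sum]
  have hsum : ∑ i, d i * ∑ l, ‖Z i l‖ ^ 2
      = ∑ i : {i // d i ≠ 0}, d i * ∑ l, ‖Z i l‖ ^ 2 := by
    rw [← Finset.sum_subtype (Finset.univ.filter fun i => d i ≠ 0) (by simp)
      (fun i => d i * ∑ l, ‖Z i l‖ ^ 2), Finset.sum_filter]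
    refine Finset.sum_congr rfl fun i _ => ?_
    split_ifs with h0
    · rfl
    · rw [not_not.1 h0, zero_mul]
  rw [hsum]

/-- Large deviations of the energy contributed by `G`, bounded through its largest eigenvalue. -/
theorem IsCN.measure_le_trForm_one_sub_inv {n L : ℕ} (hL : 1 ≤ L)
    {ν : Measure (Fin n → Fin L → ℂ)} {F G : Matrix (Fin n) (Fin n) ℂ} (hν : IsCN ν F)
    (hG : G.PosSemidef) (hF : F = 1 + G) {m : ℕ} (hm : 1 ≤ m) (hmn : m ≤ n)
    (hrank : G.rank ≤ m) (hmax : 0 < maxEig G) (x : ℝ) :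
    ν {Y | x ≤ trForm 1 Y - trForm F⁻¹ Y}
      ≤ ENNReal.ofReal (1 - gammaRatio ((L * m : ℕ) : ℝ) (x / maxEig G)) := by
  obtain ⟨T, d, hT, hTF, hTQ, hd, heigs, hcard⟩ :=
    exists_diagonalization_inv_sub_inv Matrix.PosDef.one hG hF
  rw [inv_one] at hTQ heigs
  rw [Matrix.one_mul] at heigs
  -- `m` coordinates that include all those with a nonzero weight
  obtain ⟨N, hN, hNcard⟩ := Finset.exists_superset_card_eq
    (s := Finset.univ.filter fun i => d i ≠ 0) (n := m)
    (by rw [← Fintype.card_subtype, hcard]; exact hrank) (by simpa using hmn)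
  have : Nonempty (N × Fin L) := by
    have h1 : Nonempty N := Fintype.card_pos_iff.1 (by rw [Fintype.card_coe]; omega)
    have h2 : Nonempty (Fin L) := ⟨⟨0, hL⟩⟩
    infer_instance
  have h := stdGaussian_le_sq_norm (ι := N × Fin L) (x / maxEig G)
  rw [Fintype.card_prod, Fintype.card_coe, hNcard, Fintype.card_fin, mul_comm m L] at h
  rw [← h]
  have hinj : Function.Injective fun p : N × Fin L => ((p.1 : Fin n), p.2) := by
    rintro ⟨a, b⟩ ⟨a', b'⟩ hab
    simp only [Prod.mk.injEq] at hab
    exact Prod.ext (Subtype.ext hab.1) hab.2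
  have hmp := (measurePreserving_comp_injective (complexGaussian 1) hinj).comp
    (measurePreserving_uncurry_gaussianArray n L)
  have hm1 := (continuous_trForm (L := L) (1 : Matrix (Fin n) (Fin n) ℂ)).measurable
  have hm2 := (continuous_trForm (L := L) F⁻¹).measurable
  rw [hν T hT, Measure.map_apply (measurable_leftMul T)
    (measurableSet_le (g := fun Y => trForm 1 Y - trForm F⁻¹ Y) measurable_const
      (hm1.sub hm2)), ← hmp.measure_preimage
      (measurableSet_le (by fun_prop) (by fun_prop)).nullMeasurableSet]
  refine measure_mono fun Z hZ => ?_
  simp only [Set.mem_preimage, Set.mem_ofPred_eq, Function.comp, ← trForm_sub,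
    trForm_leftMul hTQ, Fintype.sum_prod_type] at hZ ⊢
  rw [div_le_iff₀ hmax]
  calc x ≤ ∑ i, d i * ∑ l, ‖Z i l‖ ^ 2 := hZ
    _ = ∑ i ∈ N, d i * ∑ l, ‖Z i l‖ ^ 2 := by
        refine (Finset.sum_subset (Finset.subset_univ N) fun i _ hi => ?_).symm
        have : d i = 0 := by
          by_contra h0
          exact hi (hN (by simpa using h0))
        rw [this, zero_mul]
    _ ≤ ∑ i ∈ N, maxEig G * ∑ l, ‖Z i l‖ ^ 2 := by
        refine Finset.sum_le_sum fun i _ => mul_le_mul_of_nonneg_right (le_maxEig_of_eigs heigs i)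
          (Finset.sum_nonneg fun l _ => by positivity)
    _ = (∑ i : N, ∑ l, ‖Z i l‖ ^ 2) * maxEig G := by
        rw [← Finset.mul_sum, mul_comm, Finset.sum_coe_sort N fun i => ∑ l, ‖Z i l‖ ^ 2]

/-! ### Rank of Gaussian matrices -/

/-- The law of a vector with i.i.d. `CN(0, v)` entries is a scaled standard Gaussian law. -/
theorem pi_complexGaussian_eq_map (ι : Type*) [Fintype ι] {v : ℝ} (hv : 0 ≤ v) :
    (Measure.pi fun _ : ι => complexGaussian v)
      = (stdGaussian ι).map fun z i => (Real.sqrt v : ℂ) * z i := by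
  have : SigmaFinite ((complexGaussian 1).map fun z => (Real.sqrt v : ℂ) * z) := by
    rw [← complexGaussian_eq_map hv]; infer_instance
  rw [complexGaussian_eq_map hv, stdGaussian,
    Measure.pi_map_pi (f := fun _ z => (Real.sqrt v : ℂ) * z) fun i => by fun_prop]

/-- Proper subspaces are null sets of a nondegenerate Gaussian law. -/
theorem pi_complexGaussian_submodule {ι : Type*} [Fintype ι] {v : ℝ} (hv : 0 < v)
    (p : Submodule ℂ (ι → ℂ)) (hp : p ≠ ⊤) :
    (Measure.pi fun _ : ι => complexGaussian v) (p : Set (ι → ℂ)) = 0 := by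
  have hne : (Real.sqrt v : ℂ) ≠ 0 := by exact_mod_cast (Real.sqrt_pos.2 hv).ne'
  have hm : MeasurableSet (p : Set (ι → ℂ)) := p.closed_of_finiteDimensional.measurableSet
  rw [pi_complexGaussian_eq_map ι hv.le, Measure.map_apply (by fun_prop) hm]
  have : (fun (z : ι → ℂ) i => (Real.sqrt v : ℂ) * z i) ⁻¹' (p : Set (ι → ℂ)) = p := by
    ext z
    exact p.smul_mem_iff hne
  rw [this, stdGaussian_eq_withDensity]
  refine withDensity_absolutelyContinuous _ _ ?_
  have h := Measure.addHaar_submodule (volume : Measure (ι → ℂ)) (p.restrictScalars ℝ) (by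
    intro h
    exact hp ((Submodule.restrictScalars_eq_top_iff ℝ ℂ _).1 h))
  exact h

/-- Each further vector almost surely avoids the span of the previous ones. -/
theorem ae_linearIndependent_gaussianArray {n : ℕ} {v : ℝ} (hv : 0 < v) :
    ∀ q ≤ n, ∀ᵐ A ∂(gaussianArray q n v), LinearIndependent ℂ A := by
  intro q
  induction q with
  | zero => intro _; exact ae_of_all _ fun A => linearIndependent_empty_type
  | succ q ih =>
    intro hq
    have hmp := measurePreserving_piFinSuccAbove
      (fun _ : Fin (q + 1) => Measure.pi fun _ : Fin n => complexGaussian v) 0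
    have hopen : IsOpen {A : Fin (q + 1) → Fin n → ℂ | LinearIndependent ℂ A} :=
      isOpen_setOfPred_linearIndependent
    have hmeas : MeasurableSet {z : (Fin n → ℂ) × (Fin q → Fin n → ℂ) |
        LinearIndependent ℂ (Fin.cons z.1 z.2 : Fin (q + 1) → Fin n → ℂ)} := by
      refine hopen.measurableSet.preimage
        (f := fun z : (Fin n → ℂ) × (Fin q → Fin n → ℂ) =>
          (Fin.cons z.1 z.2 : Fin (q + 1) → Fin n → ℂ)) ?_
      refine measurable_pi_lambda _ fun i => ?_
      refine Fin.cases ?_ (fun i => ?_) i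
      · exact measurable_fst
      · exact (measurable_pi_apply i).comp measurable_snd
    have key : ∀ᵐ z ∂((Measure.pi fun _ : Fin n => complexGaussian v).prod (gaussianArray q n v)),
        LinearIndependent ℂ (Fin.cons z.1 z.2 : Fin (q + 1) → Fin n → ℂ) := by
      rw [Measure.ae_prod_iff_ae_ae hmeas, Measure.ae_ae_comm hmeas]
      filter_upwards [ih (by omega)] with A hA
      have hspan : Submodule.span ℂ (Set.range A) ≠ ⊤ := by
        intro h
        have h1 := finrank_span_eq_card hA
        rw [h, finrank_top, Module.finrank_fin_fun, Fintype.card_fin] at h1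
        omega
      have h0 := pi_complexGaussian_submodule hv _ hspan
      filter_upwards [measure_eq_zero_iff_ae_notMem.1 h0] with x hx
      exact linearIndependent_finCons.2 ⟨hA, hx⟩
    have h2 := hmp.quasiMeasurePreserving.ae key
    filter_upwards [h2] with A hA
    convert hA
    exact (Fin.cons_self_tail A).symm

/-- The Gram matrix of `s` of the columns of a Gaussian matrix almost surely has the largest
possible rank. -/
theorem ae_rank_gram_gaussianArray {n ka s : ℕ} {v : ℝ} (hv : 0 < v) (hs : s ≤ ka) :
    ∀ᵐ A ∂(gaussianArray ka n v),
      (gram A (Finset.univ.filter fun j => j.val < s)).rank = min n s := by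
  have hinj : Function.Injective (Fin.castLE ((min_le_right n s).trans hs)) :=
    Fin.castLE_injective _
  have hmp := measurePreserving_comp_injective
    (Measure.pi fun _ : Fin n => complexGaussian v) hinj
  have h := hmp.quasiMeasurePreserving.ae
    (ae_linearIndependent_gaussianArray hv (min n s) (min_le_left n s))
  filter_upwards [h] with A hA
  let S : Finset (Fin ka) := Finset.univ.filter fun j => j.val < s
  let B : Matrix (Fin n) S ℂ := Matrix.of fun i j => A j i
  have hB : gram A S = B * Bᴴ := by
    ext i i'
    rw [gram, Matrix.sum_apply, Matrix.mul_apply, ← Finset.sum_coe_sort S]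
    rfl
  change (gram A S).rank = _
  rw [hB, Matrix.rank_self_mul_conjTranspose]
  refine le_antisymm (le_min ?_ ?_) ?_
  · exact B.rank_le_card_height.trans (Fintype.card_fin n).le
  · refine (Matrix.rank_le_card_width B).trans ?_
    rw [Fintype.card_coe]
    have : S.card = (Finset.univ.filter fun j : Fin ka => j.val < s).card := rfl
    rw [this, Fin.card_filter_val_lt]
    exact min_le_right _ _
  · rw [Matrix.rank_eq_finrank_span_cols]
    have h1 := finrank_span_eq_card hA
    rw [Fintype.card_fin] at h1
    rw [← h1]
    refine Submodule.finrank_mono (Submodule.span_mono ?_)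
    rintro _ ⟨j, rfl⟩
    refine ⟨⟨Fin.castLE ((min_le_right n s).trans hs) j, ?_⟩, rfl⟩
    simp only [S, Finset.mem_filter, Finset.mem_univ, true_and, Fin.val_castLE]
    exact lt_of_lt_of_le j.2 (min_le_right _ _)

/-! ### Error events for given codewords -/

theorem posSemidef_gram {n q : ℕ} (A : Fin q → Fin n → ℂ) (T : Finset (Fin q)) :
    (gram A T).PosSemidef :=
  Matrix.posSemidef_sum _ fun j _ => Matrix.posSemidef_vecMulVec_self_star (A j)

theorem posDef_matF1 {n ka : ℕ} (A : Fin ka → Fin n → ℂ) (s : ℕ) : (matF1 A s).PosDef :=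
  Matrix.PosDef.one.add_posSemidef (posSemidef_gram _ _)

theorem posDef_matF {n ka : ℕ} (A : Fin ka → Fin n → ℂ) : (matF A).PosDef :=
  Matrix.PosDef.one.add_posSemidef (posSemidef_gram _ _)

theorem posDef_matF' {n ka q : ℕ} (A : Fin ka → Fin n → ℂ) (A' : Fin q → Fin n → ℂ) (s : ℕ) :
    (matF' A A' s).PosDef :=
  (posDef_matF1 A s).add_posSemidef (posSemidef_gram _ _)

theorem posDef_matF'' {n ka q : ℕ} (A : Fin ka → Fin n → ℂ) (A' : Fin q → Fin n → ℂ) (a c : ℕ) :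
    (matF'' A A' a c).PosDef :=
  (posDef_matF1 A a).add_posSemidef (posSemidef_gram _ _)

theorem matF_eq_matF1_add_gram {n ka : ℕ} (A : Fin ka → Fin n → ℂ) (s : ℕ) :
    matF A = matF1 A s + gram A (Finset.univ.filter fun j => j.val < s) := by
  rw [matF, matF1, add_assoc]
  congr 1
  simp only [gram]
  rw [add_comm, ← Finset.sum_filter_add_sum_filter_not Finset.univ fun j : Fin ka => j.val < s]
  simp only [not_lt]

theorem matF1_zero {n ka : ℕ} (A : Fin ka → Fin n → ℂ) : matF1 A 0 = matF A := by
  simp [matF1, matF]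

/-- The decoding metric `L ln|F| + tr(F⁻¹ Y Yᴴ) - b`. -/
def metric {n L : ℕ} (F : Matrix (Fin n) (Fin n) ℂ) (b : ℝ) (Y : Fin n → Fin L → ℂ) : ℝ :=
  L * logDet F + trForm F⁻¹ Y - b

theorem IsCN.isProbabilityMeasure {n L : ℕ} {ν : Measure (Fin n → Fin L → ℂ)}
    {F : Matrix (Fin n) (Fin n) ℂ} (hν : IsCN ν F) (hF : F.PosDef) : IsProbabilityMeasure ν := by
  obtain ⟨T, hT⟩ := exists_eq_mul_conjTranspose hF.posSemidef
  rw [hν T hT]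
  exact Measure.isProbabilityMeasure_map (measurable_leftMul T).aemeasurable

/-- The Chernoff bound for Gaussian quadratic forms. -/
theorem IsCN.measure_le_exp {n L : ℕ} {ν : Measure (Fin n → Fin L → ℂ)}
    {F Q : Matrix (Fin n) (Fin n) ℂ} (hν : IsCN ν F) (hF : F.PosDef) (hQ : Q.IsHermitian)
    (hpos : ∀ x ∈ eigs (Q * F), 0 < x) (κ : ℝ) {E : Set (Fin n → Fin L → ℂ)}
    (hE : ∀ Y ∈ E, 0 ≤ κ - (trForm Q Y - trForm F⁻¹ Y)) :
    ν E ≤ ENNReal.ofReal (Real.exp (κ - L * logDet (Q * F))) := by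
  have hc := continuous_trForm (L := L) Q
  have hc' := continuous_trForm (L := L) F⁻¹
  have hf : Continuous fun Y => κ - (trForm Q Y - trForm (L := L) F⁻¹ Y) := by fun_prop
  calc ν E ≤ ν {Y | 0 ≤ κ - (trForm Q Y - trForm F⁻¹ Y)} := measure_mono hE
    _ = ∫⁻ Y, {Y | 0 ≤ κ - (trForm Q Y - trForm F⁻¹ Y)}.indicator 1 Y ∂ν :=
        (lintegral_indicator_one (measurableSet_le measurable_const hf.measurable)).symm
    _ ≤ ∫⁻ Y, ENNReal.ofReal (Real.exp κ) *
          ENNReal.ofReal (Real.exp (-(trForm Q Y - trForm F⁻¹ Y))) ∂ν := by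
        refine lintegral_mono fun Y => ?_
        rw [← ENNReal.ofReal_mul (Real.exp_pos _).le, ← Real.exp_add, ← sub_eq_add_neg]
        by_cases hY : Y ∈ {Y | 0 ≤ κ - (trForm Q Y - trForm F⁻¹ Y)}
        · rw [Set.indicator_of_mem hY, Pi.one_apply, ← ENNReal.ofReal_one]
          exact ENNReal.ofReal_le_ofReal (Real.one_le_exp hY)
        · rw [Set.indicator_of_notMem hY]
          exact bot_le
    _ = ENNReal.ofReal (Real.exp (κ - L * logDet (Q * F))) := by
        rw [lintegral_const_mul _ (by fun_prop), hν.lintegral_exp_trForm hF hQ hpos,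
          ← ENNReal.ofReal_mul (Real.exp_pos _).le, ← Real.exp_add, ← sub_eq_add_neg]

/-- The candidate with covariance `F'` beats the one with covariance `F''` while the transmitted
list is in the good region: Chernoff bound with multipliers `u` and `r`. -/
theorem IsCN.measure_confusion_le {n L : ℕ} {ν : Measure (Fin n → Fin L → ℂ)}
    {F F1 F' F'' : Matrix (Fin n) (Fin n) ℂ} (hν : IsCN ν F) (hF : F.PosDef) (hF1 : F1.PosDef)
    (hF' : F'.PosDef) (hF'' : F''.PosDef) (b b1 b' b'' ω ν₀ : ℝ) :
    ν {Y | metric F' b' Y ≤ metric F'' b'' Y ∧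
        metric F b Y ≤ ω * metric F1 b1 Y + n * L * ν₀}
      ≤ ⨅ (u : ℝ) (r : ℝ) (_ : 0 ≤ u ∧ 0 ≤ r ∧ ∀ x ∈ eigs (matB F F1 F' F'' ω u r), 0 < x),
        ENNReal.ofReal
          (Real.exp (L * r * n * ν₀ + (-(u * b'') + r * b + u * b' - r * ω * b1))
            * Real.exp (L * (u * logDet F'' - r * logDet F - u * logDet F'
                + r * ω * logDet F1 - logDet (matB F F1 F' F'' ω u r)))) := by
  refine le_iInf fun u => le_iInf fun r => le_iInf fun ⟨hu, hr, hpos⟩ => ?_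
  have hdF : IsUnit F.det := (Matrix.isUnit_iff_isUnit_det _).1 hF.isUnit
  have hreal : ∀ (a : ℝ) (M : Matrix (Fin n) (Fin n) ℂ), M.IsHermitian →
      ((a : ℂ) • M).IsHermitian := by
    intro a M hM
    rw [Matrix.IsHermitian, Matrix.conjTranspose_smul, hM.eq]
    simp
  -- the form for which `Q F` is the matrix `B`
  set Q : Matrix (Fin n) (Fin n) ℂ := ((1 + r : ℝ) : ℂ) • F⁻¹ - (u : ℂ) • F''⁻¹ + (u : ℂ) • F'⁻¹
    - ((r * ω : ℝ) : ℂ) • F1⁻¹ with hQdef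
  have hQ : Q.IsHermitian :=
    (((hreal _ _ hF.inv.isHermitian).sub (hreal _ _ hF''.inv.isHermitian)).add
      (hreal _ _ hF'.inv.isHermitian)).sub (hreal _ _ hF1.inv.isHermitian)
  have hB : matB F F1 F' F'' ω u r = Q * F := by
    rw [matB, hQdef]
    simp only [Matrix.sub_mul, Matrix.add_mul, Matrix.smul_mul, Matrix.nonsing_inv_mul _ hdF]
  rw [hB] at hpos ⊢
  rw [← Real.exp_add]
  refine (hν.measure_le_exp hF hQ hpos
    (u * (L * logDet F'' - b'' - (L * logDet F' - b')) + r * (n * L * ν₀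
      + ω * (L * logDet F1 - b1) - (L * logDet F - b))) fun Y hY => ?_).trans_eq ?_
  · obtain ⟨h1, h2⟩ := hY
    have h3 := mul_nonneg hu (sub_nonneg.2 h1)
    have h4 := mul_nonneg hr (sub_nonneg.2 h2)
    rw [hQdef, trForm_sub, trForm_add, trForm_sub, trForm_smul, trForm_smul, trForm_smul,
      trForm_smul]
    simp only [metric] at h3 h4
    nlinarith [h3, h4]
  · congr 2
    ring

/-- The transmitted list leaves the good region, for a nonempty set of misdetected codewords: either
`tr (F⁻¹ Y Yᴴ)` is at least `nL(1 + δ)`, or the part of the form that comes from the misdetected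
codewords is small. -/
theorem IsCN.measure_not_good_le (S : Model) (hn : 1 ≤ S.n) (hL : 1 ≤ S.L) {r' ka k' t : ℕ}
    {A : Fin ka → Fin S.n → ℂ} {ν : Measure (Fin S.n → Fin S.L → ℂ)} (hν : IsCN ν (matF A))
    (hs : 0 < missCount S r' ka k' t)
    (hrank : (gram A (Finset.univ.filter fun j => j.val < missCount S r' ka k' t)).rank
      = min S.n (missCount S r' ka k' t)) {ω : ℝ} (hω : 0 ≤ ω) (hω1 : ω ≤ 1) (ν₀ δ : ℝ) :
    ν {Y | ω * metric (matF1 A (missCount S r' ka k' t)) (b1Const S r' ka k' t) Y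
          + S.n * S.L * ν₀ < metric (matF A) (bConst S ka) Y}
      ≤ ENNReal.ofReal (1 - gammaRatio ((S.n * S.L : ℕ) : ℝ) (S.n * S.L * (1 + δ)))
        + ENNReal.ofReal (q2Integrand S r' ka k' t A ω ν₀ δ) := by
  set s := missCount S r' ka k' t with hsdef
  set G := gram A (Finset.univ.filter fun j => j.val < s) with hG
  have hFG : matF A = matF1 A s + G := matF_eq_matF1_add_gram A s
  set X := q2Numerator S r' ka k' t A ω ν₀ δ with hX
  have hsub : {Y : Fin S.n → Fin S.L → ℂ |
      ω * metric (matF1 A s) (b1Const S r' ka k' t) Y + S.n * S.L * ν₀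
        < metric (matF A) (bConst S ka) Y} ⊆
      {Y | S.n * S.L * (1 + δ) ≤ trForm (matF A)⁻¹ Y} ∪
      {Y | ω * (trForm (matF1 A s)⁻¹ Y - trForm (matF A)⁻¹ Y) < X} := by
    intro Y hY
    by_cases h : S.n * S.L * (1 + δ) ≤ trForm (matF A)⁻¹ Y
    · exact Or.inl h
    · refine Or.inr ?_
      have h' := mul_le_mul_of_nonneg_right (not_le.1 h).le (sub_nonneg.2 hω1)
      simp only [metric, Set.mem_ofPred_eq] at hY ⊢
      rw [hX, q2Numerator, ← hsdef]
      linarith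
  refine (measure_mono hsub).trans ((measure_union_le _ _).trans (add_le_add ?_ ?_))
  · exact (hν.measure_le_trForm_inv hn hL (posDef_matF A) _).le
  · rw [q2Integrand]
    simp only [← hsdef, ← hX, ← hG]
    split_ifs with h0 h1
    · have := hν.isProbabilityMeasure (posDef_matF A)
      simpa using prob_le_one
    · have : {Y : Fin S.n → Fin S.L → ℂ |
          ω * (trForm (matF1 A s)⁻¹ Y - trForm (matF A)⁻¹ Y) < X} = ∅ := by
        ext Y; simp [h0]; linarith
      rw [this]; simp
    · have hω0 : 0 < ω := lt_of_le_of_ne hω (Ne.symm h0)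
      refine le_trans (measure_mono fun Y hY => ?_)
        (hν.measure_trForm_inv_sub_inv_le hL (posDef_matF1 A s) (posSemidef_gram _ _) hFG
          (m := min S.n s) (le_min hn hs) hrank (X / ω))
      have hY : ω * (trForm (matF1 A s)⁻¹ Y - trForm (matF A)⁻¹ Y) < X := hY
      refine (le_div_iff₀ hω0).2 ?_
      linarith

/-- Without misdetected codewords, leaving the good region means that `tr (F⁻¹ Y Yᴴ)` is large. -/
theorem IsCN.measure_not_good_zero_le (S : Model) (hn : 1 ≤ S.n) (hL : 1 ≤ S.L) {ka : ℕ}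
    {A : Fin ka → Fin S.n → ℂ} {ν : Measure (Fin S.n → Fin S.L → ℂ)} (hν : IsCN ν (matF A))
    {ω : ℝ} (hω1 : ω < 1) (ν₀ : ℝ) :
    ν {Y | ω * metric (matF A) (bConst S ka) Y + S.n * S.L * ν₀ < metric (matF A) (bConst S ka) Y}
      ≤ ENNReal.ofReal (1 - gammaRatio ((S.n * S.L : ℕ) : ℝ)
          (S.n * S.L * ν₀ / (1 - ω) - S.L * logDet (matF A) + bConst S ka)) := by
  rw [← hν.measure_le_trForm_inv hn hL (posDef_matF A)]
  refine measure_mono fun Y hY => ?_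
  simp only [metric, Set.mem_ofPred_eq] at hY ⊢
  have h1 : 0 < 1 - ω := sub_pos.2 hω1
  have : S.n * S.L * ν₀ / (1 - ω) ≤ S.L * logDet (matF A) + trForm (matF A)⁻¹ Y - bConst S ka := by
    rw [div_le_iff₀ h1]
    linarith
  linarith

/-- If the received energy is small, then the whitened energy `tr (F⁻¹ Y Yᴴ)` or the rest
`tr ((I - F⁻¹) Y Yᴴ)`, which comes from the codewords, is small. -/
theorem IsCN.measure_energy_le {n L : ℕ} (hn : 1 ≤ n) (hL : 1 ≤ L) {ka : ℕ}
    {A : Fin ka → Fin n → ℂ} {ν : Measure (Fin n → Fin L → ℂ)} (hν : IsCN ν (matF A))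
    (hrank : (gram A Finset.univ).rank = min n ka) (θ η : ℝ) :
    ν {Y | trForm 1 Y ≤ n * L * θ}
      ≤ ENNReal.ofReal (gammaRatio ((L * min n ka : ℕ) : ℝ)
          (prodNonzeroEigs (gram A Finset.univ) ^ (-(1 / ((min n ka : ℕ) : ℝ)))
            * (n * L * (θ - η))))
        + ENNReal.ofReal (gammaRatio ((n * L : ℕ) : ℝ) (n * L * η)) := by
  have := hν.isProbabilityMeasure (posDef_matF A)
  have hn0 : (0 : ℝ) < n := by exact_mod_cast hn
  have hL0 : (0 : ℝ) < L := by exact_mod_cast hL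
  -- without codewords `F = I`, and the first gamma ratio is `0` or `1` by the sign of `θ - η`
  rcases Nat.eq_zero_or_pos ka with hka | hka
  · by_cases hθ : 0 < θ - η
    · refine prob_le_one.trans ?_
      have h1 : gammaRatio ((L * min n ka : ℕ) : ℝ)
          (prodNonzeroEigs (gram A Finset.univ) ^ (-(1 / ((min n ka : ℕ) : ℝ)))
            * (n * L * (θ - η))) = 1 := by
        have : min n ka = 0 := by omega
        rw [this]
        simp only [gammaRatio, mul_zero, Nat.cast_zero, if_true, div_zero, neg_zero,
          Real.rpow_zero, one_mul]
        rw [if_pos (by positivity)]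
      rw [h1, ENNReal.ofReal_one]
      exact le_self_add
    · refine le_trans ?_ le_add_self
      rw [← hν.measure_trForm_inv_le hn hL (posDef_matF A)]
      refine measure_mono fun Y hY => ?_
      have hF : matF A = 1 := by
        subst hka
        simp [matF, gram]
      simp only [Set.mem_ofPred_eq, hF, inv_one] at hY ⊢
      refine hY.trans (mul_le_mul_of_nonneg_left (by linarith) (by positivity))
  · have hsub : {Y : Fin n → Fin L → ℂ | trForm 1 Y ≤ n * L * θ} ⊆
        {Y | trForm 1⁻¹ Y - trForm (matF A)⁻¹ Y ≤ n * L * (θ - η)} ∪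
        {Y | trForm (matF A)⁻¹ Y ≤ n * L * η} := by
      intro Y hY
      by_cases h : trForm (matF A)⁻¹ Y ≤ n * L * η
      · exact Or.inr h
      · left
        simp only [Set.mem_ofPred_eq, inv_one] at hY ⊢
        linarith [not_le.1 h]
    refine (measure_mono hsub).trans ((measure_union_le _ _).trans (add_le_add ?_ ?_))
    · have h := hν.measure_trForm_inv_sub_inv_le hL Matrix.PosDef.one (posSemidef_gram A _) rfl
        (m := min n ka) (le_min hn hka) hrank (n * L * (θ - η))
      rwa [inv_one, Matrix.one_mul, ← inv_one] at h
    · exact (hν.measure_trForm_inv_le hn hL (posDef_matF A) _).le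

/-- If the received energy is large, then the whitened energy or the rest is large. -/
theorem IsCN.measure_le_energy {n L : ℕ} (hn : 1 ≤ n) (hL : 1 ≤ L) {ka : ℕ}
    {A : Fin ka → Fin n → ℂ} {ν : Measure (Fin n → Fin L → ℂ)} (hν : IsCN ν (matF A))
    (hrank : (gram A Finset.univ).rank = min n ka) (θ η : ℝ) :
    ν {Y | n * L * θ ≤ trForm 1 Y}
      ≤ ENNReal.ofReal (1 - gammaRatio ((L * min n ka : ℕ) : ℝ)
          (n * L / (if ka = 0 then 1 else maxEig (gram A Finset.univ)) * (θ - η)))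
        + ENNReal.ofReal (1 - gammaRatio ((n * L : ℕ) : ℝ) (n * L * η)) := by
  have := hν.isProbabilityMeasure (posDef_matF A)
  have hn0 : (0 : ℝ) < n := by exact_mod_cast hn
  have hL0 : (0 : ℝ) < L := by exact_mod_cast hL
  -- without codewords `F = I`, and the first gamma ratio is `0` or `1` by the sign of `θ - η`
  rcases Nat.eq_zero_or_pos ka with hka | hka
  · by_cases hθ : 0 < θ - η
    · refine le_trans ?_ le_add_self
      rw [← hν.measure_le_trForm_inv hn hL (posDef_matF A)]
      refine measure_mono fun Y hY => ?_
      have hF : matF A = 1 := by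
        subst hka
        simp [matF, gram]
      simp only [Set.mem_ofPred_eq, hF, inv_one] at hY ⊢
      refine le_trans (mul_le_mul_of_nonneg_left (by linarith) (by positivity)) hY
    · refine prob_le_one.trans ?_
      have h1 : gammaRatio ((L * min n ka : ℕ) : ℝ)
          (n * L / (if ka = 0 then 1 else maxEig (gram A Finset.univ)) * (θ - η)) = 0 := by
        have : min n ka = 0 := by omega
        rw [this]
        simp only [gammaRatio, mul_zero, Nat.cast_zero, if_true, hka, div_one]
        rw [if_neg]
        exact not_lt.2 (mul_nonpos_of_nonneg_of_nonpos (by positivity) (not_lt.1 hθ))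
      rw [h1, sub_zero, ENNReal.ofReal_one]
      exact le_self_add
  · rw [if_neg hka.ne']
    -- for `maxEig = 0` the division by zero makes the bound trivial
    rcases (maxEig_nonneg (gram A Finset.univ)).eq_or_lt with hmax | hmax
    · refine prob_le_one.trans ?_
      have hne : ((L * min n ka : ℕ) : ℝ) ≠ 0 := by
        have : 0 < L * min n ka := Nat.mul_pos hL (lt_min hn hka)
        exact_mod_cast this.ne'
      have h1 : gammaRatio ((L * min n ka : ℕ) : ℝ)
          (n * L / maxEig (gram A Finset.univ) * (θ - η)) = 0 := by
        rw [← hmax, div_zero, zero_mul, gammaRatio, if_neg hne, lowerGamma, if_pos le_rfl,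
          zero_div]
      rw [h1, sub_zero, ENNReal.ofReal_one]
      exact le_self_add
    · have hsub : {Y : Fin n → Fin L → ℂ | n * L * θ ≤ trForm 1 Y} ⊆
          {Y | n * L * (θ - η) ≤ trForm 1 Y - trForm (matF A)⁻¹ Y} ∪
          {Y | n * L * η ≤ trForm (matF A)⁻¹ Y} := by
        intro Y hY
        by_cases h : n * L * η ≤ trForm (matF A)⁻¹ Y
        · exact Or.inr h
        · left
          simp only [Set.mem_ofPred_eq] at hY ⊢
          linarith [not_le.1 h]
      refine (measure_mono hsub).trans ((measure_union_le _ _).trans (add_le_add ?_ ?_))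
      · have h := hν.measure_le_trForm_one_sub_inv hL (posSemidef_gram A _) rfl
          (m := min n ka) (le_min hn hka) (min_le_left _ _) hrank.le hmax (n * L * (θ - η))
        rwa [mul_div_right_comm] at h
      · exact (hν.measure_le_trForm_inv hn hL (posDef_matF A) _).le

/-- The eigenvalues of `I + ρ F`, in terms of those of `G = F - I`. -/
theorem exists_eigs_one_add_smul {n : ℕ} {F G : Matrix (Fin n) (Fin n) ℂ} (hG : G.PosSemidef)
    (hF : F = 1 + G) :
    ∃ d : Fin n → ℝ, (∀ i, 0 ≤ d i) ∧ (∀ i, d i ≤ maxEig G) ∧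
      ∀ ρ : ℝ, eigs ((F⁻¹ + (ρ : ℂ) • 1) * F) = Finset.univ.val.map fun i => 1 + ρ * (1 + d i) := by
  obtain ⟨T, d, hT, hTF, hTQ, hd, heigs, -⟩ :=
    exists_diagonalization_inv_sub_inv Matrix.PosDef.one hG hF
  rw [inv_one, Matrix.one_mul] at heigs
  refine ⟨d, hd, le_maxEig_of_eigs heigs, fun ρ => eigs_mul_of_diagonalization hT ?_⟩
  have h1 : Tᴴ * (1 : Matrix (Fin n) (Fin n) ℂ) * T
      = (1 : Matrix (Fin n) (Fin n) ℂ) + Matrix.diagonal fun i => (d i : ℂ) := by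
    rw [← hTQ, inv_one, Matrix.mul_sub, Matrix.sub_mul, hTF, add_sub_cancel]
  rw [Matrix.mul_add, Matrix.add_mul, hTF, Matrix.mul_smul, Matrix.smul_mul, h1,
    ← Matrix.diagonal_one, Matrix.diagonal_add, ← Matrix.diagonal_smul, Matrix.diagonal_add]
  congr 1
  ext i
  simp

theorem isHermitian_inv_add_smul_one {n : ℕ} {F : Matrix (Fin n) (Fin n) ℂ} (hF : F.PosDef)
    (ρ : ℝ) : (F⁻¹ + (ρ : ℂ) • 1).IsHermitian := by
  refine hF.inv.isHermitian.add ?_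
  rw [Matrix.IsHermitian, Matrix.conjTranspose_smul]
  simp

theorem inv_add_smul_one_mul {n : ℕ} {F : Matrix (Fin n) (Fin n) ℂ} (hF : F.PosDef) (ρ : ℂ) :
    (F⁻¹ + ρ • 1) * F = 1 + ρ • F := by
  rw [Matrix.add_mul, Matrix.nonsing_inv_mul _ ((Matrix.isUnit_iff_isUnit_det _).1 hF.isUnit),
    Matrix.smul_mul, Matrix.one_mul]

/-- The Chernoff bound for small received energy. -/
theorem IsCN.measure_energy_le_exp {n L : ℕ} {ka : ℕ}
    {A : Fin ka → Fin n → ℂ} {ν : Measure (Fin n → Fin L → ℂ)} (hν : IsCN ν (matF A))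
    (θ : ℝ) {ρ : ℝ} (hρ : 0 ≤ ρ) :
    ν {Y | trForm 1 Y ≤ n * L * θ}
      ≤ ENNReal.ofReal (Real.exp (ρ * n * L * θ - L * logDet (1 + (ρ : ℂ) • matF A))) := by
  obtain ⟨d, hd, -, heigs⟩ := exists_eigs_one_add_smul (posSemidef_gram A Finset.univ) rfl
  rw [← inv_add_smul_one_mul (posDef_matF A)]
  refine hν.measure_le_exp (posDef_matF A) (isHermitian_inv_add_smul_one (posDef_matF A) ρ) ?_ _
    fun Y hY => ?_
  · intro x hx
    rw [matF, heigs] at hx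
    obtain ⟨i, -, rfl⟩ := Multiset.mem_map.1 hx
    have := mul_nonneg hρ (add_nonneg zero_le_one (hd i))
    linarith
  · have hY : trForm 1 Y ≤ n * L * θ := hY
    have := mul_le_mul_of_nonneg_left hY hρ
    rw [trForm_add, trForm_smul]
    linarith

/-- The Chernoff bound for large received energy; the range of `ρ` keeps `I - ρ F` positive
definite. -/
theorem IsCN.measure_le_energy_exp {n L : ℕ} {ka : ℕ}
    {A : Fin ka → Fin n → ℂ} {ν : Measure (Fin n → Fin L → ℂ)} (hν : IsCN ν (matF A))
    (θ : ℝ) {ρ : ℝ} (hρ : 0 ≤ ρ) (hρ1 : ρ < 1 / (1 + maxEig (gram A Finset.univ))) :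
    ν {Y | n * L * θ ≤ trForm 1 Y}
      ≤ ENNReal.ofReal (Real.exp (-(ρ * n * L * θ) - L * logDet (1 - (ρ : ℂ) • matF A))) := by
  obtain ⟨d, hd, hmax, heigs⟩ := exists_eigs_one_add_smul (posSemidef_gram A Finset.univ) rfl
  have h1 : 1 - (ρ : ℂ) • matF A = ((matF A)⁻¹ + ((-ρ : ℝ) : ℂ) • 1) * matF A := by
    rw [inv_add_smul_one_mul (posDef_matF A), Complex.ofReal_neg, neg_smul, sub_eq_add_neg]
  rw [h1]
  refine hν.measure_le_exp (posDef_matF A) (isHermitian_inv_add_smul_one (posDef_matF A) (-ρ)) ?_ _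
    fun Y hY => ?_
  · intro x hx
    rw [matF, heigs] at hx
    obtain ⟨i, -, rfl⟩ := Multiset.mem_map.1 hx
    have h0 : 0 < 1 + maxEig (gram A Finset.univ) := by
      linarith [maxEig_nonneg (gram A Finset.univ)]
    have h2 := (lt_div_iff₀ h0).1 hρ1
    have h3 := mul_le_mul_of_nonneg_left (add_le_add_right (hmax i) 1) hρ
    linarith
  · have hY : n * L * θ ≤ trForm 1 Y := hY
    have := mul_le_mul_of_nonneg_left hY hρ
    rw [trForm_add, trForm_smul]
    linarith

/-! ### Measurability of the decoding metric -/

theorem measurable_det {X : Type*} [MeasurableSpace X] {n : ℕ}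
    {F : X → Matrix (Fin n) (Fin n) ℂ} (hF : ∀ i j, Measurable fun x => F x i j) :
    Measurable fun x => (F x).det := by
  simp only [Matrix.det_apply]
  refine Finset.measurable_sum _ fun σ _ => Measurable.const_smul ?_ _
  exact Finset.measurable_prod _ fun i _ => hF _ _

theorem measurable_inv_apply {X : Type*} [MeasurableSpace X] {n : ℕ}
    {F : X → Matrix (Fin n) (Fin n) ℂ} (hF : ∀ i j, Measurable fun x => F x i j) (i j : Fin n) :
    Measurable fun x => (F x)⁻¹ i j := by
  simp only [Matrix.inv_def, Matrix.smul_apply, Matrix.adjugate_apply, smul_eq_mul,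
    Ring.inverse_eq_inv']
  refine (measurable_det hF).inv.mul (measurable_det fun a b => ?_)
  simp only [Matrix.updateRow_apply]
  split_ifs
  · exact measurable_const
  · exact hF a b

theorem measurable_metric {X : Type*} [MeasurableSpace X] {n L : ℕ}
    {F : X → Matrix (Fin n) (Fin n) ℂ} (hF : ∀ i j, Measurable fun x => F x i j)
    {Y : X → Fin n → Fin L → ℂ} (hY : Measurable Y) (b : ℝ) :
    Measurable fun x => metric (F x) b (Y x) := by
  have h1 : Measurable fun x => logDet (F x) :=
    Real.measurable_log.comp (Complex.measurable_re.comp (measurable_det hF))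
  have h2 : Measurable fun x => trForm (F x)⁻¹ (Y x) := by
    simp only [trForm, Matrix.trace, Matrix.diag, Matrix.mul_apply, Matrix.conjTranspose_apply,
      Matrix.of_apply]
    refine Complex.measurable_re.comp (Finset.measurable_sum _ fun i _ =>
      Finset.measurable_sum _ fun j _ => (measurable_inv_apply hF i j).mul ?_)
    have hYe : ∀ i l, Measurable fun x => Y x i l := fun i l => by fun_prop
    exact Finset.measurable_sum _ fun l _ => (hYe _ _).mul (Complex.continuous_conj.measurable.comp
      (hYe _ _))
  unfold metric
  fun_prop

theorem measurable_gram_apply {X : Type*} [MeasurableSpace X] {n q : ℕ}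
    {A : X → Fin q → Fin n → ℂ} (hA : Measurable A) (T : Finset (Fin q)) (i j : Fin n) :
    Measurable fun x => gram (A x) T i j := by
  simp only [gram, Matrix.sum_apply, Matrix.vecMulVec_apply, Pi.star_apply]
  have hAe : ∀ k i, Measurable fun x => A x k i := fun k i => by fun_prop
  exact Finset.measurable_sum _ fun k _ => (hAe _ _).mul
    (Complex.continuous_conj.measurable.comp (hAe _ _))

/-! ### Reduction to the codewords that matter -/

/-- The law of fading and noise. -/
abbrev channelLaw (S : Model) : Measure (S.Fading × S.Signal) :=
  (gaussianArray S.K S.L 1).prod (gaussianArray S.n S.L 1)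

/-- The joint law of the Gaussian codebooks, the fading and the noise. -/
abbrev jointLaw (S : Model) (P' : ℝ) : Measure (S.Codebook × (S.Fading × S.Signal)) :=
  (codebookLaw S P').prod (channelLaw S)

/-- The received signal when the users `e j` send the codewords `A j`. -/
def signalOf {S : Model} {ka : ℕ} (e : Fin ka → Fin S.K) (A : Fin ka → Fin S.n → ℂ)
    (hz : S.Fading × S.Signal) : S.Signal :=
  fun i l => ∑ j, hz.1 (e j) l * A j i + hz.2 i l

theorem measurable_signalOf {S : Model} {X : Type*} [MeasurableSpace X] {ka : ℕ}
    (e : Fin ka → Fin S.K) {A : X → Fin ka → Fin S.n → ℂ} (hA : Measurable A)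
    {h : X → S.Fading × S.Signal} (hh : Measurable h) :
    Measurable fun x => signalOf e (A x) (h x) := by
  unfold signalOf
  refine measurable_pi_lambda _ fun i => measurable_pi_lambda _ fun l => ?_
  have h1 : ∀ j, Measurable fun x => (h x).1 (e j) l := fun j => by fun_prop
  have h2 : ∀ j, Measurable fun x => A x j i := fun j => by fun_prop
  have h3 : Measurable fun x => (h x).2 i l := by fun_prop
  exact (Finset.measurable_sum _ fun j _ => (h1 j).mul (h2 j)).add h3

/-- An event that depends on the codebooks only through `Φ` has probability at most the average of
any bound on its conditional probability given `Φ`. -/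
theorem jointLaw_le_lintegral {S : Model} {P' : ℝ} {X : Type*} [MeasurableSpace X] {μ : Measure X}
    {Φ : S.Codebook → X} (hΦ : MeasurePreserving Φ (codebookLaw S P') μ) {ka : ℕ}
    {A : X → Fin ka → Fin S.n → ℂ} (hA : Measurable A) {e : Fin ka → Fin S.K}
    (he : Function.Injective e) {E : Set (X × S.Signal)} (hE : MeasurableSet E) {g : X → ℝ≥0∞}
    (hg : ∀ᵐ x ∂μ, ∀ ν, IsCN ν (matF (A x)) → ν {Y | (x, Y) ∈ E} ≤ g x)
    {D : Set (S.Codebook × (S.Fading × S.Signal))}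
    (hD : ∀ c hz, (c, hz) ∈ D → (Φ c, signalOf e (A (Φ c)) hz) ∈ E) :
    jointLaw S P' D ≤ ∫⁻ x, g x ∂μ := by
  have : IsProbabilityMeasure μ := by
    rw [← hΦ.map_eq]; exact Measure.isProbabilityMeasure_map hΦ.measurable.aemeasurable
  let f : X × (S.Fading × S.Signal) → X × S.Signal := fun p => (p.1, signalOf e (A p.1) p.2)
  have hf : Measurable f :=
    measurable_fst.prodMk (measurable_signalOf e (hA.comp measurable_fst) measurable_snd)
  have hE' : MeasurableSet (f ⁻¹' E) := hf hE
  have hmp := hΦ.prod (MeasurePreserving.id (channelLaw S))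
  calc jointLaw S P' D ≤ jointLaw S P' (Prod.map Φ id ⁻¹' (f ⁻¹' E)) :=
        measure_mono fun p hp => hD p.1 p.2 hp
    _ = (μ.prod (channelLaw S)) (f ⁻¹' E) := hmp.measure_preimage hE'.nullMeasurableSet
    _ = ∫⁻ x, channelLaw S (Prod.mk x ⁻¹' (f ⁻¹' E)) ∂μ := Measure.prod_apply hE'
    _ ≤ ∫⁻ x, g x ∂μ := by
        refine lintegral_mono_ae ?_
        filter_upwards [hg] with x hx
        have hs : Measurable (signalOf (S := S) e (A x)) :=
          measurable_signalOf e measurable_const measurable_id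
        have h1 : (Measure.map (signalOf e (A x)) (channelLaw S)) (Prod.mk x ⁻¹' E) ≤ g x :=
          hx _ (isCN_fading_add_noise (L := S.L) (A x) he)
        rw [Measure.map_apply hs (measurable_prodMk_left hE)] at h1
        exact h1

/-- Selecting codewords of distinct user-message pairs gives i.i.d. Gaussian codewords. -/
theorem measurePreserving_select {S : Model} (P' : ℝ) {ι : Type*} [Fintype ι]
    {g : ι → Fin S.K × Fin S.M} (hg : Function.Injective g) :
    MeasurePreserving (fun (c : S.Codebook) (i : ι) => c (g i).1 (g i).2) (codebookLaw S P')
      (Measure.pi fun _ => Measure.pi fun _ => complexGaussian P') :=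
  (measurePreserving_comp_injective (Measure.pi fun _ : Fin S.n => complexGaussian P') hg).comp
    (measurePreserving_uncurry (α := Fin S.K) (β := Fin S.M)
      (Measure.pi fun _ : Fin S.n => complexGaussian P'))

theorem measurePreserving_select_pair {S : Model} (P' : ℝ) {p q : ℕ}
    {g : Fin p → Fin S.K × Fin S.M} {g' : Fin q → Fin S.K × Fin S.M}
    (hg : Function.Injective (Sum.elim g g')) :
    MeasurePreserving (fun c : S.Codebook =>
        ((fun j => c (g j).1 (g j).2), (fun j => c (g' j).1 (g' j).2))) (codebookLaw S P')
      ((gaussianArray p S.n P').prod (gaussianArray q S.n P')) :=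
  (measurePreserving_sumPiEquivProdPi (X := fun _ : Fin p ⊕ Fin q => Fin S.n → ℂ)
    fun _ => Measure.pi fun _ : Fin S.n => complexGaussian P').comp
    (measurePreserving_select P' hg)

/-- A finite set can be enumerated so that a given subset comes first. -/
theorem exists_enumeration {α : Type*} [DecidableEq α] {P Q : Finset α} (hPQ : P ⊆ Q) {q : ℕ}
    (hq : Q.card = q) :
    ∃ e : Fin q → α, Function.Injective e ∧ (∀ k, k ∈ Q ↔ ∃ j, e j = k) ∧
      ∀ j, e j ∈ P ↔ j.val < P.card := by
  have hcard : P.card + (Q \ P).card = q := by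
    rw [Finset.card_sdiff_of_subset hPQ, ← hq]
    have := Finset.card_le_card hPQ
    omega
  subst hcard
  refine ⟨Fin.addCases (fun j => (P.equivFin.symm j : α)) fun j => ((Q \ P).equivFin.symm j : α),
    ?_, ?_, ?_⟩
  · intro i j
    refine Fin.addCases (fun i => ?_) (fun i => ?_) i <;>
      refine Fin.addCases (fun j => ?_) (fun j => ?_) j <;>
      simp only [Fin.addCases_left, Fin.addCases_right] <;> intro h
    · rw [P.equivFin.symm.injective (Subtype.ext h)]
    · have h1 := (P.equivFin.symm i).2
      rw [h] at h1
      exact absurd h1 (Finset.mem_sdiff.1 ((Q \ P).equivFin.symm j).2).2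
    · have h1 := (P.equivFin.symm j).2
      rw [← h] at h1
      exact absurd h1 (Finset.mem_sdiff.1 ((Q \ P).equivFin.symm i).2).2
    · rw [(Q \ P).equivFin.symm.injective (Subtype.ext h)]
  · intro k
    constructor
    · intro hk
      by_cases hP : k ∈ P
      · exact ⟨Fin.castAdd _ (P.equivFin ⟨k, hP⟩), by simp⟩
      · exact ⟨Fin.natAdd _ ((Q \ P).equivFin ⟨k, Finset.mem_sdiff.2 ⟨hk, hP⟩⟩), by simp⟩
    · rintro ⟨j, rfl⟩
      refine Fin.addCases (fun j => ?_) (fun j => ?_) j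
      · simp only [Fin.addCases_left]
        exact hPQ (P.equivFin.symm j).2
      · simp only [Fin.addCases_right]
        exact (Finset.mem_sdiff.1 ((Q \ P).equivFin.symm j).2).1
  · intro j
    refine Fin.addCases (fun j => ?_) (fun j => ?_) j
    · simp only [Fin.addCases_left, Fin.val_castAdd, j.2, iff_true]
      exact (P.equivFin.symm j).2
    · simp only [Fin.addCases_right, Fin.val_natAdd]
      refine ⟨fun h => absurd h (Finset.mem_sdiff.1 ((Q \ P).equivFin.symm j).2).2, fun h => ?_⟩
      omega

theorem mem_activeSet {S : Model} {W : S.Messages} {k : Fin S.K} :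
    k ∈ activeSet W ↔ W k ≠ none := by
  simp [activeSet]

/-- An enumeration of a set of users active in `W`, together with their messages, in which a given
subset comes first. -/
theorem exists_user_enumeration {S : Model} {W : S.Messages} {P Q : Finset (Fin S.K)}
    (hPQ : P ⊆ Q) (hQ : Q ⊆ activeSet W) {q : ℕ} (hq : Q.card = q) :
    ∃ (e : Fin q → Fin S.K) (w : Fin q → Fin S.M), Function.Injective e ∧
      (∀ k, k ∈ Q ↔ ∃ j, e j = k) ∧ (∀ j, e j ∈ P ↔ j.val < P.card) ∧
      ∀ j, W (e j) = some (w j) := by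
  obtain ⟨e, he, h1, h2⟩ := exists_enumeration hPQ hq
  have h3 : ∀ j, ∃ w, W (e j) = some w := fun j =>
    Option.ne_none_iff_exists'.1 (mem_activeSet.1 (hQ ((h1 _).2 ⟨j, rfl⟩)))
  choose w hw using h3
  exact ⟨e, w, he, h1, h2, hw⟩

/-- A sum over a set of users, written through an enumeration. -/
theorem sum_eq_sum_filter_enumeration {K q : ℕ} {β : Type*} [AddCommMonoid β] {e : Fin q → Fin K}
    (he : Function.Injective e) (T : Finset (Fin K)) (p : Fin q → Prop) [DecidablePred p]
    (hT : ∀ k, k ∈ T ↔ ∃ j, p j ∧ e j = k) (f : Fin K → β) :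
    ∑ k ∈ T, f k = ∑ j ∈ Finset.univ.filter p, f (e j) := by
  have : T = (Finset.univ.filter p).image e := by
    ext k
    simp [hT]
  rw [this, Finset.sum_image fun a _ b _ h => he h]

/-- The received signal, in terms of an enumeration of the active users and their messages. -/
theorem received_eq_signalOf {S : Model} {W : S.Messages} {ka : ℕ} {e : Fin ka → Fin S.K}
    {w : Fin ka → Fin S.M} (he : Function.Injective e)
    (hW : ∀ k, k ∈ activeSet W ↔ ∃ j, e j = k) (hw : ∀ j, W (e j) = some (w j)) (c : S.Codebook)
    (hz : S.Fading × S.Signal) :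
    received c W hz.1 hz.2 = signalOf e (fun j => c (e j) (w j)) hz := by
  ext i l
  rw [received, signalOf]
  congr 1
  rw [← Finset.sum_subset (Finset.subset_univ (activeSet W)) fun k _ hk => by
    have : W k = none := by simpa [mem_activeSet] using hk
    simp [this]]
  rw [sum_eq_sum_filter_enumeration he (activeSet W) (fun _ => True) (by simpa using hW)]
  simp [hw]

/-- The covariance matrix of the codewords of the users in `T`, with messages `W`. -/
def covOn {S : Model} (c : S.Codebook) (W : S.Messages) (T : Finset (Fin S.K)) :
    Matrix (Fin S.n) (Fin S.n) ℂ :=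
  ∑ k ∈ T, (W k).elim 0 fun m => Matrix.vecMulVec (c k m) (star (c k m))

theorem covOn_eq_gram {S : Model} {W : S.Messages} {q : ℕ} {e : Fin q → Fin S.K}
    {w : Fin q → Fin S.M} (he : Function.Injective e) (hw : ∀ j, W (e j) = some (w j))
    (c : S.Codebook) (T : Finset (Fin S.K)) (p : Fin q → Prop) [DecidablePred p]
    (hT : ∀ k, k ∈ T ↔ ∃ j, p j ∧ e j = k) :
    covOn c W T = gram (fun j => c (e j) (w j)) (Finset.univ.filter p) := by
  rw [covOn, sum_eq_sum_filter_enumeration he T p hT, gram]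
  simp [hw]

/-- The covariance of a list that agrees with `W` on `T`, with `V` on `T'`, and detects nobody
else. -/
theorem candidateCov_eq_covOn_add {S : Model} (c : S.Codebook) (U W V : S.Messages)
    (T T' : Finset (Fin S.K)) (hdisj : Disjoint T T') (hT : ∀ k ∈ T, U k = W k)
    (hT' : ∀ k ∈ T', U k = V k) (hnone : ∀ k, k ∉ T → k ∉ T' → U k = none) :
    candidateCov c U = 1 + covOn c W T + covOn c V T' := by
  rw [candidateCov, add_assoc]
  congr 1
  have h1 : covOn c W T = covOn c U T := Finset.sum_congr rfl fun k hk => by rw [hT k hk]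
  have h2 : covOn c V T' = covOn c U T' := Finset.sum_congr rfl fun k hk => by rw [hT' k hk]
  rw [h1, h2, covOn, covOn, ← Finset.sum_union hdisj]
  refine (Finset.sum_subset (Finset.subset_univ _) fun k _ hk => ?_).symm
  rw [Finset.mem_union, not_or] at hk
  rw [hnone k hk.1 hk.2]
  rfl

theorem mapMetric_eq_metric {S : Model} (c : S.Codebook) (Y : S.Signal) (V : S.Messages) :
    mapMetric c Y V = metric (candidateCov c V) (logWeight S (activeSet V).card) Y :=
  rfl

/-! ### The estimate of the number of active users -/

theorem le_add_div_two_of_abs_sub_le {x a b : ℝ} (hab : a < b) (h : |x - a| ≤ |x - b|) :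
    x ≤ (a + b) / 2 := by
  by_contra! hx
  rw [abs_of_pos (by linarith : 0 < x - a)] at h
  rcases abs_cases (x - b) with h' | h' <;> linarith

theorem add_div_two_le_of_abs_sub_le {x a b : ℝ} (hab : b < a) (h : |x - a| ≤ |x - b|) :
    (a + b) / 2 ≤ x := by
  by_contra! hx
  rw [abs_of_neg (by linarith : x - a < 0)] at h
  rcases abs_cases (x - b) with h' | h' <;> linarith

/-- The estimator outputs `k'` only if the received energy is on the side of `k'` of the midpoint
between the expected energies for `k'` and any other `kt`. -/
theorem energy_of_est_eq {S : Model} (hn : 1 ≤ S.n) (hL : 1 ≤ S.L) {P' : ℝ} (hP' : 0 < P')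
    {r' : ℕ} (φ : EnergyMAPReceiver S P' r') {Y : S.Signal} {k' kt : ℕ} (h : φ.est Y = k')
    (hkt : kt ≤ S.K) :
    (k' < kt → trForm 1 Y ≤ S.n * S.L * threshold P' k' kt) ∧
      (kt < k' → S.n * S.L * threshold P' k' kt ≤ trForm 1 Y) := by
  have h1 := φ.est_min Y kt hkt
  rw [h, energyMetric, energyMetric, ← trForm_one] at h1
  have hn0 : (0 : ℝ) < S.n := by exact_mod_cast hn
  have hL0 : (0 : ℝ) < S.L := by exact_mod_cast hL
  have h2 : S.n * S.L * threshold P' k' kt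
      = (S.n * S.L * (1 + k' * P') + S.n * S.L * (1 + kt * P')) / 2 := by
    rw [threshold]; ring
  rw [h2]
  refine ⟨fun hlt => le_add_div_two_of_abs_sub_le ?_ h1,
    fun hlt => add_div_two_le_of_abs_sub_le ?_ h1⟩ <;>
  · have : (k' : ℝ) < kt ∨ (kt : ℝ) < k' := by exact_mod_cast lt_or_gt_of_ne (by omega)
    have h3 : _ := (Nat.cast_lt (α := ℝ)).2 hlt
    gcongr

theorem lintegral_add_const_of_isProbabilityMeasure {X : Type*} [MeasurableSpace X]
    (μ : Measure X) [IsProbabilityMeasure μ] (f : X → ℝ≥0∞) (a : ℝ≥0∞) :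
    ∫⁻ x, (f x + a) ∂μ = ∫⁻ x, f x ∂μ + a := by
  rw [lintegral_add_right _ measurable_const, lintegral_const, measure_univ, mul_one]

/-- Each competitor `kt` of `k'` gives a bound on the probability that `k'` is the estimate. -/
theorem jointLaw_est_eq_le {S : Model} (hn : 1 ≤ S.n) (hL : 1 ≤ S.L) {P' : ℝ} (hP' : 0 < P')
    {r' : ℕ} (φ : EnergyMAPReceiver S P' r') {W : S.Messages} {ka : ℕ}
    (hka : (activeSet W).card = ka) (k' : ℕ) :
    jointLaw S P' {p | φ.est (received p.1 W p.2.1 p.2.2) = k'} ≤ pEst S P' ka k' := by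
  obtain ⟨e, w, he, hmem, -, hw⟩ := exists_user_enumeration (Finset.empty_subset _)
    (Finset.Subset.refl (activeSet W)) hka
  have hinj : Function.Injective fun j => (e j, w j) := fun i j h => he (congrArg Prod.fst h)
  have hΦ : MeasurePreserving (fun (c : S.Codebook) j => c (e j) (w j)) (codebookLaw S P')
      (gaussianArray ka S.n P') := measurePreserving_select P' hinj
  have hrank : ∀ᵐ A ∂(gaussianArray ka S.n P'), (gram A Finset.univ).rank = min S.n ka := by
    filter_upwards [ae_rank_gram_gaussianArray (n := S.n) hP' (le_refl ka)] with A hA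
    rwa [Finset.filter_true_of_mem fun j _ => j.2] at hA
  have hmeas : Measurable fun x : (Fin ka → Fin S.n → ℂ) × S.Signal => trForm 1 x.2 :=
    (continuous_trForm 1).measurable.comp measurable_snd
  refine le_iInf fun kt => le_iInf fun ⟨hkt, hne⟩ => ?_
  split_ifs with hlt
  · have key : ∀ g : (Fin ka → Fin S.n → ℂ) → ℝ≥0∞,
        (∀ᵐ A ∂(gaussianArray ka S.n P'), ∀ ν, IsCN ν (matF A) →
          ν {Y : S.Signal | trForm 1 Y ≤ S.n * S.L * threshold P' k' kt} ≤ g A) →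
        jointLaw S P' {p | φ.est (received p.1 W p.2.1 p.2.2) = k'}
          ≤ ∫⁻ A, g A ∂(gaussianArray ka S.n P') := fun g hg =>
      jointLaw_le_lintegral hΦ measurable_id he (measurableSet_le hmeas measurable_const) hg
        fun c hz h => by
          rw [id_eq, ← received_eq_signalOf he hmem hw c hz]
          exact (energy_of_est_eq hn hL hP' φ h hkt).1 hlt
    refine le_min (le_iInf fun η => le_iInf fun _ => ?_) ?_
    · rw [← lintegral_add_const_of_isProbabilityMeasure]
      refine key _ ?_
      filter_upwards [hrank] with A hA ν hν
      exact hν.measure_energy_le hn hL hA _ η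
    · exact key _ (Filter.Eventually.of_forall fun A ν hν =>
        le_iInf fun ρ => le_iInf fun hρ => hν.measure_energy_le_exp _ hρ)
  · have hlt' : kt < k' := by omega
    have key : ∀ g : (Fin ka → Fin S.n → ℂ) → ℝ≥0∞,
        (∀ᵐ A ∂(gaussianArray ka S.n P'), ∀ ν, IsCN ν (matF A) →
          ν {Y : S.Signal | S.n * S.L * threshold P' k' kt ≤ trForm 1 Y} ≤ g A) →
        jointLaw S P' {p | φ.est (received p.1 W p.2.1 p.2.2) = k'}
          ≤ ∫⁻ A, g A ∂(gaussianArray ka S.n P') := fun g hg =>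
      jointLaw_le_lintegral hΦ measurable_id he (measurableSet_le measurable_const hmeas) hg
        fun c hz h => by
          rw [id_eq, ← received_eq_signalOf he hmem hw c hz]
          exact (energy_of_est_eq hn hL hP' φ h hkt).2 hlt'
    refine le_min (le_iInf fun η => le_iInf fun _ => ?_) ?_
    · rw [← lintegral_add_const_of_isProbabilityMeasure]
      refine key _ ?_
      filter_upwards [hrank] with A hA ν hν
      exact hν.measure_le_energy hn hL hA _ η
    · exact key _ (Filter.Eventually.of_forall fun A ν hν =>
        le_iInf fun ρ => le_iInf fun hρ => hν.measure_le_energy_exp _ hρ.1 hρ.2)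

/-! ### The decoding errors -/

/-- The transmitted list `W` is good for the set `T` of users: its metric is at most `ω` times the
metric of the list without the users in `T`, plus `nL ν₀`.  Here `b` and `b1` are the log-weights of
the two lists. -/
def IsGood {S : Model} (W : S.Messages) (T : Finset (Fin S.K)) (b b1 ω ν₀ : ℝ) (c : S.Codebook)
    (Y : S.Signal) : Prop :=
  metric (1 + covOn c W (activeSet W)) b Y
    ≤ ω * metric (1 + covOn c W (activeSet W \ T)) b1 Y + S.n * S.L * ν₀

/-- One bound `β` serves all sets `T` of the given size; multiplied by the number of these sets it is
at most `q₂`, or `q₂₀` if the sets are empty. -/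
theorem jointLaw_not_isGood_le {S : Model} (hn : 1 ≤ S.n) (hL : 1 ≤ S.L) {P' : ℝ} (hP' : 0 < P')
    (r' ka k' t : ℕ) {ω ν₀ : ℝ} (hω : 0 ≤ ω) (hω1 : ω ≤ 1) (hν₀ : 0 ≤ ν₀) :
    ∃ β : ℝ≥0∞,
      ((ka.choose (missCount S r' ka k' t) : ℝ≥0∞) * β
        ≤ if 0 < missCount S r' ka k' t then q2 S P' r' ka k' t ω ν₀ else q20 S P' ka ω ν₀) ∧
      ∀ (W : S.Messages) (T : Finset (Fin S.K)), (activeSet W).card = ka → T ⊆ activeSet W →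
        T.card = missCount S r' ka k' t →
        jointLaw S P' {p | ¬ IsGood W T (bConst S ka) (b1Const S r' ka k' t) ω ν₀ p.1
          (received p.1 W p.2.1 p.2.2)} ≤ β := by
  have key : ∀ (W : S.Messages) (T : Finset (Fin S.K)), (activeSet W).card = ka →
      T ⊆ activeSet W → T.card = missCount S r' ka k' t → ∀ g : (Fin ka → Fin S.n → ℂ) → ℝ≥0∞,
        (∀ᵐ A ∂(gaussianArray ka S.n P'), ∀ ν, IsCN ν (matF A) →
          ν {Y : S.Signal | ω * metric (matF1 A (missCount S r' ka k' t)) (b1Const S r' ka k' t) Y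
          + S.n * S.L * ν₀ < metric (matF A) (bConst S ka) Y} ≤ g A) →
        jointLaw S P' {p | ¬ IsGood W T (bConst S ka) (b1Const S r' ka k' t) ω ν₀ p.1
          (received p.1 W p.2.1 p.2.2)} ≤ ∫⁻ A, g A ∂(gaussianArray ka S.n P') := by
    intro W T hka hT hTs g hg
    obtain ⟨e, w, he, hmem, hfirst, hw⟩ := exists_user_enumeration hT
      (Finset.Subset.refl (activeSet W)) hka
    have hinj : Function.Injective fun j => (e j, w j) := fun i j h => he (congrArg Prod.fst h)
    have hΦ : MeasurePreserving (fun (c : S.Codebook) j => c (e j) (w j)) (codebookLaw S P')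
        (gaussianArray ka S.n P') := measurePreserving_select P' hinj
    have hF : ∀ (U : Finset (Fin ka)) (i j : Fin S.n),
        Measurable fun x : (Fin ka → Fin S.n → ℂ) × S.Signal => (1 + gram x.1 U) i j :=
      fun U i j => measurable_const.add (measurable_gram_apply measurable_fst U i j)
    refine jointLaw_le_lintegral hΦ measurable_id he (measurableSet_lt
      (((measurable_metric (hF _) measurable_snd _).const_mul ω).add_const _)
      (measurable_metric (hF _) measurable_snd _)) hg fun c hz h => ?_
    rw [id_eq, ← received_eq_signalOf he hmem hw c hz]
    simp only [Set.mem_ofPred_eq, IsGood, not_le] at h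
    rw [covOn_eq_gram he hw c (activeSet W) (fun _ => True) (by simpa using hmem),
      Finset.filter_true, covOn_eq_gram he hw c (activeSet W \ T)
        (fun j => missCount S r' ka k' t ≤ j.val) ?_] at h
    · exact h
    · intro k
      rw [Finset.mem_sdiff, hmem, ← hTs]
      constructor
      · rintro ⟨⟨j, rfl⟩, hj⟩
        exact ⟨j, by rwa [hfirst, not_lt] at hj, rfl⟩
      · rintro ⟨j, hj, rfl⟩
        exact ⟨⟨j, rfl⟩, by rwa [hfirst, not_lt]⟩
  split_ifs with hs
  · refine ⟨_, le_rfl, fun W T hka hT hTs => le_iInf fun δ => le_iInf fun _ => ?_⟩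
    have hrank := ae_rank_gram_gaussianArray (n := S.n) hP'
      (show missCount S r' ka k' t ≤ ka by rw [← hTs, ← hka]; exact Finset.card_le_card hT)
    rw [add_comm, ← lintegral_add_const_of_isProbabilityMeasure]
    refine key W T hka hT hTs _ ?_
    filter_upwards [hrank] with A hA ν hν
    rw [add_comm]
    exact hν.measure_not_good_le S hn hL hs hA hω hω1 ν₀ δ
  · have hs0 : missCount S r' ka k' t = 0 := by omega
    have hb : b1Const S r' ka k' t = bConst S ka := by simp [b1Const, bConst, hs0]
    refine ⟨q20 S P' ka ω ν₀, by simp [hs0], fun W T hka hT hTs => ?_⟩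
    rw [q20]
    split_ifs with h1
    · refine (key W T hka hT hTs (fun _ => 0) (Filter.Eventually.of_forall fun A ν hν => ?_)).trans
        (by simp)
      rw [hs0, matF1_zero, hb, h1]
      have : {Y : S.Signal | 1 * metric (matF A) (bConst S ka) Y + S.n * S.L * ν₀
          < metric (matF A) (bConst S ka) Y} = ∅ := by
        ext Y
        have : 0 ≤ (S.n : ℝ) * S.L * ν₀ := by positivity
        simp only [Set.mem_ofPred_eq, Set.mem_empty_iff_false, iff_false, not_lt]
        linarith
      rw [this, measure_empty]
    · refine key W T hka hT hTs _ (Filter.Eventually.of_forall fun A ν hν => ?_)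
      rw [hs0, matF1_zero, hb]
      exact hν.measure_not_good_zero_le S hn hL (lt_of_le_of_ne hω1 h1) ν₀

/-! ### Patterns of decoding errors -/

/-- The misdetected users. -/
def missSet {S : Model} (W V : S.Messages) : Finset (Fin S.K) :=
  (activeSet W).filter fun k => W k ≠ V k

/-- The users with a false alarm. -/
def falseSet {S : Model} (W V : S.Messages) : Finset (Fin S.K) :=
  (activeSet V).filter fun k => V k ≠ W k

theorem mem_missSet {S : Model} {W V : S.Messages} {k : Fin S.K} :
    k ∈ missSet W V ↔ W k ≠ none ∧ W k ≠ V k := by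
  rw [missSet, Finset.mem_filter, mem_activeSet]

theorem mem_falseSet {S : Model} {W V : S.Messages} {k : Fin S.K} :
    k ∈ falseSet W V ↔ V k ≠ none ∧ V k ≠ W k := by
  rw [falseSet, Finset.mem_filter, mem_activeSet]

theorem missSet_subset {S : Model} (W V : S.Messages) : missSet W V ⊆ activeSet W :=
  Finset.filter_subset _ _

theorem falseSet_subset {S : Model} (W V : S.Messages) : falseSet W V ⊆ activeSet V :=
  Finset.filter_subset _ _

theorem card_missSet_le {S : Model} (W V : S.Messages) :
    (missSet W V).card ≤ (activeSet W).card :=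
  Finset.card_le_card (missSet_subset W V)

theorem card_falseSet_le {S : Model} (W V : S.Messages) :
    (falseSet W V).card ≤ (activeSet V).card :=
  Finset.card_le_card (falseSet_subset W V)

/-- The correctly decoded users are counted from both sides. -/
theorem card_activeSet_sub_missSet {S : Model} (W V : S.Messages) :
    (activeSet W).card - (missSet W V).card = (activeSet V).card - (falseSet W V).card := by
  have h : activeSet W \ missSet W V = activeSet V \ falseSet W V := by
    ext k
    simp only [Finset.mem_sdiff, mem_activeSet, mem_missSet, mem_falseSet, not_and, not_not]
    constructor
    · rintro ⟨h1, h2⟩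
      exact ⟨h2 h1 ▸ h1, fun _ => (h2 h1).symm⟩
    · rintro ⟨h1, h2⟩
      exact ⟨h2 h1 ▸ h1, fun _ => (h2 h1).symm⟩
  rw [← Finset.card_sdiff_of_subset (missSet_subset W V), h,
    Finset.card_sdiff_of_subset (falseSet_subset W V)]

theorem activeSet_sdiff_subset_falseSet {S : Model} (W V : S.Messages) :
    activeSet V \ activeSet W ⊆ falseSet W V := by
  intro k
  simp only [Finset.mem_sdiff, mem_activeSet, mem_falseSet, not_not]
  rintro ⟨h1, h2⟩
  exact ⟨h1, by rwa [h2]⟩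

/-- Given the sets of misdetected users and of false alarms, a decoded list is determined by the
messages of the latter. -/
theorem card_filter_missSet_falseSet_eq_le {S : Model} (W : S.Messages) (T T' : Finset (Fin S.K)) :
    (Finset.univ.filter fun V : S.Messages => missSet W V = T ∧ falseSet W V = T').card
      ≤ S.M ^ T'.card := by
  classical
  have hsub : (Finset.univ.filter fun V : S.Messages => missSet W V = T ∧ falseSet W V = T')
      ⊆ (Finset.univ : Finset (T' → Fin S.M)).image fun f k =>
        if hk : k ∈ T' then some (f ⟨k, hk⟩) else if k ∈ T then none else W k := by
    intro V hV
    obtain ⟨rfl, rfl⟩ := (Finset.mem_filter.1 hV).2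
    have h1 : ∀ k : falseSet W V, ∃ m, V k = some m := fun k =>
      Option.ne_none_iff_exists'.1 (mem_falseSet.1 k.2).1
    choose f hf using h1
    refine Finset.mem_image.2 ⟨f, Finset.mem_univ _, ?_⟩
    ext1 k
    split_ifs with h2 h3
    · exact (hf ⟨k, h2⟩).symm
    · by_contra h
      exact h2 (mem_falseSet.2 ⟨fun h' => h h'.symm, fun h' => (mem_missSet.1 h3).2 h'.symm⟩)
    · by_contra h
      rw [mem_missSet, not_and, not_not] at h3
      rw [mem_falseSet, not_and, not_not] at h2
      by_cases hW : W k = none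
      · by_cases hV' : V k = none
        · exact h (hW.trans hV'.symm)
        · exact h (h2 hV').symm
      · exact h (h3 hW)
  refine (Finset.card_le_card hsub).trans (Finset.card_image_le.trans ?_)
  simp

/-- The number of decoded lists with given numbers of misdetections and of false alarms: the users
with a false alarm are inactive or misdetected. -/
theorem card_filter_card_missSet_card_falseSet_le {S : Model} {r' ka k' t t' : ℕ} {W : S.Messages}
    (hka : (activeSet W).card = ka) :
    (Finset.univ.filter fun V : S.Messages => (missSet W V).card = missCount S r' ka k' t ∧
        (falseSet W V).card = falseCount r' ka k' t').card ≤ combCount S r' ka k' t t' := by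
  classical
  set s₁ := missCount S r' ka k' t with hs₁
  set s₂ := falseCount r' ka k' t' with hs₂
  have hsub : (Finset.univ.filter fun V : S.Messages => (missSet W V).card = s₁ ∧
        (falseSet W V).card = s₂)
      ⊆ (Finset.powersetCard s₁ (activeSet W)).biUnion fun T =>
        (Finset.powersetCard s₂ ((activeSet W)ᶜ ∪ T)).biUnion fun T' =>
          Finset.univ.filter fun V : S.Messages => missSet W V = T ∧ falseSet W V = T' := by
    intro V hV
    obtain ⟨h1, h2⟩ := (Finset.mem_filter.1 hV).2
    refine Finset.mem_biUnion.2 ⟨missSet W V,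
      Finset.mem_powersetCard.2 ⟨missSet_subset W V, h1⟩,
      Finset.mem_biUnion.2 ⟨falseSet W V, Finset.mem_powersetCard.2 ⟨fun k hk => ?_, h2⟩,
        by simp⟩⟩
    rw [Finset.mem_union, Finset.mem_compl, mem_activeSet, mem_missSet]
    by_cases hW : W k = none
    · exact Or.inl fun h => h hW
    · exact Or.inr ⟨hW, (mem_falseSet.1 hk).2.symm⟩
  have hK : ka ≤ S.K := by rw [← hka]; simpa using Finset.card_le_univ (activeSet W)
  calc _ ≤ _ := Finset.card_le_card hsub
    _ ≤ (Finset.powersetCard s₁ (activeSet W)).card *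
        ((S.K - min ka (highK S r' k') + t).choose s₂ * S.M ^ s₂) := by
        refine Finset.card_biUnion_le_card_mul _ _ _ fun T hT => ?_
        obtain ⟨hT1, hT2⟩ := Finset.mem_powersetCard.1 hT
        have hcard : ((activeSet W)ᶜ ∪ T).card = S.K - min ka (highK S r' k') + t := by
          rw [Finset.card_union_of_disjoint
            (Finset.disjoint_left.2 fun k h h' => Finset.mem_compl.1 h (hT1 h')),
            Finset.card_compl, hka, hT2, Fintype.card_fin, hs₁, missCount, missForced]
          omega
        rw [← hcard, ← Finset.card_powersetCard]
        refine Finset.card_biUnion_le_card_mul _ _ _ fun T' hT' => ?_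
        rw [← (Finset.mem_powersetCard.1 hT').2]
        exact card_filter_missSet_falseSet_eq_le W T T'
    _ = combCount S r' ka k' t t' := by
        rw [Finset.card_powersetCard, hka, combCount, mul_assoc]

/-- The bound on the probability that a given list is preferred to the transmitted list with only
the forced errors, while the transmitted list is good. -/
def confusionBound (S : Model) (P' : ℝ) (r' ka k' t t' : ℕ) (ω ν : ℝ) : ℝ≥0∞ :=
  ∫⁻ A : (Fin ka → Fin S.n → ℂ) × (Fin (falseCount r' ka k' t') → Fin S.n → ℂ),
      (let F := matF A.1
       let F1 := matF1 A.1 (missCount S r' ka k' t)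
       let F' := matF' A.1 A.2 (missCount S r' ka k' t)
       let F'' := matF'' A.1 A.2 (missForced S r' ka k') (falseForced r' ka k')
       ⨅ (u : ℝ) (r : ℝ) (_ : 0 ≤ u ∧ 0 ≤ r ∧ ∀ x ∈ eigs (matB F F1 F' F'' ω u r), 0 < x),
        ENNReal.ofReal
          (Real.exp (S.L * r * S.n * ν
              + (-(u * b''Const S r' ka k') + r * bConst S ka + u * b'Const S r' ka k' t t'
                  - r * ω * b1Const S r' ka k' t))
            * Real.exp (S.L * (u * logDet F'' - r * logDet F - u * logDet F'
                + r * ω * logDet F1 - logDet (matB F F1 F' F'' ω u r)))))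
      ∂((gaussianArray ka S.n P').prod (gaussianArray (falseCount r' ka k' t') S.n P'))

theorem q1_eq (S : Model) (P' : ℝ) (r' ka k' t t' : ℕ) (ω ν : ℝ) :
    q1 S P' r' ka k' t t' ω ν
      = (combCount S r' ka k' t t' : ℝ≥0∞) * confusionBound S P' r' ka k' t t' ω ν :=
  rfl

/-- The codewords on which the comparison of a list `V` with the transmitted list depends: those of
`W`, with the misdetected ones first, and the false alarms of `V`, with the forced ones first.  The
competitor `U` of `V` is the transmitted list with only the forced errors. -/
theorem exists_error_enumeration {S : Model} {r' : ℕ} {W V : S.Messages} {ka k' t t' : ℕ}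
    (hka : (activeSet W).card = ka)
    (hs₁ : (missSet W V).card = missCount S r' ka k' t)
    (hs₂ : (falseSet W V).card = falseCount r' ka k' t')
    (hV : (activeSet V).card ∈ Finset.Icc (lowK r' k') (highK S r' k')) :
    ∃ (e : Fin ka → Fin S.K) (w : Fin ka → Fin S.M) (e' : Fin (falseCount r' ka k' t') → Fin S.K)
      (v : Fin (falseCount r' ka k' t') → Fin S.M) (U : S.Messages),
      Function.Injective e ∧ (∀ k, k ∈ activeSet W ↔ ∃ j, e j = k) ∧ (∀ j, W (e j) = some (w j)) ∧
      (∀ j, e j ∈ missSet W V ↔ j.val < missCount S r' ka k' t) ∧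
      Function.Injective (Sum.elim (fun j => (e j, w j)) fun j => (e' j, v j)) ∧
      (activeSet V).card = detCount S r' ka k' t t' ∧
      (activeSet U).card = ka - missForced S r' ka k' + falseForced r' ka k' ∧
      (activeSet U).card ∈ Finset.Icc (lowK r' k') (highK S r' k') ∧
      (∀ c : S.Codebook, candidateCov c V
        = matF' (fun j => c (e j) (w j)) (fun j => c (e' j) (v j)) (missCount S r' ka k' t)) ∧
      ∀ c : S.Codebook, candidateCov c U
        = matF'' (fun j => c (e j) (w j)) (fun j => c (e' j) (v j)) (missForced S r' ka k')
          (falseForced r' ka k') := by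
  classical
  obtain ⟨hV1, hV2⟩ := Finset.mem_Icc.1 hV
  -- the users active in `W`, with the misdetected ones first
  obtain ⟨e, w, he, hmem, hfirst, hw⟩ := exists_user_enumeration (missSet_subset W V)
    (Finset.Subset.refl (activeSet W)) hka
  have hfirst' : ∀ j, e j ∈ missSet W V ↔ j.val < missCount S r' ka k' t := by rwa [hs₁] at hfirst
  -- the forced false alarms can be chosen among the inactive users
  obtain ⟨P₂, hP₂, hP₂c⟩ : ∃ P₂ ⊆ activeSet V \ activeSet W, P₂.card = falseForced r' ka k' := by
    refine Finset.exists_subset_card_eq ?_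
    have := Finset.le_card_sdiff (activeSet W) (activeSet V)
    rw [falseForced]
    omega
  have hP₂S : P₂ ⊆ falseSet W V := hP₂.trans (activeSet_sdiff_subset_falseSet W V)
  obtain ⟨e', v, he', hmem', hlast, hv⟩ := exists_user_enumeration hP₂S (falseSet_subset W V) hs₂
  rw [hP₂c] at hlast
  -- the forced misdetections are the first users of the enumeration
  let P₁ : Finset (Fin S.K) :=
    (Finset.univ.filter fun j : Fin ka => j.val < missForced S r' ka k').image e
  have hP₁ : ∀ j, e j ∈ P₁ ↔ j.val < missForced S r' ka k' := by
    intro j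
    simp only [P₁, Finset.mem_image, Finset.mem_filter, Finset.mem_univ, true_and]
    exact ⟨fun ⟨i, hi, hij⟩ => he hij ▸ hi, fun h => ⟨j, h, rfl⟩⟩
  have hP₁W : P₁ ⊆ activeSet W := by
    intro k hk
    obtain ⟨j, -, rfl⟩ := Finset.mem_image.1 hk
    exact (hmem _).2 ⟨j, rfl⟩
  have hP₁c : P₁.card = missForced S r' ka k' := by
    rw [Finset.card_image_of_injective _ he]
    have : missForced S r' ka k' ≤ ka := Nat.sub_le _ _
    rw [Fin.card_filter_val_lt, min_eq_right this]
  have hdisj₂ : ∀ k ∈ P₂, k ∉ activeSet W := fun k hk => (Finset.mem_sdiff.1 (hP₂ hk)).2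
  -- the competitor: the transmitted list with only the forced errors
  let U : S.Messages := fun k => if k ∈ P₁ then none else if k ∈ P₂ then V k else W k
  have hUactive : activeSet U = (activeSet W \ P₁) ∪ P₂ := by
    ext k
    simp only [mem_activeSet, Finset.mem_union, Finset.mem_sdiff, U]
    by_cases h1 : k ∈ P₁
    · have h2 : k ∉ P₂ := fun h => hdisj₂ k h (hP₁W h1)
      simp [h1, h2]
    · by_cases h2 : k ∈ P₂
      · have := mem_activeSet.1 (Finset.mem_sdiff.1 (hP₂ h2)).1
        simp [h1, h2, this]
      · simp [h1, h2]
  have hdisjU : Disjoint (activeSet W \ P₁) P₂ :=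
    Finset.disjoint_left.2 fun k h h' => hdisj₂ k h' (Finset.mem_sdiff.1 h).1
  have hUcard : (activeSet U).card = ka - missForced S r' ka k' + falseForced r' ka k' := by
    rw [hUactive, Finset.card_union_of_disjoint hdisjU, Finset.card_sdiff_of_subset hP₁W, hka,
      hP₁c, hP₂c]
  have hUsize : (activeSet U).card ∈ Finset.Icc (lowK r' k') (highK S r' k') := by
    rw [hUcard, Finset.mem_Icc, missForced, falseForced]
    omega
  have hVcard : (activeSet V).card = detCount S r' ka k' t t' := by
    have h1 := card_activeSet_sub_missSet W V
    have h2 := card_falseSet_le W V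
    rw [detCount, ← hs₁, ← hs₂, ← hka]
    omega
  have hcovV : ∀ c : S.Codebook, candidateCov c V
      = matF' (fun j => c (e j) (w j)) (fun j => c (e' j) (v j)) (missCount S r' ka k' t) := by
    intro c
    rw [candidateCov_eq_covOn_add c V W V (activeSet W \ missSet W V) (falseSet W V),
      covOn_eq_gram he hw c (activeSet W \ missSet W V)
        (fun j => missCount S r' ka k' t ≤ j.val),
      covOn_eq_gram he' hv c (falseSet W V) (fun _ => True) (by simpa using hmem'),
      Finset.filter_true]
    · rfl
    · intro k
      rw [Finset.mem_sdiff, hmem]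
      constructor
      · rintro ⟨⟨j, rfl⟩, hj⟩
        exact ⟨j, by rwa [hfirst', not_lt] at hj, rfl⟩
      · rintro ⟨j, hj, rfl⟩
        exact ⟨⟨j, rfl⟩, by rwa [hfirst', not_lt]⟩
    · refine Finset.disjoint_left.2 fun k h h' => ?_
      rw [Finset.mem_sdiff, mem_activeSet, mem_missSet] at h
      exact h.2 ⟨h.1, (mem_falseSet.1 h').2.symm⟩
    · intro k h
      rw [Finset.mem_sdiff, mem_activeSet, mem_missSet, not_and, not_not] at h
      exact (h.2 h.1).symm
    · exact fun k _ => rfl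
    · intro k h h'
      rw [Finset.mem_sdiff, mem_activeSet, mem_missSet] at h
      rw [mem_falseSet] at h'
      by_contra hk
      have hWV : V k = W k := by
        by_contra hne
        exact h' ⟨hk, hne⟩
      exact h ⟨hWV ▸ hk, fun hh => hh.2 hWV.symm⟩
  have hcovU : ∀ c : S.Codebook, candidateCov c U
      = matF'' (fun j => c (e j) (w j)) (fun j => c (e' j) (v j)) (missForced S r' ka k')
        (falseForced r' ka k') := by
    intro c
    rw [candidateCov_eq_covOn_add c U W V (activeSet W \ P₁) P₂ hdisjU,
      covOn_eq_gram he hw c (activeSet W \ P₁) (fun j => missForced S r' ka k' ≤ j.val),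
      covOn_eq_gram he' hv c P₂ (fun j => j.val < falseForced r' ka k')]
    · rfl
    · intro k
      constructor
      · intro hk
        obtain ⟨j, rfl⟩ := (hmem' k).1 (hP₂S hk)
        exact ⟨j, (hlast j).1 hk, rfl⟩
      · rintro ⟨j, hj, rfl⟩
        exact (hlast j).2 hj
    · intro k
      rw [Finset.mem_sdiff, hmem]
      constructor
      · rintro ⟨⟨j, rfl⟩, hj⟩
        exact ⟨j, by rwa [hP₁, not_lt] at hj, rfl⟩
      · rintro ⟨j, hj, rfl⟩
        exact ⟨⟨j, rfl⟩, by rwa [hP₁, not_lt]⟩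
    · intro k h
      rw [Finset.mem_sdiff] at h
      have : k ∉ P₂ := fun h' => hdisj₂ k h' h.1
      simp [U, h.2, this]
    · intro k h
      have : k ∉ P₁ := fun h' => hdisj₂ k h (hP₁W h')
      simp [U, h, this]
    · intro k h h'
      by_contra hk
      have := mem_activeSet.2 hk
      rw [hUactive, Finset.mem_union] at this
      exact this.elim h h'
  have hinj : Function.Injective (Sum.elim (fun j => (e j, w j)) fun j => (e' j, v j)) := by
    refine Function.Injective.sumElim (fun i j h => he (congrArg Prod.fst h))
      (fun i j h => he' (congrArg Prod.fst h)) fun i j h => ?_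
    obtain ⟨h1, h2⟩ := Prod.mk.inj h
    refine (mem_falseSet.1 ((hmem' (e' j)).2 ⟨j, rfl⟩)).2 ?_
    rw [hv, ← h1, hw, h2]
  exact ⟨e, w, e', v, U, he, hmem, hw, hfirst', hinj, hVcard, hUcard, hUsize, hcovV, hcovU⟩

/-- The probability that a given list is decoded although the transmitted one is good. -/
theorem jointLaw_dec_eq_le {S : Model} {P' : ℝ} {r' : ℕ} (φ : EnergyMAPReceiver S P' r')
    {W V : S.Messages} {ka k' t t' : ℕ} (hka : (activeSet W).card = ka)
    (hs₁ : (missSet W V).card = missCount S r' ka k' t)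
    (hs₂ : (falseSet W V).card = falseCount r' ka k' t')
    (hV : (activeSet V).card ∈ Finset.Icc (lowK r' k') (highK S r' k')) (ω ν₀ : ℝ) :
    jointLaw S P' {p | φ.dec p.1 (received p.1 W p.2.1 p.2.2) = V ∧
        φ.est (received p.1 W p.2.1 p.2.2) = k' ∧
        IsGood W (missSet W V) (bConst S ka) (b1Const S r' ka k' t) ω ν₀ p.1
          (received p.1 W p.2.1 p.2.2)}
      ≤ confusionBound S P' r' ka k' t t' ω ν₀ := by
  obtain ⟨e, w, e', v, U, he, hmem, hw, hfirst', hinj, hVcard, hUcard, hUsize, hcovV, hcovU⟩ :=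
    exists_error_enumeration hka hs₁ hs₂ hV
  have hΦ := measurePreserving_select_pair (S := S) P' hinj
  have hF : ∀ U : Finset (Fin ka), ∀ i j : Fin S.n, Measurable fun x : ((Fin ka → Fin S.n → ℂ) ×
      (Fin (falseCount r' ka k' t') → Fin S.n → ℂ)) × S.Signal => (1 + gram x.1.1 U) i j :=
    fun U i j => measurable_const.add
      (measurable_gram_apply (measurable_fst.comp measurable_fst) U i j)
  have hF' : ∀ U U', ∀ i j : Fin S.n, Measurable fun x : ((Fin ka → Fin S.n → ℂ) ×
      (Fin (falseCount r' ka k' t') → Fin S.n → ℂ)) × S.Signal =>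
        (1 + gram x.1.1 U + gram x.1.2 U') i j :=
    fun U U' i j => (hF U i j).add
      (measurable_gram_apply (measurable_snd.comp measurable_fst) U' i j)
  have hE : MeasurableSet {x : ((Fin ka → Fin S.n → ℂ) ×
      (Fin (falseCount r' ka k' t') → Fin S.n → ℂ)) × S.Signal |
        metric (matF' x.1.1 x.1.2 (missCount S r' ka k' t)) (b'Const S r' ka k' t t') x.2
          ≤ metric (matF'' x.1.1 x.1.2 (missForced S r' ka k') (falseForced r' ka k'))
            (b''Const S r' ka k') x.2 ∧
        metric (matF x.1.1) (bConst S ka) x.2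
          ≤ ω * metric (matF1 x.1.1 (missCount S r' ka k' t)) (b1Const S r' ka k' t) x.2
            + S.n * S.L * ν₀} :=
    (measurableSet_le (measurable_metric (hF' _ _) measurable_snd _)
      (measurable_metric (hF' _ _) measurable_snd _)).inter
    (measurableSet_le (measurable_metric (hF _) measurable_snd _)
      (((measurable_metric (hF _) measurable_snd _).const_mul ω).add_const _))
  rw [confusionBound]
  refine jointLaw_le_lintegral hΦ measurable_fst he hE (Filter.Eventually.of_forall fun A ν hν => ?_)
    fun c hz h => ?_
  · have h0 := hν.measure_confusion_le (posDef_matF A.1) (posDef_matF1 A.1 (missCount S r' ka k' t))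
      (posDef_matF' A.1 A.2 (missCount S r' ka k' t))
      (posDef_matF'' A.1 A.2 (missForced S r' ka k') (falseForced r' ka k')) (bConst S ka)
      (b1Const S r' ka k' t) (b'Const S r' ka k' t t') (b''Const S r' ka k') ω ν₀
    exact h0
  obtain ⟨hdec, hest, hgood⟩ := h
  rw [← received_eq_signalOf he hmem hw c hz]
  refine ⟨?_, ?_⟩
  · have h1 := φ.dec_min c (received c W hz.1 hz.2) U (by rw [hest]; exact hUsize)
    rw [hdec, mapMetric_eq_metric, mapMetric_eq_metric, hcovV, hcovU, hUcard, hVcard] at h1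
    exact h1
  · rw [IsGood, covOn_eq_gram he hw c (activeSet W) (fun _ => True) (by simpa using hmem),
      Finset.filter_true, covOn_eq_gram he hw c (activeSet W \ missSet W V)
        (fun j => missCount S r' ka k' t ≤ j.val) ?_] at hgood
    · exact hgood
    · intro k
      rw [Finset.mem_sdiff, hmem]
      constructor
      · rintro ⟨⟨j, rfl⟩, hj⟩
        exact ⟨j, by rwa [hfirst', not_lt] at hj, rfl⟩
      · rintro ⟨j, hj, rfl⟩
        exact ⟨⟨j, rfl⟩, by rwa [hfirst', not_lt]⟩

/-- The union bound over the sets of misdetected users and over the lists with the given numbers of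
errors. -/
theorem jointLaw_card_errors_le {S : Model} (hn : 1 ≤ S.n) (hL : 1 ≤ S.L) {P' : ℝ} (hP' : 0 < P')
    {r' : ℕ} (φ : EnergyMAPReceiver S P' r') {W : S.Messages} {ka : ℕ}
    (hka : (activeSet W).card = ka) (k' t t' : ℕ) :
    jointLaw S P' {p | φ.est (received p.1 W p.2.1 p.2.2) = k' ∧
        (missSet W (φ.dec p.1 (received p.1 W p.2.1 p.2.2))).card = missCount S r' ka k' t ∧
        (falseSet W (φ.dec p.1 (received p.1 W p.2.1 p.2.2))).card = falseCount r' ka k' t'}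
      ≤ pErr S P' r' ka k' t t' := by
  refine le_iInf fun ω => le_iInf fun ν₀ => le_iInf fun ⟨hω, hω1, hν₀⟩ => ?_
  obtain ⟨β, hβ, hgood⟩ := jointLaw_not_isGood_le hn hL hP' r' ka k' t hω hω1 hν₀
  let C : Finset S.Messages := Finset.univ.filter fun V =>
    (missSet W V).card = missCount S r' ka k' t ∧ (falseSet W V).card = falseCount r' ka k' t'
  let C' : Finset S.Messages := C.filter fun V =>
    (activeSet V).card ∈ Finset.Icc (lowK r' k') (highK S r' k')
  let D : S.Messages → Set (S.Codebook × (S.Fading × S.Signal)) := fun V =>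
    {p | φ.dec p.1 (received p.1 W p.2.1 p.2.2) = V ∧
        φ.est (received p.1 W p.2.1 p.2.2) = k' ∧
        IsGood W (missSet W V) (bConst S ka) (b1Const S r' ka k' t) ω ν₀ p.1
          (received p.1 W p.2.1 p.2.2)}
  let N : Finset (Fin S.K) → Set (S.Codebook × (S.Fading × S.Signal)) := fun T =>
    {p | ¬ IsGood W T (bConst S ka) (b1Const S r' ka k' t) ω ν₀ p.1
          (received p.1 W p.2.1 p.2.2)}
  let Ts := Finset.powersetCard (missCount S r' ka k' t) (activeSet W)
  have hC' : C'.card ≤ combCount S r' ka k' t t' :=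
    (Finset.card_filter_le _ _).trans (card_filter_card_missSet_card_falseSet_le hka)
  calc _ ≤ jointLaw S P' ((⋃ V ∈ C', D V) ∪ ⋃ T ∈ Ts, N T) := by
        refine measure_mono fun p hp => ?_
        obtain ⟨h1, h2, h3⟩ := hp
        set V := φ.dec p.1 (received p.1 W p.2.1 p.2.2) with hV
        by_cases hg : IsGood W (missSet W V) (bConst S ka) (b1Const S r' ka k' t) ω ν₀ p.1
          (received p.1 W p.2.1 p.2.2)
        · refine Or.inl (Set.mem_biUnion (x := V) (Finset.mem_filter.2
            ⟨Finset.mem_filter.2 ⟨Finset.mem_univ _, h2, h3⟩, ?_⟩) ⟨hV.symm, h1, hg⟩)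
          rw [← h1]
          exact φ.dec_size _ _
        · exact Or.inr (Set.mem_biUnion (x := missSet W V)
            (Finset.mem_powersetCard.2 ⟨missSet_subset W V, h2⟩) hg)
    _ ≤ ∑ V ∈ C', jointLaw S P' (D V) + ∑ T ∈ Ts, jointLaw S P' (N T) :=
        (measure_union_le _ _).trans
          (add_le_add (measure_biUnion_finset_le _ _) (measure_biUnion_finset_le _ _))
    _ ≤ C'.card • confusionBound S P' r' ka k' t t' ω ν₀ + Ts.card • β := by
        refine add_le_add (Finset.sum_le_card_nsmul _ _ _ fun V hV => ?_)
          (Finset.sum_le_card_nsmul _ _ _ fun T hT => ?_)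
        · obtain ⟨hV1, hV2⟩ := Finset.mem_filter.1 hV
          obtain ⟨-, hV3, hV4⟩ := Finset.mem_filter.1 hV1
          exact jointLaw_dec_eq_le φ hka hV3 hV4 hV2 ω ν₀
        · obtain ⟨hT1, hT2⟩ := Finset.mem_powersetCard.1 hT
          exact hgood W T hka hT1 hT2
    _ ≤ _ := by
        rw [q1_eq, nsmul_eq_mul, nsmul_eq_mul]
        refine add_le_add (by gcongr) (le_trans (le_of_eq ?_) hβ)
        rw [Finset.card_powersetCard, hka]

/-! ### Existence of the receiver and the power constraint -/

/-- Finitely many measurable functions have a measurable minimizer, also under a measurable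
constraint on the candidates. -/
theorem exists_measurable_argmin {X ι : Type*} [MeasurableSpace X] [Finite ι] {s : X → Set ι}
    (hs : ∀ i, MeasurableSet {x | i ∈ s x}) (hne : ∀ x, (s x).Nonempty) {f : ι → X → ℝ}
    (hf : ∀ i, Measurable (f i)) :
    ∃ g : X → ι, (∀ i, MeasurableSet {x | g x = i}) ∧
      ∀ x, g x ∈ s x ∧ ∀ j ∈ s x, f (g x) x ≤ f j x := by
  let m : X → Set ι := fun x => {i | i ∈ s x ∧ ∀ j ∈ s x, f i x ≤ f j x}
  have hm : ∀ x, (m x).Nonempty := fun x =>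
    Set.exists_min_image (s x) (fun i => f i x) (Set.toFinite _) (hne x)
  have hmi : ∀ i, MeasurableSet {x | i ∈ m x} := by
    intro i
    have : {x | i ∈ m x} = {x | i ∈ s x} ∩ ⋂ j, ({x | j ∈ s x}ᶜ ∪ {x | f i x ≤ f j x}) := by
      ext x
      simp only [m, Set.mem_ofPred_eq, Set.mem_inter_iff, Set.mem_iInter, Set.mem_union,
        Set.mem_compl_iff, imp_iff_not_or]
    rw [this]
    exact (hs i).inter (MeasurableSet.iInter fun j =>
      (hs j).compl.union (measurableSet_le (hf i) (hf j)))
  have hmM : ∀ M : Set ι, MeasurableSet {x | m x = M} := by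
    intro M
    have : {x | m x = M} = ⋂ i, {x | i ∈ m x ↔ i ∈ M} := by
      ext x
      simp only [Set.mem_ofPred_eq, Set.mem_iInter, Set.ext_iff]
    rw [this]
    refine MeasurableSet.iInter fun i => ?_
    by_cases hi : i ∈ M
    · simpa only [hi, iff_true] using hmi i
    · simp only [hi, iff_false]
      exact (hmi i).compl
  refine ⟨fun x => (hm x).choose, fun i => ?_, fun x => (hm x).choose_spec⟩
  -- the choice depends on the set of minimizers only
  have : {x | (hm x).choose = i}
      = ⋃ M ∈ {M : Set ι | ∃ h : M.Nonempty, h.choose = i}, {x | m x = M} := by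
    ext x
    simp only [Set.mem_ofPred_eq, Set.mem_iUnion, exists_prop]
    constructor
    · exact fun h => ⟨m x, ⟨hm x, h⟩, rfl⟩
    · rintro ⟨M, ⟨h, hi⟩, rfl⟩
      exact hi
  rw [this]
  exact MeasurableSet.biUnion (Set.to_countable _) fun M _ => hmM M

theorem measurable_mapMetric {S : Model} (V : S.Messages) :
    Measurable fun q : S.Codebook × S.Signal => mapMetric q.1 q.2 V := by
  simp only [mapMetric_eq_metric]
  refine measurable_metric (fun i j => ?_) measurable_snd _
  simp only [candidateCov, Matrix.add_apply, Matrix.sum_apply]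
  refine measurable_const.add (Finset.measurable_sum _ fun k _ => ?_)
  rcases V k with _ | m
  · exact measurable_const
  · simp only [Option.elim_some, Matrix.vecMulVec_apply, Pi.star_apply]
    have h : ∀ i, Measurable fun q : S.Codebook × S.Signal => q.1 k m i := fun i => by fun_prop
    exact (h i).mul (Complex.continuous_conj.measurable.comp (h j))

theorem exists_card_activeSet_eq {S : Model} {k : ℕ} (hk : k ≤ S.K) :
    ∃ V : S.Messages, (activeSet V).card = k := by
  obtain ⟨T, -, hT⟩ := Finset.exists_subset_card_eq
    (s := (Finset.univ : Finset (Fin S.K))) (by simpa using hk)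
  refine ⟨fun k => if k ∈ T then some ⟨0, Nat.two_pow_pos _⟩ else none, ?_⟩
  rw [← hT]
  congr 1
  ext k
  simp [mem_activeSet]

theorem nonempty_energyMAPReceiver (S : Model) (P' : ℝ) (r' : ℕ) :
    Nonempty (EnergyMAPReceiver S P' r') := by
  obtain ⟨g, hg, hg'⟩ := exists_measurable_argmin (X := S.Signal) (ι := Fin (S.K + 1))
    (s := fun _ => Set.univ) (by simp) (fun _ => Set.univ_nonempty)
    (f := fun k Y => energyMetric S P' Y k) (fun k => by unfold energyMetric; fun_prop)
  have hest : Measurable fun Y => (g Y).val :=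
    (measurable_from_top (f := Fin.val)).comp (measurable_to_countable' hg)
  obtain ⟨d, hd, hd'⟩ := exists_measurable_argmin (X := S.Codebook × S.Signal) (ι := S.Messages)
    (s := fun q => {V | (activeSet V).card ∈ Finset.Icc (lowK r' (g q.2).val)
      (highK S r' (g q.2).val)})
    (fun V => (hest.comp measurable_snd) (MeasurableSet.of_discrete (s := {k : ℕ |
      (activeSet V).card ∈ Finset.Icc (lowK r' k) (highK S r' k)})))
    (fun q => by
      have hk := (g q.2).is_lt
      obtain ⟨V, hV⟩ := exists_card_activeSet_eq (S := S) (k := lowK r' (g q.2).val)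
        (by rw [lowK]; omega)
      refine ⟨V, ?_⟩
      rw [Set.mem_ofPred_eq, hV, Finset.mem_Icc, lowK, highK]
      omega)
    (f := fun V q => mapMetric q.1 q.2 V) measurable_mapMetric
  exact ⟨{
    est := fun Y => (g Y).val
    measurable_est := hest
    est_le := fun Y => Nat.lt_succ_iff.1 (g Y).is_lt
    est_min := fun Y k hk => (hg' Y).2 ⟨k, Nat.lt_succ_iff.2 hk⟩ (Set.mem_univ _)
    dec := fun c Y => d (c, Y)
    measurable_dec := hd
    dec_size := fun c Y => (hd' (c, Y)).1
    dec_min := fun c Y V hV => (hd' (c, Y)).2 V hV }⟩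

theorem powerConstraint_code {S : Model} {P P' : ℝ} {r' : ℕ} (φ : EnergyMAPReceiver S P' r')
    (hP : 0 ≤ P) : (φ.code P).PowerConstraint P := by
  intro c k m
  change ∑ i, ‖truncate S P c k m i‖ ^ 2 ≤ S.n * P
  unfold truncate
  split_ifs with h
  · exact h
  · simpa using mul_nonneg (Nat.cast_nonneg S.n) hP

/-! ### The law of the messages -/

/-- The users are independent. -/
theorem sum_prior_mul_prod (S : Model) (q : Fin S.K → Option (Fin S.M) → ℝ) :
    ∑ W : S.Messages, prior S W * ∏ k, q k (W k)
      = ∏ k, ((1 - S.pa) * q k none + ∑ m, S.pa / S.M * q k (some m)) := by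
  simp only [prior, ← Finset.prod_mul_distrib]
  have h : ∀ k, (1 - S.pa) * q k none + ∑ m, S.pa / S.M * q k (some m)
      = ∑ o : Option (Fin S.M), o.elim (1 - S.pa) (fun _ => S.pa / S.M) * q k o := fun k => by
    rw [Fintype.sum_option]; rfl
  simp only [h]
  rw [Finset.prod_univ_sum, Fintype.piFinset_univ]

theorem prior_nonneg {S : Model} (h0 : 0 ≤ S.pa) (h1 : S.pa ≤ 1) (W : S.Messages) :
    0 ≤ prior S W := by
  refine Finset.prod_nonneg fun k _ => ?_
  rcases W k with _ | m
  · exact sub_nonneg.2 h1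
  · exact div_nonneg h0 (Nat.cast_nonneg _)

theorem cast_M_ne_zero (S : Model) : (S.M : ℝ) ≠ 0 := by
  simp [Model.M]

/-- The mean number of active users. -/
theorem sum_prior_mul_card_activeSet (S : Model) :
    ∑ W : S.Messages, prior S W * (activeSet W).card = S.K * S.pa := by
  have h1 : ∀ W : S.Messages, ((activeSet W).card : ℝ)
      = ∑ k, ∏ j, if j = k then (W j).elim 0 (fun _ => 1) else (1 : ℝ) := by
    intro W
    rw [activeSet, Finset.card_filter, Nat.cast_sum]
    refine Finset.sum_congr rfl fun k _ => ?_
    rw [Finset.prod_ite_eq' Finset.univ k, if_pos (Finset.mem_univ k)]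
    rcases W k with _ | m <;> simp
  simp only [h1, Finset.mul_sum]
  rw [Finset.sum_comm]
  have h2 : ∀ k : Fin S.K, ∑ W : S.Messages, prior S W *
      ∏ j, (if j = k then (W j).elim 0 (fun _ => 1) else (1 : ℝ)) = S.pa := by
    intro k
    rw [sum_prior_mul_prod S fun j o => if j = k then o.elim 0 (fun _ => 1) else 1]
    have h3 : ∀ j : Fin S.K, ((1 - S.pa) * (if j = k then (none : Option (Fin S.M)).elim 0
          (fun _ => 1) else 1) + ∑ m : Fin S.M, S.pa / S.M *
            (if j = k then (some m).elim 0 (fun _ => 1) else 1))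
        = if j = k then S.pa else 1 := by
      intro j
      have hM := cast_M_ne_zero S
      split_ifs
      · simp [mul_div_cancel₀, hM]
      · simp [mul_div_cancel₀, hM]
    rw [Finset.prod_congr rfl fun j _ => h3 j, Finset.prod_ite_eq' Finset.univ k,
      if_pos (Finset.mem_univ k)]
  rw [Finset.sum_congr rfl fun k _ => h2 k]
  simp

/-- The number of active users is binomial. -/
theorem sum_prior_card_activeSet_eq (S : Model) (ka : ℕ) :
    ∑ W : S.Messages with (activeSet W).card = ka, prior S W = activeProb S ka := by
  have h1 : ∀ T : Finset (Fin S.K), ∑ W : S.Messages with activeSet W = T, prior S W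
      = S.pa ^ T.card * (1 - S.pa) ^ (S.K - T.card) := by
    intro T
    have hq : ∀ W : S.Messages, (if activeSet W = T then prior S W else 0)
        = prior S W * ∏ j, (W j).elim (if j ∈ T then 0 else 1)
            (fun _ => if j ∈ T then (1 : ℝ) else 0) := by
      intro W
      split_ifs with h
      · rw [Finset.prod_eq_one fun j _ => ?_, mul_one]
        simp only [← h, mem_activeSet]
        rcases W j with _ | m <;> simp
      · obtain ⟨j, hj⟩ : ∃ j, ¬ (j ∈ activeSet W ↔ j ∈ T) := by
          by_contra! hcon
          exact h (Finset.ext hcon)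
        rw [Finset.prod_eq_zero (Finset.mem_univ j), mul_zero]
        rw [mem_activeSet] at hj
        rcases hW : W j with _ | m <;> simp only [hW] at hj <;> simpa using hj
    rw [Finset.sum_filter, Finset.sum_congr rfl fun W _ => hq W, sum_prior_mul_prod S
      fun j o => o.elim (if j ∈ T then 0 else 1) (fun _ => if j ∈ T then (1 : ℝ) else 0)]
    have h3 : ∀ j : Fin S.K, ((1 - S.pa) * ((none : Option (Fin S.M)).elim
          (if j ∈ T then 0 else 1) (fun _ => if j ∈ T then (1 : ℝ) else 0)) +
          ∑ m : Fin S.M, S.pa / S.M * ((some m).elim (if j ∈ T then 0 else 1)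
            (fun _ => if j ∈ T then (1 : ℝ) else 0)))
        = if j ∈ T then S.pa else 1 - S.pa := by
      intro j
      have hM := cast_M_ne_zero S
      split_ifs
      · simp [mul_div_cancel₀, hM]
      · simp
    rw [Finset.prod_congr rfl fun j _ => h3 j, Finset.prod_ite, Finset.prod_const,
      Finset.prod_const, Finset.filter_not, Finset.filter_mem_eq_inter, Finset.univ_inter,
      Finset.card_sdiff_of_subset (Finset.subset_univ T), Finset.card_univ, Fintype.card_fin]
  have h2 : (Finset.univ.filter fun W : S.Messages => (activeSet W).card = ka)
      = (Finset.powersetCard ka Finset.univ).biUnion fun T =>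
        Finset.univ.filter fun W : S.Messages => activeSet W = T := by
    ext W
    simp [Finset.mem_powersetCard]
  rw [h2, Finset.sum_biUnion fun T _ T' _ hTT' => Finset.disjoint_left.2 fun W h h' =>
    hTT' ((Finset.mem_filter.1 h).2.symm.trans (Finset.mem_filter.1 h').2)]
  rw [Finset.sum_congr rfl fun T hT => by rw [h1, (Finset.mem_powersetCard.1 hT).2]]
  rw [Finset.sum_const, Finset.card_powersetCard, Finset.card_univ, Fintype.card_fin,
    nsmul_eq_mul, activeProb, mul_assoc]

/-! ### The cost of the power constraint -/

/-- The probability that a codeword violates the power constraint. -/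
theorem codebookLaw_power_lt_le {S : Model} (hn : 1 ≤ S.n) {P' : ℝ} (hP' : 0 < P') (P : ℝ)
    (k : Fin S.K) (m : Fin S.M) :
    codebookLaw S P' {c | S.n * P < ∑ i, ‖c k m i‖ ^ 2}
      ≤ ENNReal.ofReal (1 - gammaRatio S.n (S.n * P / P')) := by
  have : Nonempty (Fin S.n) := ⟨⟨0, hn⟩⟩
  have hmp : MeasurePreserving (fun c : S.Codebook => c k m) (codebookLaw S P')
      (Measure.pi fun _ : Fin S.n => complexGaussian P') :=
    (measurePreserving_eval (fun _ : Fin S.M => Measure.pi fun _ : Fin S.n => complexGaussian P')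
      m).comp (measurePreserving_eval (fun _ : Fin S.K => gaussianArray S.M S.n P') k)
  have hs : MeasurableSet {x : Fin S.n → ℂ | S.n * P < ∑ i, ‖x i‖ ^ 2} :=
    measurableSet_lt measurable_const (by fun_prop)
  have h1 := stdGaussian_le_sq_norm (ι := Fin S.n) (S.n * P / P')
  rw [Fintype.card_fin] at h1
  rw [← h1]
  change codebookLaw S P' ((fun c : S.Codebook => c k m) ⁻¹' {x | S.n * P < ∑ i, ‖x i‖ ^ 2}) ≤ _
  rw [hmp.measure_preimage hs.nullMeasurableSet, pi_complexGaussian_eq_map _ hP'.le,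
    Measure.map_apply (by fun_prop) hs]
  refine measure_mono fun z hz => ?_
  simp only [Set.mem_preimage, Set.mem_ofPred_eq, norm_mul, mul_pow, Complex.norm_real,
    Real.norm_eq_abs, sq_abs, Real.sq_sqrt hP'.le, ← Finset.mul_sum] at hz ⊢
  rw [div_le_iff₀ hP']
  linarith

theorem measurable_received {S : Model} {X : Type*} [MeasurableSpace X] {x : X → S.Codebook}
    (hx : Measurable x) (W : S.Messages) {h : X → S.Fading × S.Signal} (hh : Measurable h) :
    Measurable fun p => received (x p) W (h p).1 (h p).2 := by
  unfold received
  refine measurable_pi_lambda _ fun i => measurable_pi_lambda _ fun l => ?_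
  have h1 : ∀ k, Measurable fun p => (h p).1 k l := fun k => by fun_prop
  have h2 : ∀ k m, Measurable fun p => x p k m i := fun k m => by fun_prop
  have h3 : Measurable fun p => (h p).2 i l := by fun_prop
  refine (Finset.measurable_sum _ fun k _ => (h1 k).mul ?_).add h3
  rcases W k with _ | m
  · exact measurable_const
  · exact h2 k m

/-- Any event that is determined by the outputs of the receiver is measurable. -/
theorem measurableSet_receiver {S : Model} {P' : ℝ} {r' : ℕ} (φ : EnergyMAPReceiver S P' r')
    {X : Type*} [MeasurableSpace X] {c : X → S.Codebook} (hc : Measurable c) {Y : X → S.Signal}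
    (hY : Measurable Y) (Q : ℕ → S.Messages → Prop) :
    MeasurableSet {p | Q (φ.est (Y p)) (φ.dec (c p) (Y p))} := by
  have : {p | Q (φ.est (Y p)) (φ.dec (c p) (Y p))}
      = ⋃ (k : ℕ) (V : S.Messages) (_ : Q k V), {p | φ.est (Y p) = k} ∩
        {p | φ.dec (c p) (Y p) = V} := by
    ext p
    simp only [Set.mem_ofPred_eq, Set.mem_iUnion, Set.mem_inter_iff, exists_prop]
    exact ⟨fun h => ⟨_, _, h, rfl, rfl⟩, fun ⟨k, V, h, h1, h2⟩ => by rw [h1, h2]; exact h⟩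
  rw [this]
  refine MeasurableSet.iUnion fun k => MeasurableSet.iUnion fun V => MeasurableSet.iUnion fun _ =>
    MeasurableSet.inter ?_ ?_
  · exact (φ.measurable_est.comp hY) (measurableSet_singleton k)
  · exact (hc.prodMk hY) (φ.measurable_dec V)

theorem measurable_receiver {S : Model} {P' : ℝ} {r' : ℕ} (φ : EnergyMAPReceiver S P' r')
    {X : Type*} [MeasurableSpace X] {c : X → S.Codebook} (hc : Measurable c) {Y : X → S.Signal}
    (hY : Measurable Y) (f : S.Messages → ℝ≥0∞) :
    Measurable fun p => f (φ.dec (c p) (Y p)) :=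
  fun s _ => measurableSet_receiver φ hc hY fun _ V => f V ∈ s

/-- Truncation changes the received signal only if the codeword of an active user is too long. -/
theorem received_truncate {S : Model} {P : ℝ} {c : S.Codebook} {W : S.Messages}
    (h : ∀ k m, W k = some m → ∑ i, ‖c k m i‖ ^ 2 ≤ S.n * P) (x : S.Fading) (z : S.Signal) :
    received (truncate S P c) W x z = received c W x z := by
  ext i l
  simp only [received]
  congr 1
  refine Finset.sum_congr rfl fun k _ => ?_
  rcases hW : W k with _ | m
  · rfl
  · simp only [Option.elim_some, truncate, if_pos (h k m hW)]

/-- The effect of the truncation on the error is at most the mean number of active users whose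
codeword is too long. -/
theorem lintegral_truncate_le {S : Model} (hn : 1 ≤ S.n) {P P' : ℝ} (hP' : 0 < P') {r' : ℕ}
    (φ : EnergyMAPReceiver S P' r') {f : S.Messages → S.Messages → ℝ} (hf : ∀ W V, f W V ≤ 1)
    (W : S.Messages) :
    ∫⁻ p, ENNReal.ofReal (f W (φ.dec p.1 (received (truncate S P p.1) W p.2.1 p.2.2)))
        ∂(jointLaw S P')
      ≤ ∫⁻ p, ENNReal.ofReal (f W (φ.dec p.1 (received p.1 W p.2.1 p.2.2))) ∂(jointLaw S P')
        + (activeSet W).card * ENNReal.ofReal (1 - gammaRatio S.n (S.n * P / P')) := by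
  let O : Fin S.K → Set (S.Codebook × (S.Fading × S.Signal)) := fun k =>
    {p | ∃ m, W k = some m ∧ S.n * P < ∑ i, ‖p.1 k m i‖ ^ 2}
  have hO : ∀ k ∈ activeSet W, MeasurableSet (O k) ∧
      jointLaw S P' (O k) ≤ ENNReal.ofReal (1 - gammaRatio S.n (S.n * P / P')) := by
    intro k hk
    obtain ⟨m, hm⟩ := Option.ne_none_iff_exists'.1 (mem_activeSet.1 hk)
    have h1 : O k = Prod.fst ⁻¹' {c : S.Codebook | S.n * P < ∑ i, ‖c k m i‖ ^ 2} := by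
      ext p
      simp [O, hm]
    have h2 : MeasurableSet {c : S.Codebook | S.n * P < ∑ i, ‖c k m i‖ ^ 2} :=
      measurableSet_lt measurable_const (by fun_prop)
    rw [h1]
    refine ⟨measurable_fst h2, ?_⟩
    rw [measurePreserving_fst.measure_preimage h2.nullMeasurableSet]
    exact codebookLaw_power_lt_le hn hP' P k m
  have hmeas : Measurable fun p : S.Codebook × (S.Fading × S.Signal) =>
      ENNReal.ofReal (f W (φ.dec p.1 (received p.1 W p.2.1 p.2.2))) :=
    measurable_receiver φ measurable_fst (measurable_received measurable_fst W measurable_snd)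
      fun V => ENNReal.ofReal (f W V)
  calc _ ≤ ∫⁻ p, (ENNReal.ofReal (f W (φ.dec p.1 (received p.1 W p.2.1 p.2.2)))
            + ∑ k ∈ activeSet W, (O k).indicator 1 p) ∂(jointLaw S P') := by
        refine lintegral_mono fun p => ?_
        by_cases h : ∀ k m, W k = some m → ∑ i, ‖p.1 k m i‖ ^ 2 ≤ S.n * P
        · rw [received_truncate h]
          exact le_self_add
        · push Not at h
          obtain ⟨k, m, hk, hkm⟩ := h
          have hk' : k ∈ activeSet W := mem_activeSet.2 (by rw [hk]; exact Option.some_ne_none m)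
          refine le_trans ?_ le_add_self
          refine le_trans ?_ (Finset.single_le_sum
            (f := fun k => (O k).indicator (1 : S.Codebook × (S.Fading × S.Signal) → ℝ≥0∞) p)
            (fun _ _ => bot_le) hk')
          have hp : p ∈ O k := ⟨m, hk, hkm⟩
          simp only [Set.indicator_of_mem hp, Pi.one_apply]
          exact ENNReal.ofReal_le_one.2 (hf _ _)
    _ = _ + ∑ k ∈ activeSet W, jointLaw S P' (O k) := by
        rw [lintegral_add_left hmeas, lintegral_finsetSum']
        · congr 1
          exact Finset.sum_congr rfl fun k hk => lintegral_indicator_one (hO k hk).1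
        · exact fun k hk => (measurable_one.indicator (hO k hk).1).aemeasurable
    _ ≤ _ := by
        gcongr
        rw [← nsmul_eq_mul]
        exact Finset.sum_le_card_nsmul _ _ _ fun k hk => (hO k hk).2

/-- Averaging over the messages a bound that depends on the number of active users. -/
theorem lintegral_expectedError_truncate_le {S : Model} (hn : 1 ≤ S.n) (h0 : 0 ≤ S.pa)
    (h1 : S.pa ≤ 1) {P P' : ℝ} (hP' : 0 < P') {r' : ℕ} (φ : EnergyMAPReceiver S P' r')
    {f : S.Messages → S.Messages → ℝ} (hf : ∀ W V, f W V ≤ 1) {G : ℕ → ℝ≥0∞}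
    (hG : ∀ W, ∫⁻ p, ENNReal.ofReal (f W (φ.dec p.1 (received p.1 W p.2.1 p.2.2)))
      ∂(jointLaw S P') ≤ G (activeSet W).card) :
    ∫⁻ c, expectedError f (truncate S P c) (φ.dec c) ∂(codebookLaw S P')
      ≤ p0 S P P' + ∑ ka ∈ Finset.Icc 0 S.K, ENNReal.ofReal (activeProb S ka) * G ka := by
  have hmeas : ∀ W, Measurable fun p : S.Codebook × (S.Fading × S.Signal) =>
      ENNReal.ofReal (f W (φ.dec p.1 (received (truncate S P p.1) W p.2.1 p.2.2))) := fun W =>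
    measurable_receiver φ measurable_fst
      (measurable_received ((measurable_truncate S P).comp measurable_fst) W measurable_snd)
      fun V => ENNReal.ofReal (f W V)
  have hprior := prior_nonneg h0 h1
  calc _ = ∑ W : S.Messages, ENNReal.ofReal (prior S W) * ∫⁻ p,
          ENNReal.ofReal (f W (φ.dec p.1 (received (truncate S P p.1) W p.2.1 p.2.2)))
            ∂(jointLaw S P') := by
        unfold expectedError
        rw [lintegral_finsetSum _ fun W _ => ((hmeas W).lintegral_prod_right').const_mul _]
        refine Finset.sum_congr rfl fun W _ => ?_
        rw [lintegral_const_mul _ (hmeas W).lintegral_prod_right',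
          lintegral_prod _ (hmeas W).aemeasurable]
    _ ≤ ∑ W : S.Messages, ENNReal.ofReal (prior S W) * (G (activeSet W).card +
          (activeSet W).card * ENNReal.ofReal (1 - gammaRatio S.n (S.n * P / P'))) := by
        gcongr with W
        exact (lintegral_truncate_le hn hP' φ hf W).trans (by gcongr; exact hG W)
    _ = ∑ W : S.Messages, ENNReal.ofReal (prior S W * (activeSet W).card) *
          ENNReal.ofReal (1 - gammaRatio S.n (S.n * P / P'))
          + ∑ W : S.Messages, ENNReal.ofReal (prior S W) * G (activeSet W).card := by
        rw [← Finset.sum_add_distrib]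
        refine Finset.sum_congr rfl fun W _ => ?_
        rw [ENNReal.ofReal_mul (hprior W), ENNReal.ofReal_natCast, mul_add, add_comm, mul_assoc]
    _ = _ := by
        congr 1
        · rw [← Finset.sum_mul, ← ENNReal.ofReal_sum_of_nonneg
            fun W _ => mul_nonneg (hprior W) (Nat.cast_nonneg _), sum_prior_mul_card_activeSet,
            ← ENNReal.ofReal_mul (mul_nonneg (Nat.cast_nonneg _) h0), p0, mul_comm (S.K : ℝ)]
        · rw [← Finset.sum_fiberwise_of_maps_to (s := Finset.univ) (t := Finset.Icc 0 S.K)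
            (g := fun W : S.Messages => (activeSet W).card)
            fun W _ => Finset.mem_Icc.2 ⟨Nat.zero_le _, by
              simpa using Finset.card_le_univ (activeSet W)⟩]
          refine Finset.sum_congr rfl fun ka _ => ?_
          rw [← sum_prior_card_activeSet_eq, ENNReal.ofReal_sum_of_nonneg fun W _ => hprior W,
            Finset.sum_mul]
          exact Finset.sum_congr rfl fun W hW => by rw [(Finset.mem_filter.1 hW).2]

/-! ### The error probabilities -/

/-- An integral is bounded through events that cover the support of the integrand, with a bound on
the integrand on each of them. -/
theorem lintegral_le_sum_mul_measure {X I : Type*} [MeasurableSpace X] {μ : Measure X}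
    {s : Finset I} {E : I → Set X} (hE : ∀ i, MeasurableSet (E i)) {a : I → ℝ≥0∞} {f : X → ℝ≥0∞}
    (h : ∀ x, f x ≠ 0 → ∃ i ∈ s, x ∈ E i ∧ f x ≤ a i) :
    ∫⁻ x, f x ∂μ ≤ ∑ i ∈ s, a i * μ (E i) := by
  calc ∫⁻ x, f x ∂μ ≤ ∫⁻ x, ∑ i ∈ s, (E i).indicator (fun _ => a i) x ∂μ := by
        refine lintegral_mono fun x => ?_
        by_cases hx : f x = 0
        · rw [hx]
          exact bot_le
        · obtain ⟨i, hi, hxi, hle⟩ := h x hx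
          refine le_trans ?_ (Finset.single_le_sum (f := fun i => (E i).indicator (fun _ => a i) x)
            (fun _ _ => bot_le) hi)
          simpa only [Set.indicator_of_mem hxi] using hle
    _ = ∑ i ∈ s, a i * μ (E i) := by
        rw [lintegral_finsetSum _ fun i _ => measurable_const.indicator (hE i)]
        exact Finset.sum_congr rfl fun i _ => lintegral_indicator_const (hE i) _

theorem misdetectionFraction_eq {S : Model} (W V : S.Messages) :
    misdetectionFraction W V = (missSet W V).card / (activeSet W).card := by
  rw [misdetectionFraction, ← missSet]
  split_ifs with h
  · rfl
  · have : (activeSet W).card = 0 := by omega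
    simp [this]

theorem falseAlarmFraction_eq {S : Model} (W V : S.Messages) :
    falseAlarmFraction W V = (falseSet W V).card / (activeSet V).card := by
  rw [falseAlarmFraction, ← falseSet]
  split_ifs with h
  · rfl
  · have : (activeSet V).card = 0 := by omega
    simp [this]

theorem misdetectionFraction_le_one {S : Model} (W V : S.Messages) :
    misdetectionFraction W V ≤ 1 := by
  rw [misdetectionFraction_eq]
  exact div_le_one_of_le₀ (by exact_mod_cast card_missSet_le W V) (Nat.cast_nonneg _)

theorem falseAlarmFraction_le_one {S : Model} (W V : S.Messages) :
    falseAlarmFraction W V ≤ 1 := by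
  rw [falseAlarmFraction_eq]
  exact div_le_one_of_le₀ (by exact_mod_cast card_falseSet_le W V) (Nat.cast_nonneg _)

theorem ofReal_natCast_div_natCast {a b : ℕ} (hb : b ≠ 0) :
    ENNReal.ofReal ((a : ℝ) / b) = (a : ℝ≥0∞) / b := by
  rw [ENNReal.ofReal_div_of_pos (by exact_mod_cast Nat.pos_of_ne_zero hb), ENNReal.ofReal_natCast,
    ENNReal.ofReal_natCast]

/-- The constraint on the size of the decoded list forces at least `missForced` misdetections and
`falseForced` false alarms; `t` and `t'` count the remaining ones. -/
theorem exists_card_missSet_card_falseSet {S : Model} {r' k' ka : ℕ} {W V : S.Messages}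
    (hka : (activeSet W).card = ka)
    (hV : (activeSet V).card ∈ Finset.Icc (lowK r' k') (highK S r' k')) :
    ∃ t ∈ rangeT S r' ka k', ∃ t' ∈ rangeTBar S r' ka k' t,
      (missSet W V).card = missCount S r' ka k' t ∧ (falseSet W V).card = falseCount r' ka k' t' ∧
      (activeSet V).card = detCount S r' ka k' t t' ∧
      ((activeSet V).card ≠ 0 → t' ∈ rangeT' S r' ka k' t) := by
  have h1 := card_activeSet_sub_missSet W V
  have h2 := card_missSet_le W V
  have h3 := card_falseSet_le W V
  obtain ⟨h4, h5⟩ := Finset.mem_Icc.1 hV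
  rw [hka] at h1 h2
  refine ⟨(missSet W V).card - missForced S r' ka k', ?_,
    (falseSet W V).card - falseForced r' ka k', ?_⟩
  · rw [rangeT, Finset.mem_Icc, missForced]
    omega
  · simp only [rangeTBar, rangeT', Finset.mem_Icc, detCount, missCount, falseCount, missForced,
      falseForced]
    omega

theorem lintegral_misdetectionFraction_le {S : Model} (hn : 1 ≤ S.n) (hL : 1 ≤ S.L) {P' : ℝ}
    (hP' : 0 < P') {r' : ℕ} (φ : EnergyMAPReceiver S P' r') {W : S.Messages} {ka : ℕ}
    (hka : (activeSet W).card = ka) :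
    ∫⁻ p, ENNReal.ofReal (misdetectionFraction W (φ.dec p.1 (received p.1 W p.2.1 p.2.2)))
        ∂(jointLaw S P')
      ≤ ∑ k' ∈ Finset.Icc 0 S.K, ∑ t ∈ rangeT S r' ka k',
        (missCount S r' ka k' t : ℝ≥0∞) / (ka : ℝ≥0∞) *
          min 1 (min (∑ t' ∈ rangeTBar S r' ka k' t, pErr S P' r' ka k' t t')
            (pEst S P' ka k')) := by
  let E : (Σ _ : ℕ, ℕ) → Set (S.Codebook × (S.Fading × S.Signal)) := fun i =>
    {p | φ.est (received p.1 W p.2.1 p.2.2) = i.1 ∧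
      (missSet W (φ.dec p.1 (received p.1 W p.2.1 p.2.2))).card = missCount S r' ka i.1 i.2 ∧
      ∃ t' ∈ rangeTBar S r' ka i.1 i.2,
        (falseSet W (φ.dec p.1 (received p.1 W p.2.1 p.2.2))).card = falseCount r' ka i.1 t'}
  have hE : ∀ i, MeasurableSet (E i) := fun i =>
    measurableSet_receiver φ measurable_fst (measurable_received measurable_fst W measurable_snd)
      fun k V => k = i.1 ∧ (missSet W V).card = missCount S r' ka i.1 i.2 ∧
        ∃ t' ∈ rangeTBar S r' ka i.1 i.2, (falseSet W V).card = falseCount r' ka i.1 t'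
  rw [Finset.sum_sigma']
  refine (lintegral_le_sum_mul_measure hE (s := (Finset.Icc 0 S.K).sigma fun k' =>
    rangeT S r' ka k') (a := fun i => (missCount S r' ka i.1 i.2 : ℝ≥0∞) / (ka : ℝ≥0∞))
    fun p hp => ?_).trans (Finset.sum_le_sum fun i _ => ?_)
  · set Y := received p.1 W p.2.1 p.2.2 with hY
    obtain ⟨t, ht, t', ht', h1, h2, -, -⟩ :=
      exists_card_missSet_card_falseSet hka (φ.dec_size p.1 Y)
    refine ⟨⟨φ.est Y, t⟩, Finset.mem_sigma.2 ⟨Finset.mem_Icc.2 ⟨Nat.zero_le _, φ.est_le Y⟩, ht⟩,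
      ⟨rfl, h1, t', ht', h2⟩, ?_⟩
    have hka0 : ka ≠ 0 := by
      rintro rfl
      simp [misdetectionFraction_eq, hka] at hp
    rw [misdetectionFraction_eq, hka, h1, ofReal_natCast_div_natCast hka0]
  · gcongr
    refine le_min prob_le_one (le_min ?_ ?_)
    · calc _ ≤ jointLaw S P' (⋃ t' ∈ rangeTBar S r' ka i.1 i.2,
            {p | φ.est (received p.1 W p.2.1 p.2.2) = i.1 ∧
        (missSet W (φ.dec p.1 (received p.1 W p.2.1 p.2.2))).card = missCount S r' ka i.1 i.2 ∧
        (falseSet W (φ.dec p.1 (received p.1 W p.2.1 p.2.2))).card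
          = falseCount r' ka i.1 t'}) := by
            refine measure_mono fun p ⟨h1, h2, t', ht', h3⟩ => ?_
            exact Set.mem_biUnion (x := t') ht' ⟨h1, h2, h3⟩
        _ ≤ _ := measure_biUnion_finset_le _ _
        _ ≤ _ := Finset.sum_le_sum fun t' _ => jointLaw_card_errors_le hn hL hP' φ hka i.1 i.2 t'
    · exact (measure_mono fun p hp => hp.1).trans (jointLaw_est_eq_le hn hL hP' φ hka i.1)

theorem lintegral_falseAlarmFraction_le {S : Model} (hn : 1 ≤ S.n) (hL : 1 ≤ S.L) {P' : ℝ}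
    (hP' : 0 < P') {r' : ℕ} (φ : EnergyMAPReceiver S P' r') {W : S.Messages} {ka : ℕ}
    (hka : (activeSet W).card = ka) :
    ∫⁻ p, ENNReal.ofReal (falseAlarmFraction W (φ.dec p.1 (received p.1 W p.2.1 p.2.2)))
        ∂(jointLaw S P')
      ≤ ∑ k' ∈ Finset.Icc 0 S.K, ∑ t ∈ rangeT S r' ka k', ∑ t' ∈ rangeT' S r' ka k' t,
        (falseCount r' ka k' t' : ℝ≥0∞) / (detCount S r' ka k' t t' : ℝ≥0∞) *
          min 1 (min (pErr S P' r' ka k' t t') (pEst S P' ka k')) := by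
  let E : (Σ _ : (Σ _ : ℕ, ℕ), ℕ) → Set (S.Codebook × (S.Fading × S.Signal)) := fun i =>
    {p | φ.est (received p.1 W p.2.1 p.2.2) = i.1.1 ∧
      (missSet W (φ.dec p.1 (received p.1 W p.2.1 p.2.2))).card = missCount S r' ka i.1.1 i.1.2 ∧
      (falseSet W (φ.dec p.1 (received p.1 W p.2.1 p.2.2))).card = falseCount r' ka i.1.1 i.2}
  have hE : ∀ i, MeasurableSet (E i) := fun i =>
    measurableSet_receiver φ measurable_fst (measurable_received measurable_fst W measurable_snd)
      fun k V => k = i.1.1 ∧ (missSet W V).card = missCount S r' ka i.1.1 i.1.2 ∧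
        (falseSet W V).card = falseCount r' ka i.1.1 i.2
  rw [Finset.sum_sigma', Finset.sum_sigma']
  refine (lintegral_le_sum_mul_measure hE (s := ((Finset.Icc 0 S.K).sigma fun k' =>
    rangeT S r' ka k').sigma fun i => rangeT' S r' ka i.1 i.2)
    (a := fun i => (falseCount r' ka i.1.1 i.2 : ℝ≥0∞) /
      (detCount S r' ka i.1.1 i.1.2 i.2 : ℝ≥0∞))
    fun p hp => ?_).trans (Finset.sum_le_sum fun i _ => ?_)
  · set Y := received p.1 W p.2.1 p.2.2 with hY
    obtain ⟨t, ht, t', -, h1, h2, h3, h4⟩ :=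
      exists_card_missSet_card_falseSet hka (φ.dec_size p.1 Y)
    have hV0 : (activeSet (φ.dec p.1 Y)).card ≠ 0 := by
      intro h0
      simp [falseAlarmFraction_eq, h0] at hp
    refine ⟨⟨⟨φ.est Y, t⟩, t'⟩, Finset.mem_sigma.2 ⟨Finset.mem_sigma.2
      ⟨Finset.mem_Icc.2 ⟨Nat.zero_le _, φ.est_le Y⟩, ht⟩, h4 hV0⟩, ⟨rfl, h1, h2⟩, ?_⟩
    rw [falseAlarmFraction_eq, ofReal_natCast_div_natCast hV0, h2, h3]
  · gcongr
    exact le_min prob_le_one (le_min (jointLaw_card_errors_le hn hL hP' φ hka i.1.1 i.1.2 i.2)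
      ((measure_mono fun p hp => hp.1).trans (jointLaw_est_eq_le hn hL hP' φ hka i.1.1)))

theorem misdetection_code_le {S : Model} (hn : 1 ≤ S.n) (hL : 1 ≤ S.L) (h0 : 0 ≤ S.pa)
    (h1 : S.pa ≤ 1) {P P' : ℝ} (hP' : 0 < P') {r' : ℕ} (φ : EnergyMAPReceiver S P' r') :
    (φ.code P).misdetection ≤ boundMD S r' P P' := by
  refine (lintegral_expectedError_truncate_le hn h0 h1 hP' φ misdetectionFraction_le_one
    (G := fun ka => if ka = 0 then 0 else ∑ k' ∈ Finset.Icc 0 S.K, ∑ t ∈ rangeT S r' ka k',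
        (missCount S r' ka k' t : ℝ≥0∞) / (ka : ℝ≥0∞) *
          min 1 (min (∑ t' ∈ rangeTBar S r' ka k' t, pErr S P' r' ka k' t t')
            (pEst S P' ka k'))) fun W => ?_).trans_eq ?_
  · split_ifs with h
    · simp [misdetectionFraction_eq, h]
    · exact lintegral_misdetectionFraction_le hn hL hP' φ rfl
  · rw [boundMD]
    congr 1
    have hsub : Finset.Icc 1 S.K ⊆ Finset.Icc 0 S.K := Finset.Icc_subset_Icc_left zero_le_one
    rw [← Finset.sum_subset hsub fun ka hka hka' => ?_]
    · refine Finset.sum_congr rfl fun ka hka => ?_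
      rw [if_neg (by have := (Finset.mem_Icc.1 hka).1; omega)]
    · rw [Finset.mem_Icc] at hka hka'
      rw [if_pos (by omega), mul_zero]

theorem falseAlarm_code_le {S : Model} (hn : 1 ≤ S.n) (hL : 1 ≤ S.L) (h0 : 0 ≤ S.pa)
    (h1 : S.pa ≤ 1) {P P' : ℝ} (hP' : 0 < P') {r' : ℕ} (φ : EnergyMAPReceiver S P' r') :
    (φ.code P).falseAlarm ≤ boundFA S r' P P' :=
  lintegral_expectedError_truncate_le hn h0 h1 hP' φ falseAlarmFraction_le_one
    fun _ => lintegral_falseAlarmFraction_le hn hL hP' φ rfl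

end MassiveAccess

end

theorem mainTheorem7 (S : MassiveAccess.Model) (hK : 1 ≤ S.K) (hn : 1 ≤ S.n) (hL : 1 ≤ S.L)
    (hJ : 1 ≤ S.J) (hpa0 : 0 < S.pa) (hpa1 : S.pa < 1) (r' : ℕ) :
    (∀ P P' : ℝ, 0 < P' → P' < P →
      Nonempty (MassiveAccess.EnergyMAPReceiver S P' r') ∧
      ∀ φ : MassiveAccess.EnergyMAPReceiver S P' r',
        (φ.code P).PowerConstraint P ∧
        (φ.code P).misdetection ≤ MassiveAccess.boundMD S r' P P' ∧
        (φ.code P).falseAlarm ≤ MassiveAccess.boundFA S r' P P') ∧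
    (∀ εMD εFA : NNReal,
      MassiveAccess.minEnergyPerBit S εMD εFA ≤
        ⨅ (P : ℝ) (_ : 0 < P ∧ ∃ P' : ℝ, 0 < P' ∧ P' < P ∧
            MassiveAccess.boundMD S r' P P' ≤ εMD ∧ MassiveAccess.boundFA S r' P P' ≤ εFA),
          ENNReal.ofReal (S.n * P / S.J)) := by
  have key : ∀ P P' : ℝ, 0 < P' → P' < P →
      Nonempty (MassiveAccess.EnergyMAPReceiver S P' r') ∧
      ∀ φ : MassiveAccess.EnergyMAPReceiver S P' r',
        (φ.code P).PowerConstraint P ∧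
        (φ.code P).misdetection ≤ MassiveAccess.boundMD S r' P P' ∧
        (φ.code P).falseAlarm ≤ MassiveAccess.boundFA S r' P P' := fun P P' hP' hP =>
    ⟨MassiveAccess.nonempty_energyMAPReceiver S P' r', fun φ =>
      ⟨MassiveAccess.powerConstraint_code φ (hP'.trans hP).le,
        MassiveAccess.misdetection_code_le hn hL hpa0.le hpa1.le hP' φ,
        MassiveAccess.falseAlarm_code_le hn hL hpa0.le hpa1.le hP' φ⟩⟩
  refine ⟨key, fun εMD εFA => le_iInf fun P => le_iInf fun ⟨hP0, P', hP', hP, hMD, hFA⟩ => ?_⟩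
  obtain ⟨⟨φ⟩, h⟩ := key P P' hP' hP
  obtain ⟨h1, h2, h3⟩ := h φ
  exact iInf_le_of_le P (iInf_le_of_le hP0 (iInf_le _
    ⟨S.Codebook, inferInstance, φ.code P, h1, h2.trans hMD, h3.trans hFA⟩))
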